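/- Let $a<c<b<d$ and $u_a,u_b,\rho_c,\rho_d$ be real numbers. Consider the zero-pressure gas dynamics system $u_t+(u^2/2)_x=0$, $\rho_t+(\rho u)_x=0$ on $\mathbb R\times(0,\infty)$ with data $u|_{t=0}=u_a\delta_a+u_b\delta_b$, $\rho|_{t=0}=\rho_c\delta_c+\rho_d\delta_d$, and, for $\epsilon>0$, its viscous approximation (the modified adhesion model) $$u^\epsilon_t+\Big(\tfrac{(u^\epsilon)^2}{2}\Big)_x=\tfrac{\epsilon}{2}u^\epsilon_{xx},\qquad \rho^\epsilon_t+(\rho^\epsilon u^\epsilon)_x=\tfrac{\epsilon}{2}\rho^\epsilon_{xx},\qquad u^\epsilon|_{t=0}=u_a\delta_a+u_b\delta_b,\quad \rho^\epsilon|_{t=0}=\rho_c\delta_c+\rho_d\delta_d .$$ An approximate solution is a pair $(u^\epsilon,\rho^\epsilon)$ of $C^2$ functions on $\mathbb R\times(0,\infty)$ that solves this system for $t>0$, takes the initial data in the sense of distributions as $t\to0+$, and has the form $(U^\epsilon_x,R^\epsilon_x)$, where $(U^\epsilon,R^\epsilon)$ is bounded, $C^2$ for $t>0$, solves $U_t+\frac{(U_x)^2}{2}=\frac\epsilon2U_{xx}$,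 $R_t+R_xU_x=\frac\epsilon2R_{xx}$, and tends as $t\to0+$ to the step data $U=0,\ u_a,\ u_a+u_b$ on $x<a$, $a<x<b$, $x>b$ and $R=0,\ \rho_c,\ \rho_c+\rho_d$ on $x<c$, $c<x<d$, $x>d$. **(Existence and explicit form.)** Put $\operatorname{erfc}(z)=\int_z^\infty e^{-s^2}ds$ and, for $p\in\{a,b,c,d\}$, $E_p=\operatorname{erfc}\big(-\frac{x-p}{\sqrt{2t\epsilon}}\big)$, and let $$N^\epsilon=\sqrt\pi-E_a+e^{-u_a/\epsilon}(E_a-E_b)+e^{-(u_a+u_b)/\epsilon}E_b .$$ For every $\epsilon>0$ an approximate solution is given by $$u^\epsilon=\frac{\epsilon}{\sqrt{2t\epsilon}}\cdot\frac{e^{-\frac{(x-a)^2}{2t\epsilon}}\big(1-e^{-u_a/\epsilon}\big)+e^{-\frac{(x-b)^2}{2t\epsilon}}\big(e^{-u_a/\epsilon}-e^{-(u_a+u_b)/\epsilon}\big)}{N^\epsilon},$$ $$\rho^\epsilon=R^\epsilon_x,\qquad R^\epsilon=\frac{\rho_ce^{-u_a/\epsilon}(E_c-E_b)+\rho_ce^{-(u_a+u_b)/\epsilon}(E_b-E_d)+(\rho_c+\rho_d)e^{-(u_a+u_b)/\epsilon}E_d}{N^\epsilon}.$$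 **(Limits.)** Let $(u^\epsilon,\rho^\epsilon)_{\epsilon>0}$ be any family of approximate solutions. In each of the six cases below, with the curves given there, the following holds as $\epsilon\to0+$. For every $t>0$ and every $x$ in one of the listed open sets, $u^\epsilon(x,t)$ converges to the listed value $u(x,t)$. For every $\epsilon>0$ and every test function $\phi\in C_c^\infty(\mathbb R\times[0,\infty))$ the product $\rho^\epsilon\phi$ is integrable on $\mathbb R\times(0,\infty)$, and $\rho^\epsilon$ converges in the sense of distributions to $\rho=\rho_c\,\delta_{x=\gamma_c(t)}+\rho_d\,\delta_{x=\gamma_d(t)}$, that is, $$\int_0^\infty\!\!\int_{\mathbb R}\rho^\epsilon\phi\,dx\,dt\ \longrightarrow\ \int_0^\infty\big(\rho_c\,\phi(\gamma_c(t),t)+\rho_d\,\phi(\gamma_d(t),t)\big)\,dt .$$ *Case 1: $u_a<0$, $u_b>0$.* $\gamma_a=a-\sqrt{-2u_at}$, $\gamma_b=b+\sqrt{2u_bt}$, $\gamma_c=c$, and $\gamma_d=d$ for $t\le\frac{(d-b)^2}{2u_b}$, $\gamma_d=b+\sqrt{2u_bt}$ afterwards. $u=0$ on $(-\infty,\gamma_a)\cup(a,b)\cup(\gamma_b,\infty)$;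 $u=\frac{x-a}t$ on $(\gamma_a,a)$; $u=\frac{x-b}t$ on $(b,\gamma_b)$. *Case 2: $u_a>0$, $u_b>0$.* Let $t_1=\frac{(b-a)^2}{2u_a}$, $t^*=\frac{(b-a)^2}{2(\sqrt{u_a+u_b}-\sqrt{u_b})^2}$, $x^*=b+\frac{(b-a)\sqrt{u_b}}{\sqrt{u_a+u_b}-\sqrt{u_b}}$, $l=\frac{a+b}2+\frac{u_a}{b-a}t$, $p=a+\sqrt{2(u_a+u_b)t}$. $\gamma_a=a+\sqrt{2u_at}$ for $t\le t_1$, $l$ for $t_1\le t\le t^*$, $p$ for $t\ge t^*$. $\gamma_{b,1}=b$ for $t\le t_1$, $l$ for $t_1\le t\le t^*$, $p$ for $t\ge t^*$. $\gamma_{b,2}=b+\sqrt{2u_bt}$ for $t\le t^*$, $p$ for $t\ge t^*$. $\gamma_c=c$ for $t\le\frac{(c-a)^2}{2u_a}$, then $a+\sqrt{2u_at}$ until $t_1$, then $l$ until $t^*$, then $p$. If $d<x^*$: $\gamma_d=d$ for $t\le\frac{(d-b)^2}{2u_b}$, then $b+\sqrt{2u_bt}$ until $t^*$, then $p$. If $d=x^*$: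 $\gamma_d=d$ until $t^*$, then $p$. If $d>x^*$: $\gamma_d=d$ for $t\le\frac{(d-a)^2}{2(u_a+u_b)}$, then $p$. $u=0$ on $(-\infty,a)\cup(\gamma_a,\gamma_{b,1})\cup(\gamma_{b,2},\infty)$; $u=\frac{x-a}t$ on $(a,\gamma_a)$; $u=\frac{x-b}t$ on $(\gamma_{b,1},\gamma_{b,2})$. In Cases 3 and 4 let $t^*=\frac{(b-a)^2}{2(\sqrt{u_a}+\sqrt{-u_b})^2}$, $x^*=a+\frac{(b-a)\sqrt{u_a}}{\sqrt{u_a}+\sqrt{-u_b}}$, $l=\frac{a+b}2+\frac{u_a+u_b}{b-a}t$. *Case 3: $u_a>0$, $u_b<0$, $u_a+u_b>0$.* Let $t_2=\frac{(b-a)^2}{2(u_a+u_b)}$, $p=a+\sqrt{2(u_a+u_b)t}$. $\gamma_a=a+\sqrt{2u_at}$ for $t\le t^*$, $l$ for $t^*\le t\le t_2$, $p$ for $t\ge t_2$. $\gamma_{b,1}=b-\sqrt{-2u_bt}$ for $t\le t^*$, $l$ for $t^*\le t\le t_2$, $p$ for $t\ge t_2$. $\gamma_{b,2}=b$ for $t\le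 t_2$, $p$ for $t\ge t_2$. $\gamma_d=d$ for $t\le\frac{(d-a)^2}{2(u_a+u_b)}$, then $p$. If $c<x^*$: $\gamma_c=c$ for $t\le\frac{(c-a)^2}{2u_a}$, then $a+\sqrt{2u_at}$ until $t^*$, then $l$ until $t_2$, then $p$. If $c=x^*$: $\gamma_c=c$ until $t^*$, then $l$ until $t_2$, then $p$. If $c>x^*$: $\gamma_c=c$ for $t\le\frac{(b-c)^2}{-2u_b}$, then $b-\sqrt{-2u_bt}$ until $t^*$, then $l$ until $t_2$, then $p$. $u=0$ on $(-\infty,a)\cup(\gamma_a,\gamma_{b,1})\cup(\gamma_{b,2},\infty)$; $u=\frac{x-a}t$ on $(a,\gamma_a)$; $u=\frac{x-b}t$ on $(\gamma_{b,1},\gamma_{b,2})$. *Case 4: $u_a>0$, $u_b<0$, $u_a+u_b<0$.* Let $t_2=\frac{(b-a)^2}{-2(u_a+u_b)}$, $q=b-\sqrt{-2(u_a+u_b)t}$. $\gamma_{a,1}=a$ for $t\le t_2$, $q$ for $t\ge t_2$. $\gamma_{a,2}=a+\sqrt{2u_at}$ for $t\le t^*$, $l$ for $t^*\le t\le t_2$,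 $q$ for $t\ge t_2$. $\gamma_b=b-\sqrt{-2u_bt}$ for $t\le t^*$, $l$ for $t^*\le t\le t_2$, $q$ for $t\ge t_2$. $\gamma_d=d$, and $\gamma_c$ is given as in Case 3 (three subcases $c<x^*$, $c=x^*$, $c>x^*$), with the present $t_2$ and with $q$ in place of $p$. $u=0$ on $(-\infty,\gamma_{a,1})\cup(\gamma_{a,2},\gamma_b)\cup(b,\infty)$; $u=\frac{x-a}t$ on $(\gamma_{a,1},\gamma_{a,2})$; $u=\frac{x-b}t$ on $(\gamma_b,b)$. *Case 5: $u_a>0$, $u_b<0$, $u_a+u_b=0$.* Let $t^*=\frac{(b-a)^2}{2(\sqrt{u_a}+\sqrt{-u_b})^2}$. $\gamma_a=a+\sqrt{2u_at}$ for $t\le t^*$, $\frac{a+b}2$ afterwards; $\gamma_b=b-\sqrt{-2u_bt}$ for $t\le t^*$, $\frac{a+b}2$ afterwards; $\gamma_d=d$. If $c<\frac{a+b}2$: $\gamma_c=c$ for $t\le\frac{(c-a)^2}{2u_a}$, then $a+\sqrt{2u_at}$ until $t^*$, then $\frac{a+b}2$. If $c=\frac{a+b}2$: $\gamma_c=\frac{a+b}2$.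 If $c>\frac{a+b}2$: $\gamma_c=c$ for $t\le\frac{(b-c)^2}{-2u_b}$, then $b-\sqrt{-2u_bt}$ until $t^*$, then $\frac{a+b}2$. $u=0$ on $(-\infty,a)\cup(\gamma_a,\gamma_b)\cup(b,\infty)$; $u=\frac{x-a}t$ on $(a,\gamma_a)$; $u=\frac{x-b}t$ on $(\gamma_b,b)$. *Case 6: $u_a<0$, $u_b<0$.* Let $t_1=\frac{(b-a)^2}{-2u_b}$, $t^*=\frac{(b-a)^2}{2(\sqrt{-(u_a+u_b)}-\sqrt{-u_a})^2}$, $l=\frac{a+b}2+\frac{u_b}{b-a}t$, $q=b-\sqrt{-2(u_a+u_b)t}$. $\gamma_{a,1}=a-\sqrt{-2u_at}$ for $t\le t^*$, $q$ for $t\ge t^*$. $\gamma_{a,2}=a$ for $t\le t_1$, $l$ for $t_1\le t\le t^*$, $q$ for $t\ge t^*$. $\gamma_b=b-\sqrt{-2u_bt}$ for $t\le t_1$, $l$ for $t_1\le t\le t^*$, $q$ for $t\ge t^*$. $\gamma_c=c$ for $t\le\frac{(b-c)^2}{-2u_b}$, then $b-\sqrt{-2u_bt}$ until $t_1$, then $l$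 until $t^*$, then $q$; $\gamma_d=d$. $u=0$ on $(-\infty,\gamma_{a,1})\cup(\gamma_{a,2},\gamma_b)\cup(b,\infty)$; $u=\frac{x-a}t$ on $(\gamma_{a,1},\gamma_{a,2})$; $u=\frac{x-b}t$ on $(\gamma_b,b)$. -/

import Mathlib

open Real Set Filter Topology MeasureTheory
open scoped ContDiff

noncomputable section

/-- `∂f/∂x` for a function `f` of `(x, t)`. -/
def dx (f : ℝ → ℝ → ℝ) (x t : ℝ) : ℝ := deriv (fun y => f y t) x

/-- `∂f/∂t` for a function `f` of `(x, t)`. -/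
def dt (f : ℝ → ℝ → ℝ) (x t : ℝ) : ℝ := deriv (fun s => f x s) t

/-- The open upper half-plane `{(x, t) : t > 0}`. -/
def upperHalf : Set (ℝ × ℝ) := {p | 0 < p.2}

/-- A bounded classical solution `(U, R)`, for `t > 0`, of the system
`U_t + (U_x)² / 2 = (ε/2) U_xx`, `R_t + R_x U_x = (ε/2) R_xx`, with the step functions
`U(x,0) = 0, u_a, u_a + u_b` (on `x < a`, `a < x < b`, `x > b`) and
`R(x,0) = 0, ρ_c, ρ_c + ρ_d` (on `x < c`, `c < x < d`, `x > d`) as initial data. -/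
structure IsPotentialSolution (a b c d ua ub ρc ρd ε : ℝ) (U R : ℝ → ℝ → ℝ) : Prop where
  smooth_U : ContDiffOn ℝ 2 (fun p : ℝ × ℝ => U p.1 p.2) upperHalf
  smooth_R : ContDiffOn ℝ 2 (fun p : ℝ × ℝ => R p.1 p.2) upperHalf
  bounded : ∃ M : ℝ, ∀ x t : ℝ, 0 < t → |U x t| ≤ M ∧ |R x t| ≤ M
  eq_U : ∀ x t : ℝ, 0 < t → dt U x t + (dx U x t) ^ 2 / 2 = ε / 2 * dx (dx U) x t
  eq_R : ∀ x t : ℝ, 0 < t → dt R x t + dx R x t * dx U x t = ε / 2 * dx (dx R) x t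
  init_U_left : ∀ x : ℝ, x < a → Tendsto (fun t => U x t) (𝓝[>] 0) (𝓝 0)
  init_U_mid : ∀ x : ℝ, a < x → x < b → Tendsto (fun t => U x t) (𝓝[>] 0) (𝓝 ua)
  init_U_right : ∀ x : ℝ, b < x → Tendsto (fun t => U x t) (𝓝[>] 0) (𝓝 (ua + ub))
  init_R_left : ∀ x : ℝ, x < c → Tendsto (fun t => R x t) (𝓝[>] 0) (𝓝 0)
  init_R_mid : ∀ x : ℝ, c < x → x < d → Tendsto (fun t => R x t) (𝓝[>] 0) (𝓝 ρc)
  init_R_right : ∀ x : ℝ, d < x → Tendsto (fun t => R x t) (𝓝[>] 0) (𝓝 (ρc + ρd))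

/-- `(u, ρ)` is an approximate solution with viscosity `ε`: a classical solution, for `t > 0`, of
the modified adhesion model `u_t + (u²/2)_x = (ε/2) u_xx`, `ρ_t + (ρ u)_x = (ε/2) ρ_xx` which
attains the data `u_a δ_a + u_b δ_b`, `ρ_c δ_c + ρ_d δ_d` in the sense of distributions as
`t → 0+`, and which is of the form `(U_x, R_x)` with `(U, R)` a bounded solution of the
integrated system. -/
structure IsApproximateSolution (a b c d ua ub ρc ρd ε : ℝ) (u ρ : ℝ → ℝ → ℝ) : Prop where
  smooth_u : ContDiffOn ℝ 2 (fun p : ℝ × ℝ => u p.1 p.2) upperHalf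
  smooth_ρ : ContDiffOn ℝ 2 (fun p : ℝ × ℝ => ρ p.1 p.2) upperHalf
  eq_u : ∀ x t : ℝ, 0 < t →
    dt u x t + dx (fun y s => (u y s) ^ 2 / 2) x t = ε / 2 * dx (dx u) x t
  eq_ρ : ∀ x t : ℝ, 0 < t →
    dt ρ x t + dx (fun y s => ρ y s * u y s) x t = ε / 2 * dx (dx ρ) x t
  init_u : ∀ ψ : ℝ → ℝ, ContDiff ℝ ∞ ψ → HasCompactSupport ψ →
    Tendsto (fun t => ∫ x, u x t * ψ x) (𝓝[>] 0) (𝓝 (ua * ψ a + ub * ψ b))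
  init_ρ : ∀ ψ : ℝ → ℝ, ContDiff ℝ ∞ ψ → HasCompactSupport ψ →
    Tendsto (fun t => ∫ x, ρ x t * ψ x) (𝓝[>] 0) (𝓝 (ρc * ψ c + ρd * ψ d))
  potential : ∃ U R : ℝ → ℝ → ℝ, IsPotentialSolution a b c d ua ub ρc ρd ε U R ∧
    ∀ x t : ℝ, 0 < t → u x t = dx U x t ∧ ρ x t = dx R x t

/-- The unnormalised complementary error function `erfc z = ∫_z^∞ e^{-s²} ds`. -/
def erfc (z : ℝ) : ℝ := ∫ s in Ioi z, exp (-s ^ 2)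

/-- The denominator `√π V^ε(x,t)` common to the explicit formulas for `u^ε` and `R^ε`. -/
def explicitDenom (a b ua ub ε x t : ℝ) : ℝ :=
  √π - erfc (-((x - a) / √(2 * t * ε)))
    + exp (-ua / ε) * (erfc (-((x - a) / √(2 * t * ε))) - erfc (-((x - b) / √(2 * t * ε))))
    + exp (-(ua + ub) / ε) * erfc (-((x - b) / √(2 * t * ε)))

/-- The explicit velocity `u^ε`. -/
def explicitU (a b ua ub ε x t : ℝ) : ℝ :=
  ε / √(2 * t * ε) *
    ((exp (-(x - a) ^ 2 / (2 * t * ε)) * (1 - exp (-ua / ε))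
      + exp (-(x - b) ^ 2 / (2 * t * ε)) * (exp (-ua / ε) - exp (-(ua + ub) / ε)))
      / explicitDenom a b ua ub ε x t)

/-- The explicit potential `R^ε` of the density. -/
def explicitR (a b c d ua ub ρc ρd ε x t : ℝ) : ℝ :=
  (ρc * exp (-ua / ε) *
      (erfc (-((x - c) / √(2 * t * ε))) - erfc (-((x - b) / √(2 * t * ε))))
    + ρc * exp (-(ua + ub) / ε) *
      (erfc (-((x - b) / √(2 * t * ε))) - erfc (-((x - d) / √(2 * t * ε))))
    + (ρc + ρd) * exp (-(ua + ub) / ε) * erfc (-((x - d) / √(2 * t * ε))))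
    / explicitDenom a b ua ub ε x t

/-- The explicit density `ρ^ε = (R^ε)_x`. -/
def explicitρ (a b c d ua ub ρc ρd ε x t : ℝ) : ℝ :=
  dx (explicitR a b c d ua ub ρc ρd ε) x t

/-- For every `t > 0`, as `ε → 0+`, `u^ε(x,t)` tends to `0` for `x ∈ Z t`, to `(x-a)/t` for
`x ∈ A t` and to `(x-b)/t` for `x ∈ B t`. -/
def VelocityLimit (u : ℝ → ℝ → ℝ → ℝ) (a b : ℝ) (Z A B : ℝ → Set ℝ) : Prop :=
  ∀ t : ℝ, 0 < t →
    (∀ x ∈ Z t, Tendsto (fun ε => u ε x t) (𝓝[>] 0) (𝓝 0)) ∧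
    (∀ x ∈ A t, Tendsto (fun ε => u ε x t) (𝓝[>] 0) (𝓝 ((x - a) / t))) ∧
    (∀ x ∈ B t, Tendsto (fun ε => u ε x t) (𝓝[>] 0) (𝓝 ((x - b) / t)))

/-- As `ε → 0+`, `ρ^ε` tends to `ρ_c δ_{x = γ_c(t)} + ρ_d δ_{x = γ_d(t)}` in the sense of
distributions, the test functions being the smooth compactly supported functions on
`ℝ × [0, ∞)`. -/
def DensityLimit (ρ : ℝ → ℝ → ℝ → ℝ) (ρc ρd : ℝ) (γc γd : ℝ → ℝ) : Prop :=
  ∀ φ : ℝ × ℝ → ℝ, ContDiff ℝ ∞ φ → HasCompactSupport φ →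
    (∀ ε : ℝ, 0 < ε → IntegrableOn (fun p : ℝ × ℝ => ρ ε p.1 p.2 * φ p) upperHalf) ∧
    Tendsto (fun ε => ∫ p in upperHalf, ρ ε p.1 p.2 * φ p) (𝓝[>] 0)
      (𝓝 (∫ t in Ioi (0 : ℝ), (ρc * φ (γc t, t) + ρd * φ (γd t, t))))

/-! In each case the curves are functions of `t ≥ 0`. -/

namespace Case1

def γa (a ua t : ℝ) : ℝ := a - √(-2 * ua * t)

def γb (b ub t : ℝ) : ℝ := b + √(2 * ub * t)

def γc (c : ℝ) (_t : ℝ) : ℝ := c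

def γd (b d ub t : ℝ) : ℝ :=
  if t ≤ (d - b) ^ 2 / (2 * ub) then d else b + √(2 * ub * t)

end Case1

namespace Case2

/-- The abscissa `x*` of the interaction point. -/
def xStar (a b ua ub : ℝ) : ℝ := b + (b - a) * √ub / (√(ua + ub) - √ub)

/-- The time `t*` of the interaction point. -/
def tStar (a b ua ub : ℝ) : ℝ := (b - a) ^ 2 / (2 * (√(ua + ub) - √ub) ^ 2)

def γa (a b ua ub t : ℝ) : ℝ :=
  if t ≤ (b - a) ^ 2 / (2 * ua) then a + √(2 * ua * t)
  else if t ≤ tStar a b ua ub then (a + b) / 2 + ua / (b - a) * t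
  else a + √(2 * (ua + ub) * t)

def γb₁ (a b ua ub t : ℝ) : ℝ :=
  if t ≤ (b - a) ^ 2 / (2 * ua) then b
  else if t ≤ tStar a b ua ub then (a + b) / 2 + ua / (b - a) * t
  else a + √(2 * (ua + ub) * t)

def γb₂ (a b ua ub t : ℝ) : ℝ :=
  if t ≤ tStar a b ua ub then b + √(2 * ub * t)
  else a + √(2 * (ua + ub) * t)

def γc (a b c ua ub t : ℝ) : ℝ :=
  if t ≤ (c - a) ^ 2 / (2 * ua) then c
  else if t ≤ (b - a) ^ 2 / (2 * ua) then a + √(2 * ua * t)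
  else if t ≤ tStar a b ua ub then (a + b) / 2 + ua / (b - a) * t
  else a + √(2 * (ua + ub) * t)

/-- The three branches are the subcases `d < x*`, `d = x*` and `d > x*`. -/
def γd (a b d ua ub t : ℝ) : ℝ :=
  if d < xStar a b ua ub then
    if t ≤ (d - b) ^ 2 / (2 * ub) then d
    else if t ≤ tStar a b ua ub then b + √(2 * ub * t)
    else a + √(2 * (ua + ub) * t)
  else if d = xStar a b ua ub then
    if t ≤ tStar a b ua ub then d
    else a + √(2 * (ua + ub) * t)
  else
    if t ≤ (d - a) ^ 2 / (2 * (ua + ub)) then d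
    else a + √(2 * (ua + ub) * t)

end Case2

namespace Case3

/-- The abscissa `x*` of the interaction point. -/
def xStar (a b ua ub : ℝ) : ℝ := a + (b - a) * √ua / (√ua + √(-ub))

/-- The time `t*` of the interaction point. -/
def tStar (a b ua ub : ℝ) : ℝ := (b - a) ^ 2 / (2 * (√ua + √(-ub)) ^ 2)

def γa (a b ua ub t : ℝ) : ℝ :=
  if t ≤ tStar a b ua ub then a + √(2 * ua * t)
  else if t ≤ (b - a) ^ 2 / (2 * (ua + ub)) then (a + b) / 2 + (ua + ub) / (b - a) * t
  else a + √(2 * (ua + ub) * t)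

def γb₁ (a b ua ub t : ℝ) : ℝ :=
  if t ≤ tStar a b ua ub then b - √(-2 * ub * t)
  else if t ≤ (b - a) ^ 2 / (2 * (ua + ub)) then (a + b) / 2 + (ua + ub) / (b - a) * t
  else a + √(2 * (ua + ub) * t)

def γb₂ (a b ua ub t : ℝ) : ℝ :=
  if t ≤ (b - a) ^ 2 / (2 * (ua + ub)) then b
  else a + √(2 * (ua + ub) * t)

/-- The three branches are the subcases `c < x*`, `c = x*` and `c > x*`. -/
def γc (a b c ua ub t : ℝ) : ℝ :=
  if c < xStar a b ua ub then
    if t ≤ (c - a) ^ 2 / (2 * ua) then c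
    else if t ≤ tStar a b ua ub then a + √(2 * ua * t)
    else if t ≤ (b - a) ^ 2 / (2 * (ua + ub)) then (a + b) / 2 + (ua + ub) / (b - a) * t
    else a + √(2 * (ua + ub) * t)
  else if c = xStar a b ua ub then
    if t ≤ tStar a b ua ub then c
    else if t ≤ (b - a) ^ 2 / (2 * (ua + ub)) then (a + b) / 2 + (ua + ub) / (b - a) * t
    else a + √(2 * (ua + ub) * t)
  else
    if t ≤ (b - c) ^ 2 / (-2 * ub) then c
    else if t ≤ tStar a b ua ub then b - √(-2 * ub * t)
    else if t ≤ (b - a) ^ 2 / (2 * (ua + ub)) then (a + b) / 2 + (ua + ub) / (b - a) * t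
    else a + √(2 * (ua + ub) * t)

def γd (a d ua ub t : ℝ) : ℝ :=
  if t ≤ (d - a) ^ 2 / (2 * (ua + ub)) then d
  else a + √(2 * (ua + ub) * t)

end Case3

namespace Case4

/-- The abscissa `x*` of the interaction point. -/
def xStar (a b ua ub : ℝ) : ℝ := a + (b - a) * √ua / (√ua + √(-ub))

/-- The time `t*` of the interaction point. -/
def tStar (a b ua ub : ℝ) : ℝ := (b - a) ^ 2 / (2 * (√ua + √(-ub)) ^ 2)

def γa₁ (a b ua ub t : ℝ) : ℝ :=
  if t ≤ (b - a) ^ 2 / (-2 * (ua + ub)) then a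
  else b - √(-2 * (ua + ub) * t)

def γa₂ (a b ua ub t : ℝ) : ℝ :=
  if t ≤ tStar a b ua ub then a + √(2 * ua * t)
  else if t ≤ (b - a) ^ 2 / (-2 * (ua + ub)) then (a + b) / 2 + (ua + ub) / (b - a) * t
  else b - √(-2 * (ua + ub) * t)

def γb (a b ua ub t : ℝ) : ℝ :=
  if t ≤ tStar a b ua ub then b - √(-2 * ub * t)
  else if t ≤ (b - a) ^ 2 / (-2 * (ua + ub)) then (a + b) / 2 + (ua + ub) / (b - a) * t
  else b - √(-2 * (ua + ub) * t)

/-- The three branches are the subcases `c < x*`, `c = x*` and `c > x*`. -/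
def γc (a b c ua ub t : ℝ) : ℝ :=
  if c < xStar a b ua ub then
    if t ≤ (c - a) ^ 2 / (2 * ua) then c
    else if t ≤ tStar a b ua ub then a + √(2 * ua * t)
    else if t ≤ (b - a) ^ 2 / (-2 * (ua + ub)) then (a + b) / 2 + (ua + ub) / (b - a) * t
    else b - √(-2 * (ua + ub) * t)
  else if c = xStar a b ua ub then
    if t ≤ tStar a b ua ub then c
    else if t ≤ (b - a) ^ 2 / (-2 * (ua + ub)) then (a + b) / 2 + (ua + ub) / (b - a) * t
    else b - √(-2 * (ua + ub) * t)
  else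
    if t ≤ (b - c) ^ 2 / (-2 * ub) then c
    else if t ≤ tStar a b ua ub then b - √(-2 * ub * t)
    else if t ≤ (b - a) ^ 2 / (-2 * (ua + ub)) then (a + b) / 2 + (ua + ub) / (b - a) * t
    else b - √(-2 * (ua + ub) * t)

def γd (d : ℝ) (_t : ℝ) : ℝ := d

end Case4

namespace Case5

/-- The time at which the two fronts meet. -/
def tStar (a b ua ub : ℝ) : ℝ := (b - a) ^ 2 / (2 * (√ua + √(-ub)) ^ 2)

def γa (a b ua ub t : ℝ) : ℝ :=
  if t ≤ tStar a b ua ub then a + √(2 * ua * t) else (a + b) / 2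

def γb (a b ua ub t : ℝ) : ℝ :=
  if t ≤ tStar a b ua ub then b - √(-2 * ub * t) else (a + b) / 2

/-- The three branches are the subcases `c < (a+b)/2`, `c = (a+b)/2` and `c > (a+b)/2`. -/
def γc (a b c ua ub t : ℝ) : ℝ :=
  if c < (a + b) / 2 then
    if t ≤ (c - a) ^ 2 / (2 * ua) then c
    else if t ≤ tStar a b ua ub then a + √(2 * ua * t)
    else (a + b) / 2
  else if c = (a + b) / 2 then (a + b) / 2
  else
    if t ≤ (b - c) ^ 2 / (-2 * ub) then c
    else if t ≤ tStar a b ua ub then b - √(-2 * ub * t)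
    else (a + b) / 2

def γd (d : ℝ) (_t : ℝ) : ℝ := d

end Case5

namespace Case6

/-- The time `(b-a)² / (2 (√(-(u_a+u_b)) - √(-u_a))²)` after which only one front is left. -/
def tStar (a b ua ub : ℝ) : ℝ := (b - a) ^ 2 / (2 * (√(-(ua + ub)) - √(-ua)) ^ 2)

def γa₁ (a b ua ub t : ℝ) : ℝ :=
  if t ≤ tStar a b ua ub then a - √(-2 * ua * t)
  else b - √(-2 * (ua + ub) * t)

def γa₂ (a b ua ub t : ℝ) : ℝ :=
  if t ≤ (b - a) ^ 2 / (-2 * ub) then a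
  else if t ≤ tStar a b ua ub then (a + b) / 2 + ub / (b - a) * t
  else b - √(-2 * (ua + ub) * t)

def γb (a b ua ub t : ℝ) : ℝ :=
  if t ≤ (b - a) ^ 2 / (-2 * ub) then b - √(-2 * ub * t)
  else if t ≤ tStar a b ua ub then (a + b) / 2 + ub / (b - a) * t
  else b - √(-2 * (ua + ub) * t)

def γc (a b c ua ub t : ℝ) : ℝ :=
  if t ≤ (b - c) ^ 2 / (-2 * ub) then c
  else if t ≤ (b - a) ^ 2 / (-2 * ub) then b - √(-2 * ub * t)
  else if t ≤ tStar a b ua ub then (a + b) / 2 + ub / (b - a) * t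
  else b - √(-2 * (ua + ub) * t)

def γd (d : ℝ) (_t : ℝ) : ℝ := d

end Case6

end

open Real Set Filter Topology MeasureTheory
open scoped ContDiff

noncomputable section

/-! ### The complementary error function -/

/-! The Hopf–Cole substitution V = exp(-U/ε), S = R V turns the integrated system into two copies of
the heat equation V_t = (ε/2) V_xx with step data. The explicit formulas are the quotients built
from error functions that solve these equations. Conversely, a bounded solution of the heat equation
is determined by its initial limits (`HeatSolution.eq_zero`, a weighted energy estimate), so every
approximate solution coincides with the explicit one for t > 0
(`IsApproximateSolution.eq_explicit`). Only the explicit one has to be followed as ε → 0.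

Up to the factor √(2tε), the common denominator is the total mass of the weight exp(-action/ε),
where the action of y at (x,t) is U₀(y) + (x-y)²/(2t). Under the normalised weight, u^ε is the mean
of (x-y)/t, and R^ε is ρ_c times the probability of y > c plus ρ_d times the probability of y > d.
By Laplace's method (`tendsto_setIntegral_gibbs_div`) this probability concentrates on the
minimizers of the action. Hence u^ε tends to (x-y₀)/t where y₀ is the only minimizer, and R^ε tends
to a step function whose jumps lie where the minimizers cross c and d (`IsFront`). The bound |R^ε| ≤
|ρ_c| + |ρ_d|, uniform in ε, allows integration by parts and dominated convergence to pass from R^ε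
to its derivative ρ^ε (`densityLimit_of_isFront`).

What remains is geometry. Minimizers increase with x, and a minimizer other than a and b is x
itself. It therefore suffices to exhibit minimizers at the points of the listed curves: on a shock
two of them coexist, between two points sharing the minimizer a or b there is a fan, and beside a
point that is its own minimizer there is a region at rest. With the distances √(2wt) as unknowns,
each such check becomes a handful of quadratic inequalities. -/

lemma integrable_exp_neg_sq : Integrable (fun s : ℝ => exp (-s ^ 2)) := by
  simpa using integrable_exp_neg_mul_sq (b := 1) one_pos

lemma integral_exp_neg_sq : ∫ s : ℝ, exp (-s ^ 2) = √π := by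
  simpa using integral_gaussian 1

lemma erfc_eq (z : ℝ) : erfc z = erfc 0 - ∫ s in (0 : ℝ)..z, exp (-s ^ 2) := by
  have h := intervalIntegral.integral_Ioi_sub_Ioi' (a := 0) (b := z)
    (integrable_exp_neg_sq.integrableOn) (integrable_exp_neg_sq.integrableOn)
  unfold erfc
  linarith

lemma hasDerivAt_erfc (z : ℝ) : HasDerivAt erfc (-exp (-z ^ 2)) z := by
  have hc : Continuous fun s : ℝ => exp (-s ^ 2) := by fun_prop
  have h := (hc.integral_hasStrictDerivAt 0 z).hasDerivAt.const_sub (erfc 0)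
  have e : erfc = fun z => erfc 0 - ∫ s in (0 : ℝ)..z, exp (-s ^ 2) := funext erfc_eq
  rw [e]
  simpa using h

lemma contDiff_erfc : ContDiff ℝ ∞ erfc := by
  rw [contDiff_infty_iff_deriv]
  refine ⟨fun z => (hasDerivAt_erfc z).differentiableAt, ?_⟩
  have e : deriv erfc = fun z => -exp (-z ^ 2) := funext fun z => (hasDerivAt_erfc z).deriv
  rw [e]
  fun_prop

lemma erfc_pos (z : ℝ) : 0 < erfc z := by
  unfold erfc
  rw [setIntegral_pos_iff_support_of_nonneg_ae]
  · have : Function.support (fun s : ℝ => exp (-s ^ 2)) = univ := by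
      ext s; simp [(exp_pos _).ne']
    rw [this]
    simp
  · exact Eventually.of_forall fun s => (exp_pos _).le
  · exact integrable_exp_neg_sq.integrableOn

lemma strictAnti_erfc : StrictAnti erfc :=
  strictAnti_of_deriv_neg fun z => by
    rw [(hasDerivAt_erfc z).deriv]
    exact neg_neg_of_pos (exp_pos _)

lemma tendsto_erfc_atTop : Tendsto erfc atTop (𝓝 0) := by
  have h := intervalIntegral_tendsto_integral_Ioi (μ := volume) 0
    (integrable_exp_neg_sq.integrableOn (s := Ioi 0)) tendsto_id
  have h2 := h.const_sub (erfc 0)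
  have e : erfc = fun z => erfc 0 - ∫ s in (0 : ℝ)..z, exp (-s ^ 2) := funext erfc_eq
  rw [e]
  simpa [erfc] using h2

lemma erfc_neg (z : ℝ) : erfc (-z) = √π - erfc z := by
  have h := intervalIntegral.integral_Iic_add_Ioi (b := z)
    (integrable_exp_neg_sq.integrableOn) (integrable_exp_neg_sq.integrableOn)
  have h2 := integral_comp_neg_Ioi z (fun s : ℝ => exp (-s ^ 2))
  have h3 := integral_comp_neg_Iic z (fun s : ℝ => exp (-s ^ 2))
  simp only [neg_sq] at h2 h3
  rw [integral_exp_neg_sq] at h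
  unfold erfc
  linarith

lemma erfc_lt (z : ℝ) : erfc z < √π := by
  have h := erfc_neg z
  have := erfc_pos (-z)
  linarith

lemma tendsto_erfc_atBot : Tendsto erfc atBot (𝓝 √π) := by
  have h := (tendsto_erfc_atTop.comp tendsto_neg_atBot_atTop).const_sub (√π)
  refine (h.congr fun z => ?_).trans (by simp)
  simp [erfc_neg]

/-! ### Elementary solutions of the heat equation -/

/-- `√π` times the solution of `V_t = (ε/2) V_xx` with the indicator of `(p, ∞)` as data. -/
def stepHeat (p ε x t : ℝ) : ℝ := erfc (-((x - p) / √(2 * t * ε)))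

/-- The space derivative of `stepHeat`. -/
def gaussHeat (p ε x t : ℝ) : ℝ := exp (-(x - p) ^ 2 / (2 * t * ε)) / √(2 * t * ε)

lemma stepHeat_pos (p ε x t : ℝ) : 0 < stepHeat p ε x t := erfc_pos _

lemma stepHeat_lt (p ε x t : ℝ) : stepHeat p ε x t < √π := erfc_lt _

lemma stepHeat_lt_stepHeat {p q ε x t : ℝ} (hε : 0 < ε) (ht : 0 < t) (hpq : p < q) :
    stepHeat q ε x t < stepHeat p ε x t := by
  apply strictAnti_erfc
  have : 0 < √(2 * t * ε) := by positivity
  gcongr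

lemma tendsto_inv_sqrt_nhdsGT {ε : ℝ} (hε : 0 < ε) :
    Tendsto (fun t => (√(2 * t * ε))⁻¹) (𝓝[>] 0) atTop := by
  apply Tendsto.inv_tendsto_nhdsGT_zero
  refine tendsto_nhdsWithin_iff.2 ⟨?_, ?_⟩
  · have : Continuous fun t => √(2 * t * ε) := by fun_prop
    simpa using (this.tendsto 0).mono_left nhdsWithin_le_nhds
  · filter_upwards [self_mem_nhdsWithin] with t ht
    have : (0 : ℝ) < t := ht
    exact mem_Ioi.2 (by positivity)

lemma tendsto_stepHeat_of_lt {p ε x : ℝ} (hε : 0 < ε) (hx : x < p) :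
    Tendsto (stepHeat p ε x) (𝓝[>] 0) (𝓝 0) := by
  refine tendsto_erfc_atTop.comp ?_
  refine ((tendsto_inv_sqrt_nhdsGT hε).const_mul_atTop (sub_pos.2 hx)).congr fun t => ?_
  ring

lemma tendsto_stepHeat_of_gt {p ε x : ℝ} (hε : 0 < ε) (hx : p < x) :
    Tendsto (stepHeat p ε x) (𝓝[>] 0) (𝓝 √π) := by
  refine tendsto_erfc_atBot.comp ?_
  refine ((tendsto_inv_sqrt_nhdsGT hε).const_mul_atTop_of_neg (sub_neg.2 hx)).congr fun t => ?_
  ring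

lemma contDiffOn_sqrt_upperHalf {ε : ℝ} (hε : 0 < ε) :
    ContDiffOn ℝ ∞ (fun q : ℝ × ℝ => √(2 * q.2 * ε)) upperHalf := by
  refine ContDiffOn.sqrt (by fun_prop) fun q hq => ?_
  have : 0 < q.2 := hq
  positivity

lemma sqrt_ne_zero_of_mem_upperHalf {ε : ℝ} (hε : 0 < ε) (q : ℝ × ℝ) (hq : q ∈ upperHalf) :
    √(2 * q.2 * ε) ≠ 0 := by
  have : 0 < q.2 := hq
  positivity

lemma contDiffOn_stepHeat (p : ℝ) {ε : ℝ} (hε : 0 < ε) :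
    ContDiffOn ℝ ∞ (fun q : ℝ × ℝ => stepHeat p ε q.1 q.2) upperHalf := by
  refine contDiff_erfc.comp_contDiffOn (ContDiffOn.neg (ContDiffOn.div (by fun_prop)
    (contDiffOn_sqrt_upperHalf hε) (sqrt_ne_zero_of_mem_upperHalf hε)))

lemma contDiffOn_gaussHeat (p : ℝ) {ε : ℝ} (hε : 0 < ε) :
    ContDiffOn ℝ ∞ (fun q : ℝ × ℝ => gaussHeat p ε q.1 q.2) upperHalf := by
  refine ContDiffOn.div (ContDiffOn.exp (ContDiffOn.div (by fun_prop) (by fun_prop) ?_))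
    (contDiffOn_sqrt_upperHalf hε) (sqrt_ne_zero_of_mem_upperHalf hε)
  intro q hq
  have : 0 < q.2 := hq
  positivity

/-- `V` solves `V_t = (ε/2) V_xx` for `t > 0`, with space derivatives `V₁, V₂, V₃`, and so does
`V₁`. -/
structure HeatJet (ε : ℝ) (V V₁ V₂ V₃ : ℝ → ℝ → ℝ) : Prop where
  x₀ : ∀ x t : ℝ, 0 < t → HasDerivAt (fun y => V y t) (V₁ x t) x
  x₁ : ∀ x t : ℝ, 0 < t → HasDerivAt (fun y => V₁ y t) (V₂ x t) x
  x₂ : ∀ x t : ℝ, 0 < t → HasDerivAt (fun y => V₂ y t) (V₃ x t) x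
  t₀ : ∀ x t : ℝ, 0 < t → HasDerivAt (fun s => V x s) (ε / 2 * V₂ x t) t
  t₁ : ∀ x t : ℝ, 0 < t → HasDerivAt (fun s => V₁ x s) (ε / 2 * V₃ x t) t

namespace HeatJet

variable {ε : ℝ} {V V₁ V₂ V₃ W W₁ W₂ W₃ : ℝ → ℝ → ℝ}

lemma const (k : ℝ) : HeatJet ε (fun _ _ => k) (fun _ _ => 0) (fun _ _ => 0) (fun _ _ => 0) := by
  constructor <;> intro x t _ <;> simpa using hasDerivAt_const _ _

lemma add (hV : HeatJet ε V V₁ V₂ V₃) (hW : HeatJet ε W W₁ W₂ W₃) :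
    HeatJet ε (fun x t => V x t + W x t) (fun x t => V₁ x t + W₁ x t)
      (fun x t => V₂ x t + W₂ x t) (fun x t => V₃ x t + W₃ x t) where
  x₀ x t ht := (hV.x₀ x t ht).add (hW.x₀ x t ht)
  x₁ x t ht := (hV.x₁ x t ht).add (hW.x₁ x t ht)
  x₂ x t ht := (hV.x₂ x t ht).add (hW.x₂ x t ht)
  t₀ x t ht := by simpa only [mul_add] using (hV.t₀ x t ht).fun_add (hW.t₀ x t ht)
  t₁ x t ht := by simpa only [mul_add] using (hV.t₁ x t ht).fun_add (hW.t₁ x t ht)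

lemma const_mul (k : ℝ) (hV : HeatJet ε V V₁ V₂ V₃) :
    HeatJet ε (fun x t => k * V x t) (fun x t => k * V₁ x t)
      (fun x t => k * V₂ x t) (fun x t => k * V₃ x t) where
  x₀ x t ht := (hV.x₀ x t ht).const_mul k
  x₁ x t ht := (hV.x₁ x t ht).const_mul k
  x₂ x t ht := (hV.x₂ x t ht).const_mul k
  t₀ x t ht := by simpa only [mul_left_comm] using (hV.t₀ x t ht).const_mul k
  t₁ x t ht := by simpa only [mul_left_comm] using (hV.t₁ x t ht).const_mul k

lemma stepHeat (p : ℝ) (hε : 0 < ε) :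
    HeatJet ε (stepHeat p ε) (gaussHeat p ε)
      (fun x t => -(x - p) / (t * ε) * gaussHeat p ε x t)
      (fun x t => ((x - p) ^ 2 / (t * ε) ^ 2 - 1 / (t * ε)) * gaussHeat p ε x t) := by
  have hr : ∀ t : ℝ, 0 < t → 0 < √(2 * t * ε) := fun t ht => by positivity
  have hr2 : ∀ t : ℝ, 0 < t → √(2 * t * ε) ^ 2 = 2 * t * ε := fun t ht =>
    sq_sqrt (by positivity)
  have hexp : ∀ x t : ℝ, 0 < t → exp (-(-((x - p) / √(2 * t * ε))) ^ 2)
      = exp (-(x - p) ^ 2 / (2 * t * ε)) := fun x t ht => by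
    rw [neg_sq, div_pow, hr2 t ht, neg_div]
  have hg : ∀ x t : ℝ, 0 < t → HasDerivAt (fun y => gaussHeat p ε y t)
      (-(x - p) / (t * ε) * gaussHeat p ε x t) x := fun x t ht => by
    have h := (((((hasDerivAt_id x).sub_const p).pow 2).neg.div_const (2 * t * ε)).exp).div_const
      (√(2 * t * ε))
    refine h.congr_deriv ?_
    simp only [gaussHeat, id, Pi.neg_apply, Pi.pow_apply]
    have := hr t ht
    field_simp
    ring
  have hsq : ∀ t : ℝ, 0 < t → HasDerivAt (fun s => √(2 * s * ε)) (ε / √(2 * t * ε)) t :=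
    fun t ht => by
      have h := (((hasDerivAt_id t).const_mul 2).mul_const ε).sqrt
        (by simp only [id]; positivity)
      refine h.congr_deriv ?_
      simp only [id]
      have := hr t ht
      field_simp
  refine ⟨fun x t ht => ?_, hg, fun x t ht => ?_, fun x t ht => ?_, fun x t ht => ?_⟩
  · have h := (hasDerivAt_erfc _).comp x
      ((((hasDerivAt_id x).sub_const p).div_const (√(2 * t * ε))).neg)
    refine h.congr_deriv ?_
    simp only [Pi.neg_apply, id, gaussHeat]
    rw [hexp x t ht]
    ring
  · have h := ((((hasDerivAt_id x).sub_const p).neg).div_const (t * ε)).mul (hg x t ht)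
    refine h.congr_deriv ?_
    simp only [Pi.neg_apply, id]
    field_simp
    ring
  · have h := (hasDerivAt_erfc _).comp t (((hasDerivAt_const t (x - p)).div (hsq t ht)
      (hr t ht).ne').neg)
    refine h.congr_deriv ?_
    simp only [Pi.neg_apply, Pi.div_apply, gaussHeat]
    rw [hexp x t ht, hr2 t ht]
    have := hr t ht
    field_simp
    ring
  · have h1 : HasDerivAt (fun s => 2 * s * ε) (2 * ε) t := by
      simpa using ((hasDerivAt_id t).const_mul 2).mul_const ε
    have h := (((hasDerivAt_const t (-(x - p) ^ 2)).div h1 (by positivity)).exp).div (hsq t ht)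
      (hr t ht).ne'
    refine h.congr_deriv ?_
    simp only [Pi.div_apply, gaussHeat]
    have h2 := hr2 t ht
    have h3 := hr t ht
    generalize √(2 * t * ε) = r at *
    -- Eliminating ε in favour of r = √(2tε), and treating the exponential as an atom, leaves an
    -- identity between rational functions.
    have hε' : ε = r ^ 2 / (2 * t) := by field_simp; linarith
    generalize exp (-(x - p) ^ 2 / (2 * t * ε)) = e
    subst hε'
    field_simp
    ring

end HeatJet

/-! ### Partial derivatives on the upper half-plane -/

lemma isOpen_upperHalf : IsOpen upperHalf := isOpen_lt continuous_const continuous_snd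

lemma upperHalf_eq_prod : upperHalf = univ ×ˢ Ioi (0 : ℝ) := by
  ext p; simp [upperHalf]

section Partial

variable {f : ℝ → ℝ → ℝ} {x t : ℝ}

lemma hasDerivAt_dx_fderiv (hf : ContDiffOn ℝ 1 (fun p : ℝ × ℝ => f p.1 p.2) upperHalf)
    (ht : 0 < t) :
    HasDerivAt (fun y => f y t) (fderiv ℝ (fun p : ℝ × ℝ => f p.1 p.2) (x, t) (1, 0)) x := by
  have h1 : DifferentiableAt ℝ (fun p : ℝ × ℝ => f p.1 p.2) (x, t) :=
    (hf.contDiffAt (isOpen_upperHalf.mem_nhds ht)).differentiableAt one_ne_zero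
  exact h1.hasFDerivAt.comp_hasDerivAt x ((hasDerivAt_id x).prodMk (hasDerivAt_const x t))

lemma hasDerivAt_dt_fderiv (hf : ContDiffOn ℝ 1 (fun p : ℝ × ℝ => f p.1 p.2) upperHalf)
    (ht : 0 < t) :
    HasDerivAt (fun s => f x s) (fderiv ℝ (fun p : ℝ × ℝ => f p.1 p.2) (x, t) (0, 1)) t := by
  have h1 : DifferentiableAt ℝ (fun p : ℝ × ℝ => f p.1 p.2) (x, t) :=
    (hf.contDiffAt (isOpen_upperHalf.mem_nhds ht)).differentiableAt one_ne_zero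
  exact h1.hasFDerivAt.comp_hasDerivAt t ((hasDerivAt_const t x).prodMk (hasDerivAt_id t))

lemma hasDerivAt_dx (hf : ContDiffOn ℝ 1 (fun p : ℝ × ℝ => f p.1 p.2) upperHalf) (ht : 0 < t) :
    HasDerivAt (fun y => f y t) (dx f x t) x :=
  (hasDerivAt_dx_fderiv hf ht).differentiableAt.hasDerivAt

lemma hasDerivAt_dt (hf : ContDiffOn ℝ 1 (fun p : ℝ × ℝ => f p.1 p.2) upperHalf) (ht : 0 < t) :
    HasDerivAt (fun s => f x s) (dt f x t) t :=
  (hasDerivAt_dt_fderiv hf ht).differentiableAt.hasDerivAt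

/-- On the open half-plane `dx f` is the Fréchet derivative applied to (1, 0), so exactly one order
of smoothness is lost. -/
lemma contDiffOn_dx (hf : ContDiffOn ℝ 2 (fun p : ℝ × ℝ => f p.1 p.2) upperHalf) :
    ContDiffOn ℝ 1 (fun p : ℝ × ℝ => dx f p.1 p.2) upperHalf := by
  have h := (hf.fderiv_of_isOpen isOpen_upperHalf (m := 1) (by norm_num)).clm_apply
    (contDiffOn_const (c := ((1 : ℝ), (0 : ℝ))))
  refine h.congr fun p hp => ?_
  exact (hasDerivAt_dx_fderiv (hf.of_le (by norm_num)) hp).deriv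

lemma continuousOn_dx (hf : ContDiffOn ℝ 1 (fun p : ℝ × ℝ => f p.1 p.2) upperHalf) :
    ContinuousOn (fun p : ℝ × ℝ => dx f p.1 p.2) upperHalf := by
  have h := (hf.fderiv_of_isOpen isOpen_upperHalf (m := 0) (by norm_num)).clm_apply
    (contDiffOn_const (c := ((1 : ℝ), (0 : ℝ))))
  refine h.continuousOn.congr fun p hp => ?_
  exact (hasDerivAt_dx_fderiv hf hp).deriv

end Partial

/-! ### Uniqueness of bounded solutions of the heat equation -/

/-- `w` is continuous for `t > 0`, has continuous space derivatives `w₁, w₂` and satisfies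
`w_t = (ε/2) w₂`. -/
structure HeatSolution (ε : ℝ) (w w₁ w₂ : ℝ → ℝ → ℝ) : Prop where
  cont : ContinuousOn (fun p : ℝ × ℝ => w p.1 p.2) upperHalf
  cont₁ : ContinuousOn (fun p : ℝ × ℝ => w₁ p.1 p.2) upperHalf
  cont₂ : ContinuousOn (fun p : ℝ × ℝ => w₂ p.1 p.2) upperHalf
  x₀ : ∀ x t : ℝ, 0 < t → HasDerivAt (fun y => w y t) (w₁ x t) x
  x₁ : ∀ x t : ℝ, 0 < t → HasDerivAt (fun y => w₁ y t) (w₂ x t) x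
  t₀ : ∀ x t : ℝ, 0 < t → HasDerivAt (fun s => w x s) (ε / 2 * w₂ x t) t

lemma ContinuousOn.slice_upperHalf {f : ℝ → ℝ → ℝ}
    (hf : ContinuousOn (fun p : ℝ × ℝ => f p.1 p.2) upperHalf) {t : ℝ} (ht : 0 < t) :
    Continuous fun y => f y t := by
  have : Continuous ((fun p : ℝ × ℝ => f p.1 p.2) ∘ fun y : ℝ => (y, t)) :=
    hf.comp_continuous (by fun_prop) fun y => ht
  exact this

namespace HeatSolution

variable {ε : ℝ} {w w₁ w₂ v v₁ v₂ : ℝ → ℝ → ℝ}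

lemma sub (hw : HeatSolution ε w w₁ w₂) (hv : HeatSolution ε v v₁ v₂) :
    HeatSolution ε (fun x t => w x t - v x t) (fun x t => w₁ x t - v₁ x t)
      (fun x t => w₂ x t - v₂ x t) where
  cont := hw.cont.sub hv.cont
  cont₁ := hw.cont₁.sub hv.cont₁
  cont₂ := hw.cont₂.sub hv.cont₂
  x₀ x t ht := (hw.x₀ x t ht).sub (hv.x₀ x t ht)
  x₁ x t ht := (hw.x₁ x t ht).sub (hv.x₁ x t ht)
  t₀ x t ht := by simpa only [mul_sub] using (hw.t₀ x t ht).fun_sub (hv.t₀ x t ht)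

/-- The derivative in time of a localized energy. -/
lemma hasDerivAt_energy (hw : HeatSolution ε w w₁ w₂) (L : ℝ) {t : ℝ} (ht : 0 < t) :
    HasDerivAt (fun s => ∫ y in (-L)..L, (L ^ 2 - y ^ 2) ^ 3 * w y s ^ 2)
      (∫ y in (-L)..L, (L ^ 2 - y ^ 2) ^ 3 * (ε * (w y t * w₂ y t))) t := by
  -- A compact time window around t that stays away from t = 0 gives a constant bound for
  -- differentiation under the integral sign.
  have hK : IsCompact (uIcc (-L) L ×ˢ Icc (t / 2) (2 * t)) := isCompact_uIcc.prod isCompact_Icc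
  have hsub : uIcc (-L) L ×ˢ Icc (t / 2) (2 * t) ⊆ upperHalf := fun p hp => by
    have := hp.2.1
    exact show 0 < p.2 by linarith
  have hc : ContinuousOn (fun p : ℝ × ℝ =>
      (L ^ 2 - p.1 ^ 2) ^ 3 * (ε * (w p.1 p.2 * w₂ p.1 p.2))) upperHalf :=
    ContinuousOn.mul (by fun_prop) (continuousOn_const.mul (hw.cont.mul hw.cont₂))
  obtain ⟨B, hB⟩ := hK.exists_bound_of_continuousOn (hc.mono hsub)
  refine (intervalIntegral.hasDerivAt_integral_of_dominated_loc_of_deriv_le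
    (F := fun s y => (L ^ 2 - y ^ 2) ^ 3 * w y s ^ 2)
    (F' := fun s y => (L ^ 2 - y ^ 2) ^ 3 * (ε * (w y s * w₂ y s)))
    (s := Icc (t / 2) (2 * t)) (bound := fun _ => B)
    (Icc_mem_nhds (by linarith) (by linarith)) ?_ ?_ ?_ ?_ ?_ ?_).2
  · filter_upwards [lt_mem_nhds ht] with s hs
    have := hw.cont.slice_upperHalf hs
    exact Continuous.aestronglyMeasurable (by fun_prop)
  · have := hw.cont.slice_upperHalf ht
    exact Continuous.intervalIntegrable (by fun_prop) _ _
  · have := hw.cont.slice_upperHalf ht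
    have := hw.cont₂.slice_upperHalf ht
    exact Continuous.aestronglyMeasurable (by fun_prop)
  · exact Eventually.of_forall fun y hy s hs => hB (y, s) ⟨uIoc_subset_uIcc hy, hs⟩
  · exact intervalIntegrable_const
  · refine Eventually.of_forall fun y _ s hs => ?_
    have h := ((hw.t₀ y s (by linarith [hs.1])).pow 2).const_mul ((L ^ 2 - y ^ 2) ^ 3)
    refine h.congr_deriv ?_
    simp only [Nat.cast_ofNat, Nat.add_one_sub_one, pow_one]
    ring

/-- Let φ = (L² - y²)³. Since φ and φ' vanish at ±L, two integrations by parts turn the integral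
into -ε ∫ φ w₁² + (ε/2) ∫ φ'' w². The first term is dropped, and φ'' ≤ 30 L⁴ on an interval of
length 2L bounds the second, with a factor of two to spare. -/
lemma energy_deriv_le (hε : 0 < ε) (hw : HeatSolution ε w w₁ w₂) {K : ℝ}
    (hK : ∀ x t, 0 < t → |w x t| ≤ K) {L : ℝ} (hL : 0 < L) {t : ℝ} (ht : 0 < t) :
    ∫ y in (-L)..L, (L ^ 2 - y ^ 2) ^ 3 * (ε * (w y t * w₂ y t)) ≤ 60 * ε * K ^ 2 * L ^ 5 := by
  have hc := hw.cont.slice_upperHalf ht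
  have hc1 := hw.cont₁.slice_upperHalf ht
  have hc2 := hw.cont₂.slice_upperHalf ht
  -- The integrand is the derivative of 2φ w w₁ - φ' w², which vanishes at both endpoints.
  have hparts : ∫ y in (-L)..L, ((L ^ 2 - y ^ 2) ^ 3 * (2 * w₁ y t ^ 2 + 2 * w y t * w₂ y t)
      - (24 * y ^ 2 * (L ^ 2 - y ^ 2) - 6 * (L ^ 2 - y ^ 2) ^ 2) * w y t ^ 2) = 0 := by
    rw [intervalIntegral.integral_eq_sub_of_hasDerivAt
      (f := fun y => (L ^ 2 - y ^ 2) ^ 3 * (2 * w y t * w₁ y t)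
        + 6 * y * (L ^ 2 - y ^ 2) ^ 2 * w y t ^ 2)]
    · ring
    · intro y _
      have hq : HasDerivAt (fun y : ℝ => L ^ 2 - y ^ 2) (-(2 * y)) y := by
        simpa using ((hasDerivAt_id y).pow 2).const_sub (L ^ 2)
      have h0 := hw.x₀ y t ht
      have h1 := hw.x₁ y t ht
      have h := ((hq.pow 3).mul ((h0.const_mul 2).mul h1)).add
        ((((hasDerivAt_id y).const_mul 6).mul (hq.pow 2)).mul (h0.pow 2))
      refine h.congr_deriv ?_
      simp only [Pi.pow_apply, Pi.mul_apply, id, Nat.cast_ofNat, Nat.add_one_sub_one, pow_one]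
      ring
    · exact Continuous.intervalIntegrable (by fun_prop) _ _
  have hle : ∫ y in (-L)..L, (L ^ 2 - y ^ 2) ^ 3 * (ε * (w y t * w₂ y t))
      ≤ ∫ y in (-L)..L, (ε / 2 * ((L ^ 2 - y ^ 2) ^ 3 * (2 * w₁ y t ^ 2 + 2 * w y t * w₂ y t)
      - (24 * y ^ 2 * (L ^ 2 - y ^ 2) - 6 * (L ^ 2 - y ^ 2) ^ 2) * w y t ^ 2)
      + 30 * ε * K ^ 2 * L ^ 4) := by
    refine intervalIntegral.integral_mono_on (by linarith)
      (Continuous.intervalIntegrable (by fun_prop) _ _)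
      (Continuous.intervalIntegrable (by fun_prop) _ _) fun y hy => ?_
    have hyL : 0 ≤ L ^ 2 - y ^ 2 := by nlinarith [hy.1, hy.2]
    have hw2 : w y t ^ 2 ≤ K ^ 2 := sq_le_sq' (abs_le.1 (hK y t ht)).1 (abs_le.1 (hK y t ht)).2
    have hω : 24 * y ^ 2 * (L ^ 2 - y ^ 2) - 6 * (L ^ 2 - y ^ 2) ^ 2 ≤ 30 * L ^ 4 := by
      nlinarith [sq_nonneg (L ^ 2 - 2 * y ^ 2), sq_nonneg (L ^ 2 - y ^ 2), sq_nonneg (L ^ 2)]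
    have h1 : 0 ≤ ε * (L ^ 2 - y ^ 2) ^ 3 * w₁ y t ^ 2 := by positivity
    have h2 : (24 * y ^ 2 * (L ^ 2 - y ^ 2) - 6 * (L ^ 2 - y ^ 2) ^ 2) * w y t ^ 2
        ≤ 30 * L ^ 4 * K ^ 2 :=
      (mul_le_mul_of_nonneg_right hω (sq_nonneg _)).trans
        (mul_le_mul_of_nonneg_left hw2 (by positivity))
    have h3 := mul_le_mul_of_nonneg_left h2 hε.le
    have h4 : 0 ≤ ε * (L ^ 4 * K ^ 2) := by positivity
    nlinarith
  rw [intervalIntegral.integral_add (Continuous.intervalIntegrable (by fun_prop) _ _)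
    (Continuous.intervalIntegrable (by fun_prop) _ _), intervalIntegral.integral_const_mul,
    hparts, intervalIntegral.integral_const, smul_eq_mul] at hle
  linarith

/-- The energy starts from 0 by dominated convergence, for which convergence almost everywhere
suffices, and then grows at most linearly in time. The point is the power L⁵: near the origin the
weight has size L⁶, so the estimate improves as L grows. -/
lemma energy_le (hε : 0 < ε) (hw : HeatSolution ε w w₁ w₂) {K : ℝ}
    (hK : ∀ x t, 0 < t → |w x t| ≤ K)
    (h0 : ∀ᵐ x, Tendsto (fun t => w x t) (𝓝[>] 0) (𝓝 0)) {L : ℝ} (hL : 0 < L) {t : ℝ}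
    (ht : 0 < t) :
    ∫ y in (-L)..L, (L ^ 2 - y ^ 2) ^ 3 * w y t ^ 2 ≤ 60 * ε * K ^ 2 * L ^ 5 * t := by
  set G : ℝ → ℝ := fun s => ∫ y in (-L)..L, (L ^ 2 - y ^ 2) ^ 3 * w y s ^ 2 with hG
  have hG0 : Tendsto G (𝓝[>] 0) (𝓝 0) := by
    have h := intervalIntegral.tendsto_integral_filter_of_dominated_convergence
      (μ := volume) (a := -L) (b := L) (l := 𝓝[>] (0 : ℝ))
      (F := fun s y => (L ^ 2 - y ^ 2) ^ 3 * w y s ^ 2) (f := fun _ => 0)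
      (fun y => |(L ^ 2 - y ^ 2) ^ 3| * K ^ 2) ?_ ?_ ?_ ?_
    · simpa using h
    · filter_upwards [self_mem_nhdsWithin] with s hs
      have := hw.cont.slice_upperHalf hs
      exact Continuous.aestronglyMeasurable (by fun_prop)
    · filter_upwards [self_mem_nhdsWithin] with s hs
      refine Eventually.of_forall fun y _ => ?_
      rw [norm_mul, norm_eq_abs, norm_pow, norm_eq_abs]
      gcongr
      exact hK y s hs
    · exact Continuous.intervalIntegrable (by fun_prop) _ _
    · filter_upwards [h0] with y hy _
      simpa using (hy.pow 2).const_mul ((L ^ 2 - y ^ 2) ^ 3)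
  have hd : ∀ s, 0 < s → HasDerivAt G
      (∫ y in (-L)..L, (L ^ 2 - y ^ 2) ^ 3 * (ε * (w y s * w₂ y s))) s :=
    fun s hs => hw.hasDerivAt_energy L hs
  have hmv : ∀ s ∈ Ioo 0 t, G t ≤ G s + 60 * ε * K ^ 2 * L ^ 5 * (t - s) := fun s hs => by
    have h := (convex_Ioi (0 : ℝ)).image_sub_le_mul_sub_of_deriv_le (f := G)
      (C := 60 * ε * K ^ 2 * L ^ 5)
      (fun r hr => (hd r hr).continuousAt.continuousWithinAt)
      (fun r hr => (hd r (interior_subset hr)).differentiableAt.differentiableWithinAt)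
      (fun r hr => by
        rw [(hd r (interior_subset hr)).deriv]
        exact hw.energy_deriv_le hε hK hL (interior_subset hr)) s hs.1 t ht hs.2.le
    linarith
  have hlim : Tendsto (fun s => G s + 60 * ε * K ^ 2 * L ^ 5 * (t - s)) (𝓝[>] 0)
      (𝓝 (0 + 60 * ε * K ^ 2 * L ^ 5 * (t - 0))) :=
    hG0.add (((continuous_const.sub continuous_id).tendsto 0 |>.mono_left
      nhdsWithin_le_nhds).const_mul _)
  have := ge_of_tendsto hlim (by filter_upwards [Ioo_mem_nhdsGT ht] with s hs using hmv s hs)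
  simpa using this

/-- A bounded solution of the heat equation with vanishing initial data vanishes. -/
theorem eq_zero (hε : 0 < ε) (hw : HeatSolution ε w w₁ w₂) {K : ℝ}
    (hK : ∀ x t, 0 < t → |w x t| ≤ K)
    (h0 : ∀ᵐ x, Tendsto (fun t => w x t) (𝓝[>] 0) (𝓝 0)) {x t : ℝ} (ht : 0 < t) :
    w x t = 0 := by
  have hc := hw.cont.slice_upperHalf ht
  set A : ℝ := |x| + 1 with hA
  have hApos : 0 < A := by positivity
  set I : ℝ := ∫ y in (-A)..A, w y t ^ 2 with hI
  -- For |y| ≤ A ≤ L/2 one has L² - y² ≥ (3/4)L², so the weight is at least (27/64)L⁶ there.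
  -- Dividing the energy bound by L⁵ leaves a bound on I·L that does not depend on L.
  have hbound : ∀ L, 2 * A ≤ L → I * (27 / 64) * L ≤ 60 * ε * K ^ 2 * t := fun L hL => by
    have hLpos : 0 < L := by linarith
    have h1 : ∫ y in (-A)..A, (27 / 64 * L ^ 6) * w y t ^ 2
        ≤ ∫ y in (-L)..L, (L ^ 2 - y ^ 2) ^ 3 * w y t ^ 2 := by
      calc _ ≤ ∫ y in (-A)..A, (L ^ 2 - y ^ 2) ^ 3 * w y t ^ 2 := by
            refine intervalIntegral.integral_mono_on (by linarith)
              (Continuous.intervalIntegrable (by fun_prop) _ _)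
              (Continuous.intervalIntegrable (by fun_prop) _ _) fun y hy => ?_
            refine mul_le_mul_of_nonneg_right ?_ (sq_nonneg _)
            have h2 : 3 / 4 * L ^ 2 ≤ L ^ 2 - y ^ 2 := by nlinarith [hy.1, hy.2]
            calc 27 / 64 * L ^ 6 = (3 / 4 * L ^ 2) ^ 3 := by ring
              _ ≤ _ := by gcongr
        _ ≤ _ := by
            refine intervalIntegral.integral_mono_interval (by linarith) (by linarith)
              (by linarith) ?_ (Continuous.intervalIntegrable (by fun_prop) _ _)
            refine (ae_restrict_iff' measurableSet_Ioc).2 (Eventually.of_forall fun y hy => ?_)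
            have : 0 ≤ L ^ 2 - y ^ 2 := by nlinarith [hy.1, hy.2]
            simp only [Pi.zero_apply]
            positivity
    rw [intervalIntegral.integral_const_mul] at h1
    have h2 := h1.trans (hw.energy_le hε hK h0 hLpos ht)
    have h5 : 0 < L ^ 5 := by positivity
    refine le_of_mul_le_mul_right ?_ h5
    calc I * (27 / 64) * L * L ^ 5 = 27 / 64 * L ^ 6 * I := by ring
      _ ≤ _ := h2
      _ = _ := by ring
  have hI0 : I ≤ 0 := by
    by_contra! hpos
    -- This L is admissible and large enough for I·(27/64)·L to exceed the bound by I·(27/64).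
    have h := hbound (max (2 * A) (60 * ε * K ^ 2 * t / (I * (27 / 64)) + 1)) (le_max_left _ _)
    have h2 := mul_le_mul_of_nonneg_left (le_max_right (2 * A)
      (60 * ε * K ^ 2 * t / (I * (27 / 64)) + 1)) (by positivity : 0 ≤ I * (27 / 64))
    rw [mul_add, mul_div_cancel₀ _ (by positivity)] at h2
    linarith
  by_contra hne
  have : 0 < I := by
    refine intervalIntegral.integral_pos (by linarith) (by fun_prop)
      (fun y _ => sq_nonneg _) ⟨x, ⟨?_, ?_⟩, by positivity⟩
    · linarith [neg_abs_le x]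
    · linarith [le_abs_self x]
  linarith

end HeatSolution

/-! ### The Hopf–Cole transformation -/

section HopfCole

variable {ε κ : ℝ} {V V₁ V₂ V₃ S S₁ S₂ S₃ U u R ρ : ℝ → ℝ → ℝ}

/-- The additive constant κ leaves the equation unchanged; it is there to normalise U, because the
denominator tends to √π rather than to 1 on the left. -/
lemma hopfCole_eq_U (hV : HeatJet ε V V₁ V₂ V₃) (hpos : ∀ x t, 0 < t → 0 < V x t)
    (hU : ∀ x t, U x t = κ - ε * log (V x t)) {x t : ℝ} (ht : 0 < t) :
    HasDerivAt (fun y => U y t) (-ε * V₁ x t / V x t) x ∧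
      dt U x t + (dx U x t) ^ 2 / 2 = ε / 2 * dx (dx U) x t := by
  have hd : ∀ y, HasDerivAt (fun y => U y t) (-ε * V₁ y t / V y t) y := fun y => by
    have h := (((hV.x₀ y t ht).log (hpos y t ht).ne').const_mul ε).const_sub κ
    have e : (fun y => U y t) = fun y => κ - ε * log (V y t) := funext fun y => hU y t
    rw [e]
    exact h.congr_deriv (by ring)
  have hdx : (fun y => dx U y t) = fun y => -ε * V₁ y t / V y t := funext fun y => (hd y).deriv
  have hdt : dt U x t = -ε * (ε / 2 * V₂ x t) / V x t := by
    have h := (((hV.t₀ x t ht).log (hpos x t ht).ne').const_mul ε).const_sub κ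
    have e : (fun s => U x s) = fun s => κ - ε * log (V x s) := funext fun s => hU x s
    unfold dt
    rw [e, h.deriv]
    ring
  have hdd : dx (dx U) x t = (-ε * V₂ x t * V x t - -ε * V₁ x t * V₁ x t) / V x t ^ 2 := by
    rw [dx, hdx]
    exact (((hV.x₁ x t ht).const_mul (-ε)).div (hV.x₀ x t ht) (hpos x t ht).ne').deriv
  refine ⟨hd x, ?_⟩
  have hp := hpos x t ht
  rw [hdt, hdd, show dx U x t = _ from congrFun hdx x]
  field_simp
  ring

/-- This is the x-derivative of the equation for U. Since V₁ also solves the heat equation, its time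
derivative is (ε/2) V₃, and the claim becomes algebra in the jet of V without exchanging mixed
derivatives. -/
lemma hopfCole_eq_u (hV : HeatJet ε V V₁ V₂ V₃) (hpos : ∀ x t, 0 < t → 0 < V x t)
    (hu : ∀ x t, u x t = -ε * V₁ x t / V x t) {x t : ℝ} (ht : 0 < t) :
    dt u x t + dx (fun y s => (u y s) ^ 2 / 2) x t = ε / 2 * dx (dx u) x t := by
  have e : (fun y => u y t) = fun y => -ε * V₁ y t / V y t := funext fun y => hu y t
  have hd : ∀ y, HasDerivAt (fun y => u y t)
      ((-ε * V₂ y t * V y t - -ε * V₁ y t * V₁ y t) / V y t ^ 2) y := fun y => by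
    rw [e]
    exact ((hV.x₁ y t ht).const_mul (-ε)).div (hV.x₀ y t ht) (hpos y t ht).ne'
  have hdx : (fun y => dx u y t) = fun y =>
      (-ε * V₂ y t * V y t - -ε * V₁ y t * V₁ y t) / V y t ^ 2 := funext fun y => (hd y).deriv
  have hp := hpos x t ht
  have hdd : dx (dx u) x t = ((-ε * V₃ x t * V x t + -ε * V₂ x t * V₁ x t
      - (-ε * V₂ x t * V₁ x t + -ε * V₁ x t * V₂ x t)) * V x t ^ 2
      - (-ε * V₂ x t * V x t - -ε * V₁ x t * V₁ x t) * (2 * V x t * V₁ x t))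
      / (V x t ^ 2) ^ 2 := by
    rw [dx, hdx]
    have h := (((((hV.x₂ x t ht).const_mul (-ε)).fun_mul (hV.x₀ x t ht)).fun_sub
      (((hV.x₁ x t ht).const_mul (-ε)).fun_mul (hV.x₁ x t ht))).fun_div ((hV.x₀ x t ht).fun_pow 2)
      (pow_pos hp 2).ne')
    rw [h.deriv]
    simp only [Nat.cast_ofNat, Nat.add_one_sub_one, pow_one]
  have hdt : dt u x t = (-ε * (ε / 2 * V₃ x t) * V x t
      - -ε * V₁ x t * (ε / 2 * V₂ x t)) / V x t ^ 2 := by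
    have e : (fun s => u x s) = fun s => -ε * V₁ x s / V x s := funext fun s => hu x s
    unfold dt
    rw [e]
    exact (((hV.t₁ x t ht).const_mul (-ε)).div (hV.t₀ x t ht) hp.ne').deriv
  have hsq : dx (fun y s => (u y s) ^ 2 / 2) x t = u x t *
      ((-ε * V₂ x t * V x t - -ε * V₁ x t * V₁ x t) / V x t ^ 2) := by
    unfold dx
    rw [(((hd x).fun_pow 2).div_const 2).deriv]
    simp only [Nat.cast_ofNat, Nat.add_one_sub_one, pow_one]
    ring
  rw [hdt, hsq, hdd, hu]
  field_simp
  ring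

lemma hopfCole_eq_R (hV : HeatJet ε V V₁ V₂ V₃) (hpos : ∀ x t, 0 < t → 0 < V x t)
    (hS : HeatJet ε S S₁ S₂ S₃) (hu : ∀ x t, u x t = -ε * V₁ x t / V x t)
    (hR : ∀ x t, R x t = S x t / V x t) {x t : ℝ} (ht : 0 < t) :
    HasDerivAt (fun y => R y t) ((S₁ x t * V x t - S x t * V₁ x t) / V x t ^ 2) x ∧
      dt R x t + dx R x t * u x t = ε / 2 * dx (dx R) x t := by
  have e : (fun y => R y t) = fun y => S y t / V y t := funext fun y => hR y t
  have hd : ∀ y, HasDerivAt (fun y => R y t)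
      ((S₁ y t * V y t - S y t * V₁ y t) / V y t ^ 2) y := fun y => by
    rw [e]
    exact (hS.x₀ y t ht).fun_div (hV.x₀ y t ht) (hpos y t ht).ne'
  have hdx : (fun y => dx R y t) = fun y =>
      (S₁ y t * V y t - S y t * V₁ y t) / V y t ^ 2 := funext fun y => (hd y).deriv
  have hp := hpos x t ht
  have hdt : dt R x t = (ε / 2 * S₂ x t * V x t - S x t * (ε / 2 * V₂ x t)) / V x t ^ 2 := by
    have e : (fun s => R x s) = fun s => S x s / V x s := funext fun s => hR x s
    unfold dt
    rw [e]
    exact ((hS.t₀ x t ht).fun_div (hV.t₀ x t ht) hp.ne').deriv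
  have hdd : dx (dx R) x t = ((S₂ x t * V x t + S₁ x t * V₁ x t
      - (S₁ x t * V₁ x t + S x t * V₂ x t)) * V x t ^ 2
      - (S₁ x t * V x t - S x t * V₁ x t) * (2 * V x t * V₁ x t)) / (V x t ^ 2) ^ 2 := by
    rw [dx, hdx]
    have h := (((hS.x₁ x t ht).fun_mul (hV.x₀ x t ht)).fun_sub
      ((hS.x₀ x t ht).fun_mul (hV.x₁ x t ht))).fun_div ((hV.x₀ x t ht).fun_pow 2)
      (pow_pos hp 2).ne'
    rw [h.deriv]
    simp only [Nat.cast_ofNat, Nat.add_one_sub_one, pow_one]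
  refine ⟨hd x, ?_⟩
  rw [hdt, hdd, show dx R x t = _ from congrFun hdx x, hu]
  field_simp
  ring

lemma hopfCole_eq_ρ (hV : HeatJet ε V V₁ V₂ V₃) (hpos : ∀ x t, 0 < t → 0 < V x t)
    (hS : HeatJet ε S S₁ S₂ S₃) (hu : ∀ x t, u x t = -ε * V₁ x t / V x t)
    (hρ : ∀ x t, 0 < t → ρ x t = (S₁ x t * V x t - S x t * V₁ x t) / V x t ^ 2)
    {x t : ℝ} (ht : 0 < t) :
    dt ρ x t + dx (fun y s => ρ y s * u y s) x t = ε / 2 * dx (dx ρ) x t := by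
  have hp := hpos x t ht
  have e : (fun y => ρ y t) = fun y => (S₁ y t * V y t - S y t * V₁ y t) / V y t ^ 2 :=
    funext fun y => hρ y t ht
  have hd : ∀ y, HasDerivAt (fun y => ρ y t)
      (((S₂ y t * V y t + S₁ y t * V₁ y t - (S₁ y t * V₁ y t + S y t * V₂ y t)) * V y t ^ 2
      - (S₁ y t * V y t - S y t * V₁ y t) * (2 * V y t * V₁ y t)) / (V y t ^ 2) ^ 2) y :=
    fun y => by
    rw [e]
    have h := (((hS.x₁ y t ht).fun_mul (hV.x₀ y t ht)).fun_sub
      ((hS.x₀ y t ht).fun_mul (hV.x₁ y t ht))).fun_div ((hV.x₀ y t ht).fun_pow 2)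
      (pow_pos (hpos y t ht) 2).ne'
    refine h.congr_deriv ?_
    simp only [Nat.cast_ofNat, Nat.add_one_sub_one, pow_one]
  have hdx : (fun y => dx ρ y t) = fun y =>
      ((S₂ y t * V y t + S₁ y t * V₁ y t - (S₁ y t * V₁ y t + S y t * V₂ y t)) * V y t ^ 2
      - (S₁ y t * V y t - S y t * V₁ y t) * (2 * V y t * V₁ y t)) / (V y t ^ 2) ^ 2 :=
    funext fun y => (hd y).deriv
  have hdu : HasDerivAt (fun y => u y t)
      ((-ε * V₂ x t * V x t - -ε * V₁ x t * V₁ x t) / V x t ^ 2) x := by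
    rw [show (fun y => u y t) = fun y => -ε * V₁ y t / V y t from funext fun y => hu y t]
    exact ((hV.x₁ x t ht).const_mul (-ε)).fun_div (hV.x₀ x t ht) hp.ne'
  have hdt : dt ρ x t = ((ε / 2 * S₃ x t * V x t + S₁ x t * (ε / 2 * V₂ x t)
      - (ε / 2 * S₂ x t * V₁ x t + S x t * (ε / 2 * V₃ x t))) * V x t ^ 2
      - (S₁ x t * V x t - S x t * V₁ x t) * (2 * V x t * (ε / 2 * V₂ x t)))
      / (V x t ^ 2) ^ 2 := by
    have h := (((hS.t₁ x t ht).fun_mul (hV.t₀ x t ht)).fun_sub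
      ((hS.t₀ x t ht).fun_mul (hV.t₁ x t ht))).fun_div ((hV.t₀ x t ht).fun_pow 2)
      (pow_pos hp 2).ne'
    -- The formula for ρ is available at positive times only, so the two functions of s agree merely
    -- near t.
    have h' : HasDerivAt (fun s => ρ x s) _ t := h.congr_of_eventuallyEq (by
      filter_upwards [lt_mem_nhds ht] with s hs using hρ x s hs)
    rw [dt, h'.deriv]
    simp only [Nat.cast_ofNat, Nat.add_one_sub_one, pow_one]
  have hprod : dx (fun y s => ρ y s * u y s) x t = _ := ((hd x).fun_mul hdu).deriv
  have h := ((((((hS.x₂ x t ht).fun_mul (hV.x₀ x t ht)).fun_add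
    ((hS.x₁ x t ht).fun_mul (hV.x₁ x t ht))).fun_sub
    (((hS.x₁ x t ht).fun_mul (hV.x₁ x t ht)).fun_add
    ((hS.x₀ x t ht).fun_mul (hV.x₂ x t ht)))).fun_mul ((hV.x₀ x t ht).fun_pow 2)).fun_sub
    ((((hS.x₁ x t ht).fun_mul (hV.x₀ x t ht)).fun_sub
    ((hS.x₀ x t ht).fun_mul (hV.x₁ x t ht))).fun_mul
    (((hV.x₀ x t ht).const_mul 2).fun_mul (hV.x₁ x t ht)))).fun_div
    (((hV.x₀ x t ht).fun_pow 2).fun_pow 2) (pow_pos (pow_pos hp 2) 2).ne'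
  rw [hdt, hprod, dx, hdx, h.deriv, hu, hρ x t ht]
  simp only [Nat.cast_ofNat, Nat.add_one_sub_one, pow_one]
  field_simp
  ring

end HopfCole

/-! ### Distributional limits of derivatives -/

section DerivLimit

lemma integral_deriv_mul_eq_neg {F F' ψ : ℝ → ℝ} (hF : ∀ x, HasDerivAt F (F' x) x)
    (hF' : Continuous F') (hψ : ContDiff ℝ 1 ψ) (hs : HasCompactSupport ψ) :
    ∫ x, F' x * ψ x = -∫ x, F x * deriv ψ x := by
  have hc : Continuous F := continuous_iff_continuousAt.2 fun x => (hF x).continuousAt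
  have hψ' : Continuous (deriv ψ) := hψ.continuous_deriv le_rfl
  have h := integral_mul_deriv_eq_deriv_mul (u := F) (v := ψ) (u' := F') (v' := deriv ψ)
    (a' := 0) (b' := 0) (fun x _ => hF x)
    (fun x _ => (hψ.differentiable one_ne_zero x).hasDerivAt)
    ((hc.mul hψ').integrable_of_hasCompactSupport hs.deriv.mul_left)
    ((hF'.mul hψ.continuous).integrable_of_hasCompactSupport hs.mul_left) ?_ ?_
  · linarith
  all_goals
    have hz := (hs.mul_left (f := F))
    rw [hasCompactSupport_iff_eventuallyEq, Filter.coclosedCompact_eq_cocompact] at hz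
  · exact (hz.filter_mono _root_.atBot_le_cocompact).tendsto
  · exact (hz.filter_mono _root_.atTop_le_cocompact).tendsto

/-- After integration by parts only the size of F matters, not that of F'. For F = R^ε this gives a
bound uniform in ε, which serves as the dominating function in the time integral. -/
lemma abs_integral_deriv_mul_le {F F' ψ : ℝ → ℝ} {K : ℝ} (hF : ∀ x, HasDerivAt F (F' x) x)
    (hF' : Continuous F') (hK : ∀ x, |F x| ≤ K) (hψ : ContDiff ℝ 1 ψ)
    (hs : HasCompactSupport ψ) :
    |∫ x, F' x * ψ x| ≤ K * ∫ x, |deriv ψ x| := by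
  have hψ' : Continuous (deriv ψ) := hψ.continuous_deriv le_rfl
  rw [integral_deriv_mul_eq_neg hF hF' hψ hs, abs_neg, ← integral_const_mul]
  refine norm_integral_le_of_norm_le (f := fun x => F x * deriv ψ x)
    ((hψ'.integrable_of_hasCompactSupport hs.deriv).abs.const_mul K)
    (Eventually.of_forall fun x => ?_)
  rw [norm_mul, norm_eq_abs, norm_eq_abs]
  exact mul_le_mul_of_nonneg_right (hK x) (abs_nonneg _)

/-- If bounded functions converge to a step function off its jumps, then their derivatives
converge to the corresponding combination of Dirac masses. -/
lemma tendsto_integral_deriv_mul {ι : Type*} {l : Filter ι} [l.IsCountablyGenerated]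
    {F F' : ι → ℝ → ℝ} {K p q α β : ℝ}
    (hF : ∀ᶠ i in l, ∀ x, HasDerivAt (F i) (F' i x) x) (hF' : ∀ᶠ i in l, Continuous (F' i))
    (hK : ∀ᶠ i in l, ∀ x, |F i x| ≤ K)
    (hlim : ∀ x, x ≠ α → x ≠ β → Tendsto (fun i => F i x) l
      (𝓝 (p * (Ioi α).indicator 1 x + q * (Ioi β).indicator 1 x)))
    {ψ : ℝ → ℝ} (hψ : ContDiff ℝ 1 ψ) (hs : HasCompactSupport ψ) :
    Tendsto (fun i => ∫ x, F' i x * ψ x) l (𝓝 (p * ψ α + q * ψ β)) := by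
  have hψ' : Continuous (deriv ψ) := hψ.continuous_deriv le_rfl
  have hint : Integrable (deriv ψ) := hψ'.integrable_of_hasCompactSupport hs.deriv
  -- The integral of ψ' over (γ, ∞) is -ψ(γ).
  have hval : p * ψ α + q * ψ β =
      -∫ x, (p * (Ioi α).indicator 1 x + q * (Ioi β).indicator 1 x) * deriv ψ x := by
    have h1 : ∀ γ x : ℝ, (Ioi γ).indicator 1 x * deriv ψ x
        = (Ioi γ).indicator (deriv ψ) x := fun γ x => by
      by_cases h : x ∈ Ioi γ <;> simp [h]
    have h2 : ∀ γ : ℝ, ∫ x, (Ioi γ).indicator (deriv ψ) x = -ψ γ := fun γ => by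
      rw [integral_indicator measurableSet_Ioi, hs.integral_Ioi_deriv_eq hψ]
    simp_rw [add_mul, mul_assoc, h1]
    rw [integral_add ((hint.indicator measurableSet_Ioi).const_mul p)
      ((hint.indicator measurableSet_Ioi).const_mul q), integral_const_mul, integral_const_mul,
      h2, h2]
    ring
  rw [hval]
  have hconv : Tendsto (fun i => ∫ x, F i x * deriv ψ x) l
      (𝓝 (∫ x, (p * (Ioi α).indicator 1 x + q * (Ioi β).indicator 1 x) * deriv ψ x)) := by
    refine tendsto_integral_filter_of_dominated_convergence (fun x => K * |deriv ψ x|)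
      ?_ ?_ (hint.abs.const_mul K) ?_
    · filter_upwards [hF] with i hi
      have hc : Continuous (F i) := continuous_iff_continuousAt.2 fun x => (hi x).continuousAt
      exact (hc.mul hψ').aestronglyMeasurable
    · filter_upwards [hK] with i hi
      refine Eventually.of_forall fun x => ?_
      rw [norm_mul, norm_eq_abs, norm_eq_abs]
      exact mul_le_mul_of_nonneg_right (hi x) (abs_nonneg _)
    · have hα : ∀ᵐ x : ℝ, x ≠ α := by simp [ae_iff]
      have hβ : ∀ᵐ x : ℝ, x ≠ β := by simp [ae_iff]
      filter_upwards [hα, hβ] with x h1 h2 using (hlim x h1 h2).mul_const _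
  refine hconv.neg.congr' ?_
  filter_upwards [hF, hF'] with i hi hi'
  exact (integral_deriv_mul_eq_neg hi hi' hψ hs).symm

end DerivLimit

/-! ### The explicit solution -/

/-- The numerator of `explicitR`. -/
def explicitNum (b c d ua ub ρc ρd ε x t : ℝ) : ℝ :=
  ρc * exp (-ua / ε) * stepHeat c ε x t
    + ρc * (exp (-(ua + ub) / ε) - exp (-ua / ε)) * stepHeat b ε x t
    + ρd * exp (-(ua + ub) / ε) * stepHeat d ε x t

/-- The space derivative of `explicitNum`. -/
def explicitNumDx (b c d ua ub ρc ρd ε x t : ℝ) : ℝ :=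
  ρc * exp (-ua / ε) * gaussHeat c ε x t
    + ρc * (exp (-(ua + ub) / ε) - exp (-ua / ε)) * gaussHeat b ε x t
    + ρd * exp (-(ua + ub) / ε) * gaussHeat d ε x t

/-- The space derivative of `explicitDenom`. -/
def explicitDenomDx (a b ua ub ε x t : ℝ) : ℝ :=
  (exp (-ua / ε) - 1) * gaussHeat a ε x t
    + (exp (-(ua + ub) / ε) - exp (-ua / ε)) * gaussHeat b ε x t

section Explicit

variable {a b c d ua ub ρc ρd ε : ℝ}

lemma explicitDenom_eq (x t : ℝ) : explicitDenom a b ua ub ε x t =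
    √π + (exp (-ua / ε) - 1) * stepHeat a ε x t
      + (exp (-(ua + ub) / ε) - exp (-ua / ε)) * stepHeat b ε x t := by
  unfold explicitDenom stepHeat
  ring

/-- The three summands are, up to a common factor, the Gaussian masses of (-∞, a), (a, b) and (b,
∞), each weighted by exp(-U₀/ε). All three are positive, which yields positivity and the two-sided
bounds. -/
lemma explicitDenom_eq' (x t : ℝ) : explicitDenom a b ua ub ε x t =
    (√π - stepHeat a ε x t) + exp (-ua / ε) * (stepHeat a ε x t - stepHeat b ε x t)
      + exp (-(ua + ub) / ε) * stepHeat b ε x t := rfl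

lemma explicitR_eq (x t : ℝ) : explicitR a b c d ua ub ρc ρd ε x t =
    explicitNum b c d ua ub ρc ρd ε x t / explicitDenom a b ua ub ε x t := by
  unfold explicitR explicitNum stepHeat
  congr 1
  ring

lemma explicitU_eq (x t : ℝ) : explicitU a b ua ub ε x t =
    -ε * explicitDenomDx a b ua ub ε x t / explicitDenom a b ua ub ε x t := by
  unfold explicitU explicitDenomDx gaussHeat
  ring

lemma exists_heatJet_explicitDenom (hε : 0 < ε) :
    ∃ V₂ V₃, HeatJet ε (explicitDenom a b ua ub ε) (explicitDenomDx a b ua ub ε) V₂ V₃ := by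
  have h := ((HeatJet.const √π).add ((HeatJet.stepHeat a hε).const_mul (exp (-ua / ε) - 1))).add
    ((HeatJet.stepHeat b hε).const_mul (exp (-(ua + ub) / ε) - exp (-ua / ε)))
  have e₀ : explicitDenom a b ua ub ε = _ := funext fun x => funext fun t => explicitDenom_eq x t
  have e₁ : explicitDenomDx a b ua ub ε = fun x t => 0 + (exp (-ua / ε) - 1) * gaussHeat a ε x t
      + (exp (-(ua + ub) / ε) - exp (-ua / ε)) * gaussHeat b ε x t := by
    funext x t
    simp [explicitDenomDx]
  rw [e₀, e₁]
  exact ⟨_, _, h⟩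

lemma exists_heatJet_explicitNum (hε : 0 < ε) :
    ∃ S₂ S₃, HeatJet ε (explicitNum b c d ua ub ρc ρd ε)
      (explicitNumDx b c d ua ub ρc ρd ε) S₂ S₃ :=
  ⟨_, _, (((HeatJet.stepHeat c hε).const_mul _).add
    ((HeatJet.stepHeat b hε).const_mul _)).add ((HeatJet.stepHeat d hε).const_mul _)⟩

lemma explicitDenom_pos (hab : a < b) (hε : 0 < ε) {x t : ℝ} (ht : 0 < t) :
    0 < explicitDenom a b ua ub ε x t := by
  rw [explicitDenom_eq']
  have h1 := stepHeat_lt a ε x t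
  have h2 := stepHeat_lt_stepHeat (x := x) hε ht hab
  have h3 := stepHeat_pos b ε x t
  have := sub_pos.2 h1
  have := sub_pos.2 h2
  positivity

lemma explicitDenom_bounds (hab : a < b) (hε : 0 < ε) :
    ∃ m K : ℝ, 0 < m ∧ ∀ x t, 0 < t →
      m ≤ explicitDenom a b ua ub ε x t ∧ explicitDenom a b ua ub ε x t ≤ K := by
  refine ⟨min 1 (min (exp (-ua / ε)) (exp (-(ua + ub) / ε))) * √π,
    max 1 (max (exp (-ua / ε)) (exp (-(ua + ub) / ε))) * √π, by positivity, fun x t ht => ?_⟩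
  rw [explicitDenom_eq']
  have h1 := sub_pos.2 (stepHeat_lt a ε x t)
  have h2 := sub_pos.2 (stepHeat_lt_stepHeat (x := x) hε ht hab)
  have h3 := stepHeat_pos b ε x t
  generalize exp (-ua / ε) = α
  generalize exp (-(ua + ub) / ε) = β
  constructor
  · have e1 := mul_le_mul_of_nonneg_right (min_le_left 1 (min α β)) h1.le
    have e2 := mul_le_mul_of_nonneg_right ((min_le_right 1 (min α β)).trans (min_le_left _ _)) h2.le
    have e3 := mul_le_mul_of_nonneg_right ((min_le_right 1 (min α β)).trans (min_le_right _ _)) h3.le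
    linarith
  · have e1 := mul_le_mul_of_nonneg_right (le_max_left 1 (max α β)) h1.le
    have e2 := mul_le_mul_of_nonneg_right ((le_max_left α β).trans (le_max_right 1 _)) h2.le
    have e3 := mul_le_mul_of_nonneg_right ((le_max_right α β).trans (le_max_right 1 _)) h3.le
    linarith

/-- The part of the numerator that multiplies `ρ_c`. -/
def explicitNumLeft (b c ua ub ε x t : ℝ) : ℝ :=
  exp (-ua / ε) * (stepHeat c ε x t - stepHeat b ε x t) + exp (-(ua + ub) / ε) * stepHeat b ε x t

/-- The part of the numerator that multiplies `ρ_d`. -/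
def explicitNumRight (d ua ub ε x t : ℝ) : ℝ := exp (-(ua + ub) / ε) * stepHeat d ε x t

lemma explicitNum_eq (x t : ℝ) : explicitNum b c d ua ub ρc ρd ε x t =
    ρc * explicitNumLeft b c ua ub ε x t + ρd * explicitNumRight d ua ub ε x t := by
  unfold explicitNum explicitNumLeft explicitNumRight
  ring

/-- The quantity is the share of the denominator carried by y > c, so its quotient by the
denominator is a probability. The same applies to `explicitNumRight` and y > d. -/
lemma explicitNumLeft_mem (hac : a < c) (hcb : c < b) (hε : 0 < ε) {x t : ℝ} (ht : 0 < t) :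
    0 ≤ explicitNumLeft b c ua ub ε x t ∧
      explicitNumLeft b c ua ub ε x t ≤ explicitDenom a b ua ub ε x t := by
  rw [explicitDenom_eq']
  unfold explicitNumLeft
  have h0 := sub_pos.2 (stepHeat_lt a ε x t)
  have h1 := sub_pos.2 (stepHeat_lt_stepHeat (x := x) hε ht hac)
  have h2 := sub_pos.2 (stepHeat_lt_stepHeat (x := x) hε ht hcb)
  have h3 := stepHeat_pos b ε x t
  have h4 := mul_pos (exp_pos (-ua / ε)) h1
  refine ⟨by positivity, by linarith⟩

lemma explicitNumRight_mem (hab : a < b) (hbd : b < d) (hε : 0 < ε) {x t : ℝ} (ht : 0 < t) :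
    0 ≤ explicitNumRight d ua ub ε x t ∧
      explicitNumRight d ua ub ε x t ≤ explicitDenom a b ua ub ε x t := by
  rw [explicitDenom_eq']
  unfold explicitNumRight
  have h0 := sub_pos.2 (stepHeat_lt a ε x t)
  have h1 := sub_pos.2 (stepHeat_lt_stepHeat (x := x) hε ht hab)
  have h2 := sub_pos.2 (stepHeat_lt_stepHeat (x := x) hε ht hbd)
  have h3 := stepHeat_pos d ε x t
  have h4 := mul_pos (exp_pos (-ua / ε)) h1
  have h5 := mul_pos (exp_pos (-(ua + ub) / ε)) h2
  refine ⟨by positivity, by linarith⟩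

lemma abs_explicitR_le (hac : a < c) (hcb : c < b) (hbd : b < d) (hε : 0 < ε) {x t : ℝ}
    (ht : 0 < t) : |explicitR a b c d ua ub ρc ρd ε x t| ≤ |ρc| + |ρd| := by
  have hN := explicitDenom_pos (ua := ua) (ub := ub) (hac.trans hcb) hε (x := x) ht
  obtain ⟨h1, h2⟩ := explicitNumLeft_mem (ua := ua) (ub := ub) hac hcb hε (x := x) ht
  obtain ⟨h3, h4⟩ := explicitNumRight_mem (ua := ua) (ub := ub) (hac.trans hcb) hbd hε (x := x) ht
  rw [explicitR_eq, explicitNum_eq, abs_div, abs_of_pos hN, div_le_iff₀ hN]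
  refine (abs_add_le _ _).trans ?_
  rw [abs_mul, abs_mul, abs_of_nonneg h1, abs_of_nonneg h3, add_mul]
  gcongr

lemma contDiffOn_explicitDenom (hε : 0 < ε) :
    ContDiffOn ℝ ∞ (fun p : ℝ × ℝ => explicitDenom a b ua ub ε p.1 p.2) upperHalf := by
  simp_rw [explicitDenom_eq]
  exact (contDiffOn_const.add (contDiffOn_const.mul (contDiffOn_stepHeat a hε))).add
    (contDiffOn_const.mul (contDiffOn_stepHeat b hε))

lemma contDiffOn_explicitDenomDx (hε : 0 < ε) :
    ContDiffOn ℝ ∞ (fun p : ℝ × ℝ => explicitDenomDx a b ua ub ε p.1 p.2) upperHalf :=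
  (contDiffOn_const.mul (contDiffOn_gaussHeat a hε)).add
    (contDiffOn_const.mul (contDiffOn_gaussHeat b hε))

lemma contDiffOn_explicitNum (hε : 0 < ε) :
    ContDiffOn ℝ ∞ (fun p : ℝ × ℝ => explicitNum b c d ua ub ρc ρd ε p.1 p.2) upperHalf :=
  ((contDiffOn_const.mul (contDiffOn_stepHeat c hε)).add
    (contDiffOn_const.mul (contDiffOn_stepHeat b hε))).add
    (contDiffOn_const.mul (contDiffOn_stepHeat d hε))

lemma contDiffOn_explicitNumDx (hε : 0 < ε) :
    ContDiffOn ℝ ∞ (fun p : ℝ × ℝ => explicitNumDx b c d ua ub ρc ρd ε p.1 p.2) upperHalf :=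
  ((contDiffOn_const.mul (contDiffOn_gaussHeat c hε)).add
    (contDiffOn_const.mul (contDiffOn_gaussHeat b hε))).add
    (contDiffOn_const.mul (contDiffOn_gaussHeat d hε))

lemma contDiffOn_explicitU (hab : a < b) (hε : 0 < ε) :
    ContDiffOn ℝ ∞ (fun p : ℝ × ℝ => explicitU a b ua ub ε p.1 p.2) upperHalf := by
  simp_rw [explicitU_eq]
  exact (contDiffOn_const.mul (contDiffOn_explicitDenomDx hε)).div (contDiffOn_explicitDenom hε)
    fun p hp => (explicitDenom_pos hab hε hp).ne'

lemma contDiffOn_explicitR (hab : a < b) (hε : 0 < ε) :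
    ContDiffOn ℝ ∞ (fun p : ℝ × ℝ => explicitR a b c d ua ub ρc ρd ε p.1 p.2) upperHalf := by
  simp_rw [explicitR_eq]
  exact (contDiffOn_explicitNum hε).div (contDiffOn_explicitDenom hε)
    fun p hp => (explicitDenom_pos hab hε hp).ne'

lemma hasDerivAt_explicitR (hab : a < b) (hε : 0 < ε) {x t : ℝ} (ht : 0 < t) :
    HasDerivAt (fun y => explicitR a b c d ua ub ρc ρd ε y t)
      ((explicitNumDx b c d ua ub ρc ρd ε x t * explicitDenom a b ua ub ε x t
        - explicitNum b c d ua ub ρc ρd ε x t * explicitDenomDx a b ua ub ε x t)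
        / explicitDenom a b ua ub ε x t ^ 2) x := by
  obtain ⟨V₂, V₃, hV⟩ := exists_heatJet_explicitDenom (a := a) (b := b) (ua := ua) (ub := ub) hε
  obtain ⟨S₂, S₃, hS⟩ := exists_heatJet_explicitNum (b := b) (c := c) (d := d) (ua := ua)
    (ub := ub) (ρc := ρc) (ρd := ρd) hε
  simp_rw [explicitR_eq]
  exact (hS.x₀ x t ht).fun_div (hV.x₀ x t ht) (explicitDenom_pos hab hε ht).ne'

lemma explicitρ_eq (hab : a < b) (hε : 0 < ε) {x t : ℝ} (ht : 0 < t) :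
    explicitρ a b c d ua ub ρc ρd ε x t =
      (explicitNumDx b c d ua ub ρc ρd ε x t * explicitDenom a b ua ub ε x t
        - explicitNum b c d ua ub ρc ρd ε x t * explicitDenomDx a b ua ub ε x t)
        / explicitDenom a b ua ub ε x t ^ 2 :=
  (hasDerivAt_explicitR hab hε ht).deriv

lemma contDiffOn_explicitρ (hab : a < b) (hε : 0 < ε) :
    ContDiffOn ℝ ∞ (fun p : ℝ × ℝ => explicitρ a b c d ua ub ρc ρd ε p.1 p.2) upperHalf := by
  have h := (((contDiffOn_explicitNumDx (b := b) (c := c) (d := d) (ua := ua) (ub := ub)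
    (ρc := ρc) (ρd := ρd) hε).mul (contDiffOn_explicitDenom (a := a) (b := b) (ua := ua)
    (ub := ub) hε)).sub ((contDiffOn_explicitNum (b := b) (c := c) (d := d) (ua := ua) (ub := ub)
    (ρc := ρc) (ρd := ρd) hε).mul (contDiffOn_explicitDenomDx (a := a) (b := b) (ua := ua)
    (ub := ub) hε))).div ((contDiffOn_explicitDenom (a := a) (b := b) (ua := ua)
    (ub := ub) hε).pow 2) fun p hp => (pow_pos (explicitDenom_pos hab hε hp) 2).ne'
  exact h.congr fun p hp => explicitρ_eq hab hε hp

lemma tendsto_explicitDenom_left (hab : a < b) (hε : 0 < ε) {x : ℝ} (hx : x < a) :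
    Tendsto (explicitDenom a b ua ub ε x) (𝓝[>] 0) (𝓝 √π) := by
  rw [funext (explicitDenom_eq x)]
  have h := ((tendsto_stepHeat_of_lt hε hx).const_mul (exp (-ua / ε) - 1)).const_add (√π) |>.add
    ((tendsto_stepHeat_of_lt hε (hx.trans hab)).const_mul (exp (-(ua + ub) / ε) - exp (-ua / ε)))
  simpa using h

lemma tendsto_explicitDenom_mid (hε : 0 < ε) {x : ℝ} (hx : a < x) (hxb : x < b) :
    Tendsto (explicitDenom a b ua ub ε x) (𝓝[>] 0) (𝓝 (exp (-ua / ε) * √π)) := by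
  rw [funext (explicitDenom_eq x)]
  have h := ((tendsto_stepHeat_of_gt hε hx).const_mul (exp (-ua / ε) - 1)).const_add (√π) |>.add
    ((tendsto_stepHeat_of_lt hε hxb).const_mul (exp (-(ua + ub) / ε) - exp (-ua / ε)))
  convert h using 2
  ring

lemma tendsto_explicitDenom_right (hab : a < b) (hε : 0 < ε) {x : ℝ} (hx : b < x) :
    Tendsto (explicitDenom a b ua ub ε x) (𝓝[>] 0) (𝓝 (exp (-(ua + ub) / ε) * √π)) := by
  rw [funext (explicitDenom_eq x)]
  have h := ((tendsto_stepHeat_of_gt hε (hab.trans hx)).const_mul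
    (exp (-ua / ε) - 1)).const_add (√π) |>.add
    ((tendsto_stepHeat_of_gt hε hx).const_mul (exp (-(ua + ub) / ε) - exp (-ua / ε)))
  convert h using 2
  ring

end Explicit

/-! ### The explicit formulas give an approximate solution -/

section Existence

lemma two_le_infty : (2 : WithTop ℕ∞) ≤ ∞ :=
  WithTop.coe_le_coe.2 (le_top (a := (2 : ℕ∞)))

variable {a b c d ua ub ρc ρd ε : ℝ}

/-- The Hopf–Cole potential of `explicitU`. -/
def explicitPot (a b ua ub ε x t : ℝ) : ℝ := ε * log √π - ε * log (explicitDenom a b ua ub ε x t)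

lemma tendsto_explicitPot (hε : 0 < ε) {x v : ℝ}
    (h : Tendsto (explicitDenom a b ua ub ε x) (𝓝[>] 0) (𝓝 (exp (-v / ε) * √π))) :
    Tendsto (fun t => explicitPot a b ua ub ε x t) (𝓝[>] 0) (𝓝 v) := by
  have hπ : √π ≠ 0 := by positivity
  have h2 := ((h.log (by positivity)).const_mul ε).const_sub (ε * log √π)
  rw [log_mul (exp_ne_zero _) hπ, log_exp] at h2
  convert h2 using 2
  · rfl
  · field_simp
    ring

/-- The denominator is bounded below uniformly in t, so it need not have a limit: the numerator only
has to approach k times the denominator. -/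
lemma tendsto_explicitR (hab : a < b) (hε : 0 < ε) {x k : ℝ}
    (h : Tendsto (fun t => explicitNum b c d ua ub ρc ρd ε x t
      - k * explicitDenom a b ua ub ε x t) (𝓝[>] 0) (𝓝 0)) :
    Tendsto (fun t => explicitR a b c d ua ub ρc ρd ε x t) (𝓝[>] 0) (𝓝 k) := by
  obtain ⟨m, K, hm, hN⟩ := explicitDenom_bounds (ua := ua) (ub := ub) hab hε
  rw [tendsto_iff_norm_sub_tendsto_zero]
  refine squeeze_zero' (Eventually.of_forall fun _ => norm_nonneg _) ?_
    (by simpa using h.norm.div_const m)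
  filter_upwards [self_mem_nhdsWithin] with t ht
  have h1 := (hN x t ht).1
  have h2 : 0 < explicitDenom a b ua ub ε x t := hm.trans_le h1
  have e : explicitR a b c d ua ub ρc ρd ε x t - k = (explicitNum b c d ua ub ρc ρd ε x t
      - k * explicitDenom a b ua ub ε x t) / explicitDenom a b ua ub ε x t := by
    rw [explicitR_eq]
    field_simp
  rw [e, norm_div, norm_of_nonneg h2.le]
  exact div_le_div_of_nonneg_left (norm_nonneg _) hm h1

lemma isPotentialSolution_explicit (hac : a < c) (hcb : c < b) (hbd : b < d) (hε : 0 < ε) :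
    IsPotentialSolution a b c d ua ub ρc ρd ε (explicitPot a b ua ub ε)
      (explicitR a b c d ua ub ρc ρd ε) := by
  have hab := hac.trans hcb
  obtain ⟨V₂, V₃, hV⟩ := exists_heatJet_explicitDenom (a := a) (b := b) (ua := ua) (ub := ub) hε
  obtain ⟨S₂, S₃, hS⟩ := exists_heatJet_explicitNum (b := b) (c := c) (d := d) (ua := ua)
    (ub := ub) (ρc := ρc) (ρd := ρd) hε
  have hpos : ∀ x t, 0 < t → 0 < explicitDenom a b ua ub ε x t := fun x t ht =>
    explicitDenom_pos hab hε ht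
  refine ⟨?_, (contDiffOn_explicitR hab hε).of_le two_le_infty, ?_,
    fun x t ht => (hopfCole_eq_U hV hpos (fun _ _ => rfl) ht).2, fun x t ht => ?_,
    fun x hx => ?_, fun x h1 h2 => ?_, fun x hx => ?_,
    fun x hx => ?_, fun x h1 h2 => ?_, fun x hx => ?_⟩
  · have h := contDiffOn_const (c := ε * log √π) |>.sub (contDiffOn_const (c := ε) |>.mul
      ((contDiffOn_explicitDenom (a := a) (b := b) (ua := ua) (ub := ub) hε).log
      fun p hp => (hpos p.1 p.2 hp).ne'))
    exact h.of_le two_le_infty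
  · obtain ⟨m, K, hm, hN⟩ := explicitDenom_bounds (ua := ua) (ub := ub) hab hε
    refine ⟨max (|ε * log √π| + ε * (|log m| + |log K|)) (|ρc| + |ρd|), fun x t ht =>
      ⟨le_max_of_le_left ?_, le_max_of_le_right (abs_explicitR_le hac hcb hbd hε ht)⟩⟩
    refine (abs_sub _ _).trans ?_
    rw [abs_mul ε (log (explicitDenom a b ua ub ε x t)), abs_of_pos hε]
    gcongr
    have h1 := log_le_log hm (hN x t ht).1
    have h2 := log_le_log (hpos x t ht) (hN x t ht).2
    rw [abs_le]
    constructor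
    · linarith [neg_abs_le (log m), abs_nonneg (log K)]
    · linarith [le_abs_self (log K), abs_nonneg (log m)]
  · have h := (hopfCole_eq_R hV hpos hS (u := explicitU a b ua ub ε) explicitU_eq
      explicitR_eq (x := x) ht).2
    rw [dx.eq_1 (explicitPot a b ua ub ε),
      (hopfCole_eq_U hV hpos (U := explicitPot a b ua ub ε) (fun _ _ => rfl) ht).1.deriv,
      ← explicitU_eq]
    exact h
  · exact tendsto_explicitPot hε (by simpa using tendsto_explicitDenom_left hab hε hx)
  · exact tendsto_explicitPot hε (tendsto_explicitDenom_mid hε h1 h2)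
  · exact tendsto_explicitPot hε (tendsto_explicitDenom_right hab hε hx)
  · refine tendsto_explicitR hab hε ?_
    have h1 := tendsto_stepHeat_of_lt hε hx
    have h2 := tendsto_stepHeat_of_lt hε (hx.trans hcb)
    have h3 := tendsto_stepHeat_of_lt hε (hx.trans (hcb.trans hbd))
    have h := ((h1.const_mul (ρc * exp (-ua / ε))).add
      (h2.const_mul (ρc * (exp (-(ua + ub) / ε) - exp (-ua / ε))))).add
      (h3.const_mul (ρd * exp (-(ua + ub) / ε)))
    simpa [explicitNum] using h
  · refine tendsto_explicitR hab hε ?_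
    have h3 := tendsto_stepHeat_of_gt hε h1
    have h4 := tendsto_stepHeat_of_gt hε (hac.trans h1)
    have h5 := tendsto_stepHeat_of_lt hε h2
    -- Here x may lie on either side of b, or at b, so the limit of `stepHeat b` is not at hand.
    -- Subtracting ρ_c times the denominator cancels exactly the terms containing it.
    have h := (((h3.const_mul (ρc * exp (-ua / ε))).sub
      (h4.const_mul (ρc * (exp (-ua / ε) - 1)))).add
      (h5.const_mul (ρd * exp (-(ua + ub) / ε)))).sub_const (ρc * √π)
    refine (h.congr fun t => ?_).trans (by ring_nf; exact le_rfl)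
    rw [explicitDenom_eq, explicitNum]
    ring
  · refine tendsto_explicitR hab hε ?_
    have h1 := tendsto_stepHeat_of_gt hε (hcb.trans (hbd.trans hx))
    have h2 := tendsto_stepHeat_of_gt hε (hbd.trans hx)
    have h3 := tendsto_stepHeat_of_gt hε hx
    have h4 := tendsto_stepHeat_of_gt hε (hac.trans (hcb.trans (hbd.trans hx)))
    have h := ((((h1.const_mul (ρc * exp (-ua / ε))).add
      (h2.const_mul (ρc * (exp (-(ua + ub) / ε) - exp (-ua / ε))))).add
      (h3.const_mul (ρd * exp (-(ua + ub) / ε)))).sub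
      (((h4.const_mul (exp (-ua / ε) - 1)).const_add √π |>.add
      (h2.const_mul (exp (-(ua + ub) / ε) - exp (-ua / ε)))).const_mul (ρc + ρd)))
    refine (h.congr fun t => ?_).trans (by ring_nf; exact le_rfl)
    rw [explicitDenom_eq, explicitNum]

lemma step_tendsto {f : ℝ → ℝ → ℝ} {l : Filter ℝ} {α β p q : ℝ} (hαβ : α < β)
    (h1 : ∀ x, x < α → Tendsto (fun t => f x t) l (𝓝 0))
    (h2 : ∀ x, α < x → x < β → Tendsto (fun t => f x t) l (𝓝 p))
    (h3 : ∀ x, β < x → Tendsto (fun t => f x t) l (𝓝 (p + q))) (x : ℝ) (hα : x ≠ α)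
    (hβ : x ≠ β) :
    Tendsto (fun t => f x t) l (𝓝 (p * (Ioi α).indicator 1 x + q * (Ioi β).indicator 1 x)) := by
  rcases lt_or_gt_of_ne hα with h | h
  · simpa [h.not_gt, (h.trans hαβ).not_gt] using h1 x h
  · rcases lt_or_gt_of_ne hβ with h' | h'
    · simpa [h, h'.not_gt] using h2 x h h'
    · simpa [h, h'] using h3 x h'

theorem isApproximateSolution_explicit (hac : a < c) (hcb : c < b) (hbd : b < d) (hε : 0 < ε) :
    IsApproximateSolution a b c d ua ub ρc ρd ε
      (explicitU a b ua ub ε) (explicitρ a b c d ua ub ρc ρd ε) := by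
  have hab := hac.trans hcb
  have hP := isPotentialSolution_explicit (ua := ua) (ub := ub) (ρc := ρc) (ρd := ρd)
    hac hcb hbd hε
  obtain ⟨V₂, V₃, hV⟩ := exists_heatJet_explicitDenom (a := a) (b := b) (ua := ua) (ub := ub) hε
  obtain ⟨S₂, S₃, hS⟩ := exists_heatJet_explicitNum (b := b) (c := c) (d := d) (ua := ua)
    (ub := ub) (ρc := ρc) (ρd := ρd) hε
  have hpos : ∀ x t, 0 < t → 0 < explicitDenom a b ua ub ε x t := fun x t ht =>
    explicitDenom_pos hab hε ht
  have hU : ∀ x t, 0 < t → HasDerivAt (fun y => explicitPot a b ua ub ε y t)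
      (explicitU a b ua ub ε x t) x := fun x t ht => by
    rw [explicitU_eq]
    exact (hopfCole_eq_U hV hpos (U := explicitPot a b ua ub ε) (fun _ _ => rfl) ht).1
  have hR : ∀ x t, 0 < t → HasDerivAt (fun y => explicitR a b c d ua ub ρc ρd ε y t)
      (explicitρ a b c d ua ub ρc ρd ε x t) x := fun x t ht =>
    (hasDerivAt_explicitR hab hε ht).differentiableAt.hasDerivAt
  have hu2 := contDiffOn_explicitU (ua := ua) (ub := ub) hab hε
  have hρ2 := contDiffOn_explicitρ (c := c) (d := d) (ua := ua) (ub := ub) (ρc := ρc) (ρd := ρd)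
    hab hε
  obtain ⟨K, hK⟩ := hP.bounded
  refine ⟨hu2.of_le two_le_infty, hρ2.of_le two_le_infty,
    fun x t ht => hopfCole_eq_u hV hpos explicitU_eq ht,
    fun x t ht => hopfCole_eq_ρ hV hpos hS explicitU_eq (fun x t ht => explicitρ_eq hab hε ht) ht,
    fun ψ hψ hs => ?_, fun ψ hψ hs => ?_,
    ⟨_, _, hP, fun x t ht => ⟨(hU x t ht).deriv.symm, rfl⟩⟩⟩
  · refine tendsto_integral_deriv_mul (F := fun t x => explicitPot a b ua ub ε x t)
      (F' := fun t x => explicitU a b ua ub ε x t) (K := K) ?_ ?_ ?_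
      (step_tendsto hab hP.init_U_left hP.init_U_mid hP.init_U_right)
      (hψ.of_le (by exact_mod_cast le_top)) hs
    all_goals filter_upwards [self_mem_nhdsWithin] with t ht
    · exact fun x => hU x t ht
    · exact hu2.continuousOn.slice_upperHalf ht
    · exact fun x => (hK x t ht).1
  · refine tendsto_integral_deriv_mul (F := fun t x => explicitR a b c d ua ub ρc ρd ε x t)
      (F' := fun t x => explicitρ a b c d ua ub ρc ρd ε x t) (K := K) ?_ ?_ ?_
      (step_tendsto (hcb.trans hbd) hP.init_R_left hP.init_R_mid hP.init_R_right)
      (hψ.of_le (by exact_mod_cast le_top)) hs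
    all_goals filter_upwards [self_mem_nhdsWithin] with t ht
    · exact fun x => hR x t ht
    · exact hρ2.continuousOn.slice_upperHalf ht
    · exact fun x => (hK x t ht).2

end Existence

/-! ### Uniqueness of approximate solutions -/

section Uniqueness

variable {a b c d ua ub ρc ρd ε : ℝ} {U R U' R' : ℝ → ℝ → ℝ}

/-- The exponential absorbs the quadratic term of the first equation, and the same factor absorbs
the transport term of the second. Both nonlinear uniqueness questions thereby reduce to the heat
equation. -/
lemma IsPotentialSolution.heatSolution (hε : 0 < ε)
    (h : IsPotentialSolution a b c d ua ub ρc ρd ε U R) :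
    HeatSolution ε (fun x t => exp (-U x t / ε)) (dx fun x t => exp (-U x t / ε))
      (dx (dx fun x t => exp (-U x t / ε))) ∧
    HeatSolution ε (fun x t => R x t * exp (-U x t / ε)) (dx fun x t => R x t * exp (-U x t / ε))
      (dx (dx fun x t => R x t * exp (-U x t / ε))) := by
  have hU1 := h.smooth_U.of_le (m := 1) (by norm_num)
  have hR1 := h.smooth_R.of_le (m := 1) (by norm_num)
  have hV : ContDiffOn ℝ 2 (fun p : ℝ × ℝ => exp (-U p.1 p.2 / ε)) upperHalf :=
    (h.smooth_U.neg.div_const ε).exp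
  have hS := h.smooth_R.mul hV
  have gen : ∀ f : ℝ → ℝ → ℝ, ContDiffOn ℝ 2 (fun p : ℝ × ℝ => f p.1 p.2) upperHalf →
      (∀ x t, 0 < t → dt f x t = ε / 2 * dx (dx f) x t) →
      HeatSolution ε f (dx f) (dx (dx f)) := fun f hf he => by
    have hf1 := hf.of_le (m := 1) (by norm_num)
    refine ⟨hf.continuousOn, continuousOn_dx hf1, continuousOn_dx (contDiffOn_dx hf),
      fun x t ht => hasDerivAt_dx hf1 ht, fun x t ht => hasDerivAt_dx (contDiffOn_dx hf) ht,
      fun x t ht => ?_⟩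
    rw [← he x t ht]
    exact hasDerivAt_dt hf1 ht
  have hVx : ∀ x t, 0 < t → HasDerivAt (fun y => exp (-U y t / ε))
      (exp (-U x t / ε) * (-dx U x t / ε)) x := fun x t ht =>
    ((hasDerivAt_dx hU1 ht).fun_neg.div_const ε).exp
  have hVt : ∀ x t, 0 < t → HasDerivAt (fun s => exp (-U x s / ε))
      (exp (-U x t / ε) * (-dt U x t / ε)) t := fun x t ht =>
    ((hasDerivAt_dt hU1 ht).fun_neg.div_const ε).exp
  refine ⟨gen _ hV fun x t ht => ?_, gen _ hS fun x t ht => ?_⟩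
  · have e : (fun y => dx (fun x t => exp (-U x t / ε)) y t) =
        fun y => exp (-U y t / ε) * (-dx U y t / ε) := funext fun y => (hVx y t ht).deriv
    have h2 := (hVx x t ht).fun_mul
      ((hasDerivAt_dx (contDiffOn_dx h.smooth_U) (x := x) ht).fun_neg.div_const ε)
    rw [dt, (hVt x t ht).deriv, dx, e, h2.deriv]
    have h3 := h.eq_U x t ht
    field_simp
    linear_combination -2 * h3
  · have e : (fun y => dx (fun x t => R x t * exp (-U x t / ε)) y t) =
        fun y => dx R y t * exp (-U y t / ε) + R y t * (exp (-U y t / ε) * (-dx U y t / ε)) :=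
      funext fun y => ((hasDerivAt_dx hR1 ht).fun_mul (hVx y t ht)).deriv
    have h2 := ((hasDerivAt_dx (contDiffOn_dx h.smooth_R) (x := x) ht).fun_mul
      (hVx x t ht)).fun_add ((hasDerivAt_dx hR1 ht).fun_mul ((hVx x t ht).fun_mul
      ((hasDerivAt_dx (contDiffOn_dx h.smooth_U) (x := x) ht).fun_neg.div_const ε)))
    rw [dt, ((hasDerivAt_dt hR1 ht).fun_mul (hVt x t ht)).deriv, dx, e, h2.deriv]
    have h3 := h.eq_U x t ht
    have h4 := h.eq_R x t ht
    field_simp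
    linear_combination -2 * R x t * h3 + 2 * ε * h4

/-- Boundedness of U and R makes exp(-U/ε) and R exp(-U/ε) bounded, and off the points a, b, c, d
their initial limits are prescribed. Hence the transforms of two solutions agree; U is recovered by
injectivity of the exponential, R by cancelling it. -/
theorem IsPotentialSolution.unique (hab : a < b) (hcd : c < d) (hε : 0 < ε)
    (h : IsPotentialSolution a b c d ua ub ρc ρd ε U R)
    (h' : IsPotentialSolution a b c d ua ub ρc ρd ε U' R') {x t : ℝ} (ht : 0 < t) :
    U x t = U' x t ∧ R x t = R' x t := by
  obtain ⟨K, hK⟩ := h.bounded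
  obtain ⟨K', hK'⟩ := h'.bounded
  have hVb : ∀ {f : ℝ} {M : ℝ}, |f| ≤ M → exp (-f / ε) ≤ exp (M / ε) := fun {f M} hf => by
    gcongr
    linarith [neg_abs_le f]
  have hlimU : ∀ x, x ≠ a → x ≠ b → ∃ l, Tendsto (fun t => exp (-U x t / ε)) (𝓝[>] 0) (𝓝 l) ∧
      Tendsto (fun t => exp (-U' x t / ε)) (𝓝[>] 0) (𝓝 l) := fun x ha hb =>
    ⟨_, ((step_tendsto hab h.init_U_left h.init_U_mid h.init_U_right x ha hb).neg.div_const
      ε).rexp, ((step_tendsto hab h'.init_U_left h'.init_U_mid h'.init_U_right x ha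
      hb).neg.div_const ε).rexp⟩
  have hne : ∀ p : ℝ, ∀ᵐ x : ℝ, x ≠ p := fun p => by simp [ae_iff]
  have hVV : ∀ x, exp (-U x t / ε) = exp (-U' x t / ε) := fun x => by
    have hz := ((h.heatSolution hε).1.sub (h'.heatSolution hε).1).eq_zero hε
      (K := exp (K / ε) + exp (K' / ε)) (fun x t ht => ?_) ?_ (x := x) ht
    · linarith
    · refine (abs_sub _ _).trans ?_
      rw [abs_of_pos (exp_pos _), abs_of_pos (exp_pos _)]
      exact add_le_add (hVb (hK x t ht).1) (hVb (hK' x t ht).1)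
    · filter_upwards [hne a, hne b] with x ha hb
      obtain ⟨l, h1, h2⟩ := hlimU x ha hb
      simpa using h1.sub h2
  have hSS : R x t * exp (-U x t / ε) = R' x t * exp (-U' x t / ε) := by
    have hz := ((h.heatSolution hε).2.sub (h'.heatSolution hε).2).eq_zero hε
      (K := K * exp (K / ε) + K' * exp (K' / ε)) (fun x t ht => ?_) ?_ (x := x) ht
    · linarith
    · refine (abs_sub _ _).trans ?_
      rw [abs_mul, abs_mul, abs_of_pos (exp_pos _), abs_of_pos (exp_pos _)]
      exact add_le_add (mul_le_mul (hK x t ht).2 (hVb (hK x t ht).1) (exp_pos _).le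
        ((abs_nonneg _).trans (hK x t ht).2)) (mul_le_mul (hK' x t ht).2 (hVb (hK' x t ht).1)
        (exp_pos _).le ((abs_nonneg _).trans (hK' x t ht).2))
    · filter_upwards [hne a, hne b, hne c, hne d] with x ha hb hc hd
      obtain ⟨l, h1, h2⟩ := hlimU x ha hb
      have h3 := step_tendsto hcd h.init_R_left h.init_R_mid h.init_R_right x hc hd
      have h4 := step_tendsto hcd h'.init_R_left h'.init_R_mid h'.init_R_right x hc hd
      simpa using (h3.mul h1).sub (h4.mul h2)
  have hUU : U x t = U' x t := by
    have := exp_injective (hVV x)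
    field_simp at this
    linarith
  refine ⟨hUU, ?_⟩
  rw [hVV x] at hSS
  exact mul_right_cancel₀ (exp_ne_zero _) hSS

theorem IsApproximateSolution.eq_explicit (hac : a < c) (hcb : c < b) (hbd : b < d) (hε : 0 < ε)
    {u ρ : ℝ → ℝ → ℝ} (h : IsApproximateSolution a b c d ua ub ρc ρd ε u ρ) {x t : ℝ}
    (ht : 0 < t) :
    u x t = explicitU a b ua ub ε x t ∧ ρ x t = explicitρ a b c d ua ub ρc ρd ε x t := by
  obtain ⟨U, R, hP, hUR⟩ := h.potential
  obtain ⟨U', R', hP', hUR'⟩ := (isApproximateSolution_explicit (ua := ua) (ub := ub)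
    (ρc := ρc) (ρd := ρd) hac hcb hbd hε).potential
  have key := fun y => hP.unique (hac.trans hcb) (hcb.trans hbd) hε hP' (x := y) ht
  rw [(hUR x t ht).1, (hUR x t ht).2, (hUR' x t ht).1, (hUR' x t ht).2]
  unfold dx
  rw [funext fun y => (key y).1, funext fun y => (key y).2]
  exact ⟨rfl, rfl⟩

end Uniqueness

/-! ### The action and its minimizers -/

/-- The lower semicontinuous step function with jump `k` at `p`. -/
def jump (k p : ℝ) : ℝ → ℝ :=
  if 0 ≤ k then (Ioi p).indicator fun _ => k else (Ici p).indicator fun _ => k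

lemma jump_of_lt {k p y : ℝ} (h : y < p) : jump k p y = 0 := by
  unfold jump; split_ifs <;> simp [h.not_gt, h]

lemma jump_of_gt {k p y : ℝ} (h : p < y) : jump k p y = k := by
  unfold jump; split_ifs <;> simp [h, h.le]

lemma jump_self_of_nonneg {k p : ℝ} (h : 0 ≤ k) : jump k p p = 0 := by
  simp [jump, h]

lemma jump_self_of_neg {k p : ℝ} (h : k < 0) : jump k p p = k := by
  simp [jump, h.not_ge]

lemma jump_eq_or (k p y : ℝ) : jump k p y = 0 ∨ jump k p y = k := by
  rcases lt_trichotomy y p with h | h | h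
  · exact Or.inl (jump_of_lt h)
  · subst h
    rcases le_or_gt 0 k with hk | hk
    · exact Or.inl (jump_self_of_nonneg hk)
    · exact Or.inr (jump_self_of_neg hk)
  · exact Or.inr (jump_of_gt h)

lemma abs_jump_le (k p y : ℝ) : |jump k p y| ≤ |k| := by
  rcases jump_eq_or k p y with h | h <;> simp [h]

lemma lowerSemicontinuous_jump (k p : ℝ) : LowerSemicontinuous (jump k p) := by
  unfold jump
  split_ifs with h
  · exact isOpen_Ioi.lowerSemicontinuous_indicator h
  · exact isClosed_Ici.lowerSemicontinuous_indicator (not_le.1 h).le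

lemma jump_eventually_eq_left {k p y : ℝ} (h : y ≠ p ∨ 0 ≤ k) :
    ∀ᶠ z in 𝓝[<] y, jump k p z = jump k p y := by
  rcases lt_trichotomy y p with hy | hy | hy
  · filter_upwards [self_mem_nhdsWithin] with z hz
    rw [jump_of_lt (lt_trans hz hy), jump_of_lt hy]
  · subst hy
    filter_upwards [self_mem_nhdsWithin] with z hz
    rw [jump_of_lt hz, jump_self_of_nonneg (h.resolve_left (by simp))]
  · filter_upwards [Ioo_mem_nhdsLT hy] with z hz
    rw [jump_of_gt hz.1, jump_of_gt hy]

lemma jump_eventually_eq_right {k p y : ℝ} (h : y ≠ p ∨ k < 0) :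
    ∀ᶠ z in 𝓝[>] y, jump k p z = jump k p y := by
  rcases lt_trichotomy y p with hy | hy | hy
  · filter_upwards [Ioo_mem_nhdsGT hy] with z hz
    rw [jump_of_lt hz.2, jump_of_lt hy]
  · subst hy
    filter_upwards [self_mem_nhdsWithin] with z hz
    rw [jump_of_gt hz, jump_self_of_neg (h.resolve_left (by simp))]
  · filter_upwards [self_mem_nhdsWithin] with z hz
    rw [jump_of_gt (lt_trans hy hz), jump_of_gt hy]

/-- The lower semicontinuous initial potential, with jumps `u_a` at `a` and `u_b` at `b`. -/
def stepData (a b ua ub y : ℝ) : ℝ := jump ua a y + jump ub b y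

/-- The Hopf–Lax action. -/
def action (a b ua ub x t y : ℝ) : ℝ := stepData a b ua ub y + (x - y) ^ 2 / (2 * t)

/-- `y` minimizes the action for the point `(x, t)`. -/
def IsMinimizer (a b ua ub x t y : ℝ) : Prop :=
  ∀ z, action a b ua ub x t y ≤ action a b ua ub x t z

section Action

variable {a b ua ub x t ε : ℝ}

lemma neg_le_stepData (y : ℝ) : -(|ua| + |ub|) ≤ stepData a b ua ub y := by
  have h1 := neg_le_of_abs_le (abs_jump_le ua a y)
  have h2 := neg_le_of_abs_le (abs_jump_le ub b y)
  unfold stepData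
  linarith

lemma lowerSemicontinuous_action : LowerSemicontinuous (action a b ua ub x t) := by
  refine LowerSemicontinuous.add
    ((lowerSemicontinuous_jump ua a).add (lowerSemicontinuous_jump ub b)) ?_
  exact Continuous.lowerSemicontinuous (by fun_prop)

/-- At a jump the lower semicontinuous choice is the smaller of the two values, and that value is
kept on one side. Since a ≠ b, at most one jump sits at y. The side matters little: Laplace's method
only needs an interval of positive length on which the action is almost minimal. -/
lemma stepData_eventually_eq (hab : a < b) (y : ℝ) :
    (∀ᶠ z in 𝓝[<] y, stepData a b ua ub z = stepData a b ua ub y) ∨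
      ∀ᶠ z in 𝓝[>] y, stepData a b ua ub z = stepData a b ua ub y := by
  have left : (y ≠ a ∨ 0 ≤ ua) → (y ≠ b ∨ 0 ≤ ub) →
      ∀ᶠ z in 𝓝[<] y, stepData a b ua ub z = stepData a b ua ub y := fun h1 h2 => by
    filter_upwards [jump_eventually_eq_left h1, jump_eventually_eq_left h2] with z e1 e2
    rw [stepData, e1, e2, stepData]
  have right : (y ≠ a ∨ ua < 0) → (y ≠ b ∨ ub < 0) →
      ∀ᶠ z in 𝓝[>] y, stepData a b ua ub z = stepData a b ua ub y := fun h1 h2 => by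
    filter_upwards [jump_eventually_eq_right h1, jump_eventually_eq_right h2] with z e1 e2
    rw [stepData, e1, e2, stepData]
  by_cases ha : y = a
  · have hb : y ≠ b := by rintro rfl; exact hab.ne' ha
    rcases le_or_gt 0 ua with h | h
    · exact Or.inl (left (Or.inr h) (Or.inl hb))
    · exact Or.inr (right (Or.inr h) (Or.inl hb))
  · rcases le_or_gt 0 ub with h | h
    · exact Or.inl (left (Or.inl ha) (Or.inr h))
    · exact Or.inr (right (Or.inl ha) (Or.inr h))

/-- Near a point the action is, on one side, at most slightly larger. -/
lemma exists_Ioo_action_lt (hab : a < b) (y : ℝ) {M : ℝ} (hM : action a b ua ub x t y < M) :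
    ∃ l r, l < r ∧ ∀ z ∈ Ioo l r, action a b ua ub x t z < M := by
  have hq : ∀ᶠ z in 𝓝 y, stepData a b ua ub y + (x - z) ^ 2 / (2 * t) < M := by
    have : Continuous fun z => stepData a b ua ub y + (x - z) ^ 2 / (2 * t) := by fun_prop
    exact this.tendsto y (gt_mem_nhds hM)
  rcases stepData_eventually_eq (ua := ua) (ub := ub) hab y with h | h
  · have := h.and (hq.filter_mono nhdsWithin_le_nhds)
    obtain ⟨l, hl, hs⟩ := (mem_nhdsLT_iff_exists_Ioo_subset).1 this
    exact ⟨l, y, hl, fun z hz => by rw [action, (hs hz).1]; exact (hs hz).2⟩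
  · have := h.and (hq.filter_mono nhdsWithin_le_nhds)
    obtain ⟨r, hr, hs⟩ := (mem_nhdsGT_iff_exists_Ioo_subset).1 this
    exact ⟨y, r, hr, fun z hz => by rw [action, (hs hz).1]; exact (hs hz).2⟩

lemma exists_forall_action_le (ht : 0 < t) {F : Set ℝ} (hF : IsClosed F) (hne : F.Nonempty) :
    ∃ z ∈ F, ∀ y ∈ F, action a b ua ub x t z ≤ action a b ua ub x t y := by
  obtain ⟨y₁, hy₁⟩ := hne
  set A := |action a b ua ub x t y₁| + |ua| + |ub| with hA
  -- Outside this ball the quadratic term exceeds A, which outweighs the most negative data value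
  -- and the action at y₁; the second entry keeps y₁ inside the ball.
  set r := max (2 * t * A + 1) |y₁ - x| with hr
  have hA0 : 0 ≤ A := by positivity
  have hK : IsCompact (F ∩ Metric.closedBall x r) := (isCompact_closedBall x r).inter_left hF
  have h1 : y₁ ∈ F ∩ Metric.closedBall x r := ⟨hy₁, by
    rw [Metric.mem_closedBall, Real.dist_eq]; exact le_max_right _ _⟩
  obtain ⟨z, hz, hmin⟩ := LowerSemicontinuousOn.exists_isMinOn ⟨y₁, h1⟩ hK
    (lowerSemicontinuous_action (a := a) (b := b) (ua := ua) (ub := ub) (x := x)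
      (t := t) |>.lowerSemicontinuousOn _)
  refine ⟨z, hz.1, fun y hy => ?_⟩
  by_cases hyr : y ∈ Metric.closedBall x r
  · exact hmin ⟨hy, hyr⟩
  · refine (show action a b ua ub x t z ≤ _ from hmin h1).trans ?_
    rw [Metric.mem_closedBall, Real.dist_eq, not_le] at hyr
    have h2 : 2 * t * A + 1 < |y - x| := (le_max_left _ _).trans_lt hyr
    have h3 : 0 ≤ 2 * t * A := by positivity
    have h4 : 2 * t * A ≤ (x - y) ^ 2 := by
      have : (x - y) ^ 2 = |y - x| ^ 2 := by rw [sq_abs]; ring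
      rw [this]
      nlinarith
    have h5 : A ≤ (x - y) ^ 2 / (2 * t) := by
      rw [le_div_iff₀ (by positivity)]
      linarith
    have h6 := neg_le_stepData (a := a) (b := b) (ua := ua) (ub := ub) y
    have h7 := le_abs_self (action a b ua ub x t y₁)
    rw [action.eq_1 a b ua ub x t y]
    linarith

lemma exists_isMinimizer (ht : 0 < t) : ∃ y, IsMinimizer a b ua ub x t y := by
  obtain ⟨z, -, hz⟩ := exists_forall_action_le (a := a) (b := b) (ua := ua) (ub := ub) (x := x) ht
    isClosed_univ univ_nonempty
  exact ⟨z, fun y => hz y (mem_univ y)⟩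

/-! ### Laplace's method -/

/-- The Gibbs weight of the action. -/
def gibbs (a b ua ub x t ε y : ℝ) : ℝ := exp (-action a b ua ub x t y / ε)

lemma gibbs_pos (y : ℝ) : 0 < gibbs a b ua ub x t ε y := exp_pos _

lemma gibbs_eq (y : ℝ) : gibbs a b ua ub x t ε y =
    exp (-stepData a b ua ub y / ε) * exp (-(x - y) ^ 2 / (2 * t * ε)) := by
  rw [gibbs, ← exp_add, action]
  congr 1
  by_cases hε : ε = 0
  · simp [hε]
  by_cases ht : t = 0
  · simp [ht]
  field_simp
  ring

lemma measurable_stepData : Measurable (stepData a b ua ub) :=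
  ((lowerSemicontinuous_jump ua a).add (lowerSemicontinuous_jump ub b)).measurable

lemma abs_exp_stepData_le (hε : 0 < ε) (y : ℝ) :
    ‖exp (-stepData a b ua ub y / ε)‖ ≤ exp ((|ua| + |ub|) / ε) := by
  rw [norm_of_nonneg (exp_pos _).le]
  gcongr
  linarith [neg_le_stepData (a := a) (b := b) (ua := ua) (ub := ub) y]

lemma integrable_gauss (ht : 0 < t) (hε : 0 < ε) :
    Integrable fun y : ℝ => exp (-(x - y) ^ 2 / (2 * t * ε)) := by
  have h := (integrable_exp_neg_mul_sq (b := 1 / (2 * t * ε)) (by positivity)).comp_sub_left x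
  refine h.congr (Eventually.of_forall fun y => ?_)
  simp only
  congr 1
  ring

lemma integrable_mul_gauss (ht : 0 < t) (hε : 0 < ε) :
    Integrable fun y : ℝ => (x - y) / t * exp (-(x - y) ^ 2 / (2 * t * ε)) := by
  have h := ((integrable_mul_exp_neg_mul_sq (b := 1 / (2 * t * ε))
    (by positivity)).comp_sub_left x).div_const t
  refine h.congr (Eventually.of_forall fun y => ?_)
  simp only
  rw [show -(1 / (2 * t * ε)) * (x - y) ^ 2 = -(x - y) ^ 2 / (2 * t * ε) by ring]
  ring

lemma integrable_gibbs (ht : 0 < t) (hε : 0 < ε) : Integrable (gibbs a b ua ub x t ε) := by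
  rw [funext gibbs_eq]
  exact (integrable_gauss ht hε).bdd_mul
    ((measurable_stepData.neg.div_const ε).exp.aestronglyMeasurable)
    (Eventually.of_forall fun y => abs_exp_stepData_le hε y)

lemma integrable_mul_gibbs (ht : 0 < t) (hε : 0 < ε) :
    Integrable fun y => (x - y) / t * gibbs a b ua ub x t ε y := by
  have h := (integrable_mul_gauss (x := x) ht hε).bdd_mul
    ((measurable_stepData (a := a) (b := b) (ua := ua)
      (ub := ub).neg.div_const ε).exp.aestronglyMeasurable)
    (Eventually.of_forall fun y => abs_exp_stepData_le hε y)
  refine h.congr (Eventually.of_forall fun y => ?_)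
  simp only [gibbs_eq, Pi.neg_apply]
  ring

lemma integral_gibbs_pos (ht : 0 < t) (hε : 0 < ε) : 0 < ∫ y, gibbs a b ua ub x t ε y := by
  refine (integral_pos_iff_support_of_nonneg (fun y => (gibbs_pos y).le)
    (integrable_gibbs ht hε)).2 ?_
  have : Function.support (gibbs a b ua ub x t ε) = univ := by
    ext y; simp [(gibbs_pos y).ne']
  rw [this]
  simp

/-- A closed set without minimizers carries asymptotically no mass. -/
lemma tendsto_setIntegral_gibbs_div (hab : a < b) (ht : 0 < t) {F : Set ℝ} (hF : IsClosed F)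
    (hmin : ∀ y ∈ F, ¬ IsMinimizer a b ua ub x t y) {g : ℝ → ℝ} (hg0 : ∀ y, 0 ≤ g y)
    (hg : ∀ ε, 0 < ε → Integrable fun y => g y * gibbs a b ua ub x t ε y) :
    Tendsto (fun ε => (∫ y in F, g y * gibbs a b ua ub x t ε y) / ∫ y, gibbs a b ua ub x t ε y)
      (𝓝[>] 0) (𝓝 0) := by
  rcases F.eq_empty_or_nonempty with rfl | hne
  · simp
  obtain ⟨y₀, hy₀⟩ := exists_isMinimizer (a := a) (b := b) (ua := ua) (ub := ub) (x := x) ht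
  obtain ⟨z, hzF, hz⟩ := exists_forall_action_le (a := a) (b := b) (ua := ua) (ub := ub) (x := x)
    ht hF hne
  set m := action a b ua ub x t y₀ with hm
  set m' := action a b ua ub x t z with hm'
  have hlt : m < m' := by
    by_contra! h
    exact hmin z hzF fun y => h.trans (hy₀ y)
  -- The level halfway between the global minimum m and the minimum m' over F bounds the total mass
  -- from below by (r - l) exp(-(m+m')/(2ε)), while F carries at most a constant times exp(-m'/ε).
  -- The ratio decays like exp(-(m'-m)/(2ε)).
  obtain ⟨l, r, hlr, hJ⟩ := exists_Ioo_action_lt (ua := ua) (ub := ub) (x := x) (t := t) hab y₀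
    (M := (m + m') / 2) (by linarith)
  set C := ∫ y, g y * gibbs a b ua ub x t 1 y with hC
  have hlow : ∀ ε, 0 < ε → (r - l) * exp (-((m + m') / 2) / ε) ≤ ∫ y, gibbs a b ua ub x t ε y :=
    fun ε hε => by
    have h1 : ∫ y in Ioo l r, exp (-((m + m') / 2) / ε) ≤ ∫ y in Ioo l r, gibbs a b ua ub x t ε y :=
      setIntegral_mono_on (by simp) (integrable_gibbs ht hε).integrableOn
        measurableSet_Ioo fun y hy => by
          unfold gibbs
          gcongr
          exact (hJ y hy).le
    rw [setIntegral_const, smul_eq_mul, Measure.real, Real.volume_Ioo,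
      ENNReal.toReal_ofReal (by linarith)] at h1
    exact h1.trans (setIntegral_le_integral (integrable_gibbs ht hε)
      (Eventually.of_forall fun y => (gibbs_pos y).le))
  have hup : ∀ ε, 0 < ε → ε ≤ 1 →
      ∫ y in F, g y * gibbs a b ua ub x t ε y ≤ exp (-m' / ε) * (exp m' * C) := fun ε hε hε1 => by
    have h1 : ∫ y in F, g y * gibbs a b ua ub x t ε y ≤
        ∫ y in F, exp (-m' / ε) * exp m' * (g y * gibbs a b ua ub x t 1 y) := by
      refine setIntegral_mono_on (hg ε hε).integrableOn ((hg 1 one_pos).const_mul _).integrableOn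
        hF.measurableSet fun y hy => ?_
      have h2 : gibbs a b ua ub x t ε y ≤ exp (-m' / ε) * exp m' * gibbs a b ua ub x t 1 y := by
        unfold gibbs
        rw [← exp_add, ← exp_add]
        gcongr
        -- On F the excess over m' is nonnegative and can only grow when divided by ε ≤ 1. Thus the
        -- weight at ε = 1 is an integrable majorant for all smaller ε.
        have h3 : 0 ≤ action a b ua ub x t y - m' := sub_nonneg.2 (hz y hy)
        have h4 : action a b ua ub x t y - m' ≤ (action a b ua ub x t y - m') / ε := by
          rw [le_div_iff₀ hε]
          nlinarith
        have h5 : (action a b ua ub x t y - m') / ε = action a b ua ub x t y / ε - m' / ε := by ring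
        rw [neg_div, neg_div, div_one]
        linarith
      calc g y * gibbs a b ua ub x t ε y
          ≤ g y * (exp (-m' / ε) * exp m' * gibbs a b ua ub x t 1 y) :=
            mul_le_mul_of_nonneg_left h2 (hg0 y)
        _ = _ := by ring
    rw [integral_const_mul, mul_assoc] at h1
    refine h1.trans ?_
    gcongr
    exact setIntegral_le_integral (hg 1 one_pos)
      (Eventually.of_forall fun y => mul_nonneg (hg0 y) (gibbs_pos y).le)
  have hC0 : 0 ≤ C := integral_nonneg fun y => mul_nonneg (hg0 y) (gibbs_pos y).le
  have hlim : Tendsto (fun ε => exp m' * C / (r - l) * exp (-((m' - m) / 2 * ε⁻¹))) (𝓝[>] 0)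
      (𝓝 0) := by
    have h1 : Tendsto (fun ε : ℝ => (m' - m) / 2 * ε⁻¹) (𝓝[>] 0) atTop :=
      tendsto_inv_nhdsGT_zero.const_mul_atTop (by linarith)
    simpa using (tendsto_exp_neg_atTop_nhds_zero.comp h1).const_mul (exp m' * C / (r - l))
  refine squeeze_zero' ?_ ?_ hlim
  · filter_upwards [self_mem_nhdsWithin] with ε hε
    exact div_nonneg (integral_nonneg fun y => mul_nonneg (hg0 y) (gibbs_pos y).le)
      (integral_gibbs_pos ht hε).le
  · filter_upwards [Ioc_mem_nhdsGT one_pos] with ε hε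
    have hrl : 0 < r - l := sub_pos.2 hlr
    calc _ ≤ exp (-m' / ε) * (exp m' * C) / ((r - l) * exp (-((m + m') / 2) / ε)) :=
          div_le_div₀ (by positivity) (hup ε hε.1 hε.2) (by positivity) (hlow ε hε.1)
      _ = _ := by
          have hε0 : ε ≠ 0 := hε.1.ne'
          have : exp (-m' / ε) = exp (-((m' - m) / 2 * ε⁻¹)) * exp (-((m + m') / 2) / ε) := by
            rw [← exp_add]
            congr 1
            field_simp
            ring
          rw [this]
          field_simp

lemma tendsto_gibbs_Ioi_one (hab : a < b) (ht : 0 < t) {p : ℝ}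
    (hmin : ∀ y, IsMinimizer a b ua ub x t y → p < y) :
    Tendsto (fun ε => (∫ y in Ioi p, gibbs a b ua ub x t ε y) / ∫ y, gibbs a b ua ub x t ε y)
      (𝓝[>] 0) (𝓝 1) := by
  have h := (tendsto_setIntegral_gibbs_div hab ht (isClosed_Iic (a := p))
    (fun y hy hm => absurd (hmin y hm) (not_lt.2 hy)) (g := fun _ => 1) (fun _ => zero_le_one)
    fun ε hε => by simpa using integrable_gibbs ht hε).const_sub 1
  rw [sub_zero] at h
  refine h.congr' ?_
  filter_upwards [self_mem_nhdsWithin] with ε hε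
  have hZ := integral_gibbs_pos (a := a) (b := b) (ua := ua) (ub := ub) (x := x) ht hε
  have hs := integral_add_compl (measurableSet_Iic (a := p))
    (integrable_gibbs (a := a) (b := b) (ua := ua) (ub := ub) (x := x) ht hε)
  rw [compl_Iic] at hs
  simp only [one_mul]
  rw [← hs] at hZ ⊢
  field_simp
  ring

lemma tendsto_gibbs_Ioi_zero (hab : a < b) (ht : 0 < t) {p : ℝ}
    (hmin : ∀ y, IsMinimizer a b ua ub x t y → y < p) :
    Tendsto (fun ε => (∫ y in Ioi p, gibbs a b ua ub x t ε y) / ∫ y, gibbs a b ua ub x t ε y)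
      (𝓝[>] 0) (𝓝 0) := by
  have h := tendsto_setIntegral_gibbs_div hab ht (isClosed_Ici (a := p))
    (fun y hy hm => absurd (hmin y hm) (not_lt.2 hy)) (g := fun _ => 1) (fun _ => zero_le_one)
    fun ε hε => by simpa using integrable_gibbs ht hε
  simpa only [one_mul, integral_Ici_eq_integral_Ioi] using h

/-- The observable is unbounded, which is why the Laplace estimate admits a weight g. With g = |y₀ -
y|/t the part away from y₀ disappears in the limit, and the part near y₀ is small because g is. -/
lemma tendsto_gibbs_mean (hab : a < b) (ht : 0 < t) {y₀ : ℝ}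
    (hmin : ∀ y, IsMinimizer a b ua ub x t y → y = y₀) :
    Tendsto (fun ε => (∫ y, (x - y) / t * gibbs a b ua ub x t ε y) /
      ∫ y, gibbs a b ua ub x t ε y) (𝓝[>] 0) (𝓝 ((x - y₀) / t)) := by
  have hint : ∀ ε, 0 < ε → Integrable fun y => (y₀ - y) / t * gibbs a b ua ub x t ε y :=
    fun ε hε => by
    refine ((integrable_mul_gibbs (a := a) (b := b) (ua := ua) (ub := ub) (x := x) ht hε).sub
      ((integrable_gibbs (a := a) (b := b) (ua := ua) (ub := ub) (x := x) ht hε).const_mul ((x - y₀) / t))).congr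
      (Eventually.of_forall fun y => ?_)
    simp only [Pi.sub_apply]
    ring
  have hint' : ∀ ε, 0 < ε → Integrable fun y => |(y₀ - y) / t| * gibbs a b ua ub x t ε y :=
    fun ε hε => by
    refine (hint ε hε).abs.congr (Eventually.of_forall fun y => ?_)
    simp only [abs_mul, abs_of_pos (gibbs_pos y)]
  rw [Metric.tendsto_nhds]
  intro δ hδ
  -- On the ball of radius tδ/2 the observable |y₀ - y|/t is below δ/2, which leaves δ/2 for the
  -- complement.
  have h := tendsto_setIntegral_gibbs_div hab ht (F := (Metric.ball y₀ (t * δ / 2))ᶜ)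
    Metric.isOpen_ball.isClosed_compl
    (fun y hy hm => hy (by rw [hmin y hm]; exact Metric.mem_ball_self (by positivity)))
    (fun y => abs_nonneg ((y₀ - y) / t)) hint'
  filter_upwards [h.eventually (gt_mem_nhds (half_pos hδ)), self_mem_nhdsWithin] with ε h1 hε
  have hε : 0 < ε := hε
  have hZ := integral_gibbs_pos (a := a) (b := b) (ua := ua) (ub := ub) (x := x) ht hε
  have e : (∫ y, (x - y) / t * gibbs a b ua ub x t ε y) / (∫ y, gibbs a b ua ub x t ε y)
      - (x - y₀) / t = (∫ y, (y₀ - y) / t * gibbs a b ua ub x t ε y)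
        / ∫ y, gibbs a b ua ub x t ε y := by
    rw [eq_div_iff hZ.ne', sub_mul, div_mul_cancel₀ _ hZ.ne', ← integral_const_mul,
      ← integral_sub (integrable_mul_gibbs ht hε) ((integrable_gibbs ht hε).const_mul _)]
    congr 1
    funext y
    ring
  rw [Real.dist_eq, e, abs_div, abs_of_pos hZ, div_lt_iff₀ hZ]
  have h2 : |∫ y, (y₀ - y) / t * gibbs a b ua ub x t ε y|
      ≤ ∫ y, |(y₀ - y) / t| * gibbs a b ua ub x t ε y := by
    refine (abs_integral_le_integral_abs).trans (le_of_eq ?_)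
    congr 1
    funext y
    rw [abs_mul, abs_of_pos (gibbs_pos y)]
  have h3 : ∫ y in Metric.ball y₀ (t * δ / 2), |(y₀ - y) / t| * gibbs a b ua ub x t ε y
      ≤ ∫ y in Metric.ball y₀ (t * δ / 2), δ / 2 * gibbs a b ua ub x t ε y := by
    refine setIntegral_mono_on (hint' ε hε).integrableOn
      ((integrable_gibbs ht hε).const_mul _).integrableOn Metric.isOpen_ball.measurableSet
      fun y hy => mul_le_mul_of_nonneg_right ?_ (gibbs_pos y).le
    rw [Metric.mem_ball, dist_comm, Real.dist_eq] at hy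
    rw [abs_div, abs_of_pos ht, div_le_iff₀ ht]
    linarith
  have h4 : ∫ y in Metric.ball y₀ (t * δ / 2), δ / 2 * gibbs a b ua ub x t ε y
      ≤ δ / 2 * ∫ y, gibbs a b ua ub x t ε y := by
    rw [integral_const_mul]
    exact mul_le_mul_of_nonneg_left (setIntegral_le_integral (integrable_gibbs ht hε)
      (Eventually.of_forall fun y => (gibbs_pos y).le)) (half_pos hδ).le
  rw [div_lt_iff₀ hZ] at h1
  have h5 := integral_add_compl (measurableSet_ball (x := y₀) (ε := t * δ / 2))
    (hint' ε hε)
  linarith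

end Action

/-! ### The explicit solution as a Gibbs mean -/

section GibbsMean

variable {a b c d ua ub ρc ρd x t ε : ℝ}

lemma stepData_of_lt (hab : a < b) {y : ℝ} (h : y < a) : stepData a b ua ub y = 0 := by
  rw [stepData, jump_of_lt h, jump_of_lt (h.trans hab), add_zero]

lemma stepData_of_mem_Ioo {y : ℝ} (h : a < y) (h' : y < b) : stepData a b ua ub y = ua := by
  rw [stepData, jump_of_gt h, jump_of_lt h', add_zero]

lemma stepData_of_gt (hab : a < b) {y : ℝ} (h : b < y) : stepData a b ua ub y = ua + ub := by
  rw [stepData, jump_of_gt (hab.trans h), jump_of_gt h]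

/-- The values chosen at a and b for the sake of semicontinuity affect only a null set, so the
integrals see the plain step function. -/
lemma exp_stepData_mul_ae (hab : a < b) (f : ℝ → ℝ) :
    (fun y => exp (-stepData a b ua ub y / ε) * f y) =ᵐ[volume] fun y =>
      f y + (exp (-ua / ε) - 1) * (Ioi a).indicator f y
        + (exp (-(ua + ub) / ε) - exp (-ua / ε)) * (Ioi b).indicator f y := by
  have hne : ∀ p : ℝ, ∀ᵐ y : ℝ, y ≠ p := fun p => by simp [ae_iff]
  filter_upwards [hne a, hne b] with y ha hb
  rcases lt_or_gt_of_ne ha with h | h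
  · simp [stepData_of_lt hab h, h.not_gt, (h.trans hab).not_gt]
  · rcases lt_or_gt_of_ne hb with h' | h'
    · rw [stepData_of_mem_Ioo h h']
      simp [h, h'.not_gt]
      ring
    · rw [stepData_of_gt hab h']
      simp [h, h']
      ring

lemma integral_exp_stepData_mul (hab : a < b) {f : ℝ → ℝ} (hf : Integrable f) :
    ∫ y, exp (-stepData a b ua ub y / ε) * f y =
      (∫ y, f y) + (exp (-ua / ε) - 1) * (∫ y in Ioi a, f y)
        + (exp (-(ua + ub) / ε) - exp (-ua / ε)) * ∫ y in Ioi b, f y := by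
  have h1 := (hf.indicator (measurableSet_Ioi (a := a))).const_mul (exp (-ua / ε) - 1)
  have h2 := (hf.indicator (measurableSet_Ioi (a := b))).const_mul
    (exp (-(ua + ub) / ε) - exp (-ua / ε))
  have h3 : Integrable fun y => f y + (exp (-ua / ε) - 1) * (Ioi a).indicator f y := hf.add h1
  rw [integral_congr_ae (exp_stepData_mul_ae hab f), integral_add h3 h2,
    integral_add hf h1, integral_const_mul, integral_const_mul,
    integral_indicator measurableSet_Ioi, integral_indicator measurableSet_Ioi]

lemma setIntegral_exp_stepData_mul (hab : a < b) {f : ℝ → ℝ} (hf : Integrable f) (p : ℝ) :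
    ∫ y in Ioi p, exp (-stepData a b ua ub y / ε) * f y =
      (∫ y in Ioi p, f y) + (exp (-ua / ε) - 1) * (∫ y in Ioi (a ⊔ p), f y)
        + (exp (-(ua + ub) / ε) - exp (-ua / ε)) * ∫ y in Ioi (b ⊔ p), f y := by
  have h := integral_exp_stepData_mul (ε := ε) (ua := ua) (ub := ub) hab
    (hf.indicator (measurableSet_Ioi (a := p)))
  rw [setIntegral_indicator measurableSet_Ioi, setIntegral_indicator measurableSet_Ioi,
    integral_indicator measurableSet_Ioi, Ioi_inter_Ioi, Ioi_inter_Ioi] at h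
  rw [← h, ← integral_indicator measurableSet_Ioi]
  congr 1
  funext y
  by_cases hy : y ∈ Ioi p <;> simp [hy]

lemma setIntegral_gauss (ht : 0 < t) (hε : 0 < ε) (p : ℝ) :
    ∫ y in Ioi p, exp (-(x - y) ^ 2 / (2 * t * ε)) = √(2 * t * ε) * stepHeat p ε x t := by
  have hr : 0 < √(2 * t * ε) := by positivity
  have hr2 : √(2 * t * ε) ^ 2 = 2 * t * ε := sq_sqrt (by positivity)
  have hd : ∀ y ∈ Ici p, HasDerivAt (fun y => -√(2 * t * ε) * erfc ((y - x) / √(2 * t * ε)))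
      (exp (-(x - y) ^ 2 / (2 * t * ε))) y := fun y _ => by
    have h := ((hasDerivAt_erfc ((y - x) / √(2 * t * ε))).comp y
      (((hasDerivAt_id y).sub_const x).div_const √(2 * t * ε))).const_mul (-√(2 * t * ε))
    refine h.congr_deriv ?_
    rw [div_pow, hr2, show -((y - x) ^ 2 / (2 * t * ε)) = -(x - y) ^ 2 / (2 * t * ε) by ring]
    field_simp
  rw [integral_Ioi_of_hasDerivAt_of_tendsto' (m := 0)
    (f := fun y => -√(2 * t * ε) * erfc ((y - x) / √(2 * t * ε)))
    hd (integrable_gauss ht hε).integrableOn ?_]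
  · rw [stepHeat, show -((x - p) / √(2 * t * ε)) = (p - x) / √(2 * t * ε) by ring]
    ring
  · have h : Tendsto (fun y => (y - x) / √(2 * t * ε)) atTop atTop :=
      (tendsto_atTop_add_const_right atTop (-x) tendsto_id).atTop_div_const hr
    simpa using (tendsto_erfc_atTop.comp h).const_mul (-√(2 * t * ε))

lemma integral_gauss (ht : 0 < t) (hε : 0 < ε) :
    ∫ y, exp (-(x - y) ^ 2 / (2 * t * ε)) = √(2 * t * ε) * √π := by
  have h := integral_sub_left_eq_self (fun y => exp (-(1 / (2 * t * ε)) * y ^ 2)) volume x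
  rw [integral_gaussian, div_div_eq_mul_div, div_one, mul_comm π, sqrt_mul (by positivity)] at h
  rw [← h]
  congr 1
  funext y
  congr 1
  ring

lemma hasDerivAt_gauss (ht : 0 < t) (hε : 0 < ε) (y : ℝ) :
    HasDerivAt (fun y => ε * exp (-(x - y) ^ 2 / (2 * t * ε)))
      ((x - y) / t * exp (-(x - y) ^ 2 / (2 * t * ε))) y := by
  have h := (((((hasDerivAt_id y).const_sub x).fun_pow 2).fun_neg.div_const
    (2 * t * ε)).exp).const_mul ε
  refine h.congr_deriv ?_
  simp only [id, Nat.cast_ofNat, Nat.add_one_sub_one, pow_one]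
  field_simp

lemma setIntegral_mul_gauss (ht : 0 < t) (hε : 0 < ε) (p : ℝ) :
    ∫ y in Ioi p, (x - y) / t * exp (-(x - y) ^ 2 / (2 * t * ε)) =
      -(ε * √(2 * t * ε) * gaussHeat p ε x t) := by
  have hr : 0 < √(2 * t * ε) := by positivity
  rw [integral_Ioi_of_hasDerivAt_of_tendsto' (fun y _ => hasDerivAt_gauss ht hε y)
    (integrable_mul_gauss ht hε).integrableOn
    (tendsto_zero_of_hasDerivAt_of_integrableOn_Ioi (a := p)
      (fun y _ => hasDerivAt_gauss ht hε y) (integrable_mul_gauss ht hε).integrableOn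
      ((integrable_gauss ht hε).const_mul ε).integrableOn), gaussHeat]
  field_simp
  ring

lemma integral_mul_gauss (ht : 0 < t) (hε : 0 < ε) :
    ∫ y, (x - y) / t * exp (-(x - y) ^ 2 / (2 * t * ε)) = 0 :=
  integral_eq_zero_of_hasDerivAt_of_integrable (hasDerivAt_gauss ht hε)
    (integrable_mul_gauss ht hε) ((integrable_gauss ht hε).const_mul ε)

lemma integral_gibbs (hab : a < b) (ht : 0 < t) (hε : 0 < ε) :
    ∫ y, gibbs a b ua ub x t ε y = √(2 * t * ε) * explicitDenom a b ua ub ε x t := by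
  simp_rw [gibbs_eq]
  rw [integral_exp_stepData_mul hab (integrable_gauss ht hε), integral_gauss ht hε,
    setIntegral_gauss ht hε, setIntegral_gauss ht hε, explicitDenom_eq]
  ring

/-- Because a < c < b, cutting at c removes the jump at a from the integral and keeps the one at b.
The coefficient of ρ_c in R^ε thus becomes the probability of y > c. -/
lemma explicitNumLeft_div (hac : a < c) (hcb : c < b) (ht : 0 < t) (hε : 0 < ε) :
    explicitNumLeft b c ua ub ε x t / explicitDenom a b ua ub ε x t =
      (∫ y in Ioi c, gibbs a b ua ub x t ε y) / ∫ y, gibbs a b ua ub x t ε y := by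
  have hr : √(2 * t * ε) ≠ 0 := by positivity
  have hab := hac.trans hcb
  rw [integral_gibbs hab ht hε]
  simp_rw [gibbs_eq]
  rw [setIntegral_exp_stepData_mul hab (integrable_gauss ht hε), setIntegral_gauss ht hε,
    setIntegral_gauss ht hε, setIntegral_gauss ht hε, sup_eq_right.2 hac.le,
    sup_eq_left.2 hcb.le, ← mul_div_mul_left _ _ hr, explicitNumLeft]
  congr 1
  ring

lemma explicitNumRight_div (hab : a < b) (hbd : b < d) (ht : 0 < t) (hε : 0 < ε) :
    explicitNumRight d ua ub ε x t / explicitDenom a b ua ub ε x t =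
      (∫ y in Ioi d, gibbs a b ua ub x t ε y) / ∫ y, gibbs a b ua ub x t ε y := by
  have hr : √(2 * t * ε) ≠ 0 := by positivity
  rw [integral_gibbs hab ht hε]
  simp_rw [gibbs_eq]
  rw [setIntegral_exp_stepData_mul hab (integrable_gauss ht hε), setIntegral_gauss ht hε,
    setIntegral_gauss ht hε, setIntegral_gauss ht hε, sup_eq_right.2 (hab.trans hbd).le,
    sup_eq_right.2 hbd.le, ← mul_div_mul_left _ _ hr, explicitNumRight]
  congr 1
  ring

lemma explicitU_eq_gibbs (hab : a < b) (ht : 0 < t) (hε : 0 < ε) :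
    explicitU a b ua ub ε x t =
      (∫ y, (x - y) / t * gibbs a b ua ub x t ε y) / ∫ y, gibbs a b ua ub x t ε y := by
  have hr : √(2 * t * ε) ≠ 0 := by positivity
  rw [integral_gibbs hab ht hε]
  have e : ∀ y, (x - y) / t * gibbs a b ua ub x t ε y = exp (-stepData a b ua ub y / ε) *
      ((x - y) / t * exp (-(x - y) ^ 2 / (2 * t * ε))) := fun y => by
    rw [gibbs_eq]
    ring
  simp_rw [e]
  rw [integral_exp_stepData_mul hab (integrable_mul_gauss ht hε), integral_mul_gauss ht hε,
    setIntegral_mul_gauss ht hε, setIntegral_mul_gauss ht hε, explicitU_eq,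
    ← mul_div_mul_left _ _ hr, explicitDenomDx]
  congr 1
  ring

end GibbsMean

/-! ### Geometry of the minimizers -/

section Geometry

variable {a b ua ub x x' t p y y' : ℝ}

/-- Adding the two minimality inequalities cancels the data and leaves (x' - x)(y' - y) ≥ 0. -/
lemma IsMinimizer.mono (ht : 0 < t) (hx : x < x') (h : IsMinimizer a b ua ub x t y)
    (h' : IsMinimizer a b ua ub x' t y') : y ≤ y' := by
  have h1 := h y'
  have h2 := h' y
  unfold action at h1 h2
  have h3 : (x - y) ^ 2 / (2 * t) + (x' - y') ^ 2 / (2 * t)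
      ≤ (x - y') ^ 2 / (2 * t) + (x' - y) ^ 2 / (2 * t) := by linarith
  rw [← add_div, ← add_div, div_le_div_iff_of_pos_right (by positivity)] at h3
  by_contra! h4
  nlinarith [mul_pos (sub_pos.2 hx) (sub_pos.2 h4)]

lemma stepData_eventually_eq_nhds (hab : a < b) (ha : y ≠ a) (hb : y ≠ b) :
    ∀ᶠ z in 𝓝 y, stepData a b ua ub z = stepData a b ua ub y := by
  rcases lt_or_gt_of_ne ha with h | h
  · filter_upwards [gt_mem_nhds h] with z hz
    rw [stepData_of_lt hab h, stepData_of_lt hab hz]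
  · rcases lt_or_gt_of_ne hb with h' | h'
    · filter_upwards [Ioo_mem_nhds h h'] with z hz
      rw [stepData_of_mem_Ioo h h', stepData_of_mem_Ioo hz.1 hz.2]
    · filter_upwards [lt_mem_nhds h'] with z hz
      rw [stepData_of_gt hab h', stepData_of_gt hab hz]

/-- A minimizer at which the data are locally constant is the point itself. -/
lemma IsMinimizer.eq_self (hab : a < b) (ht : 0 < t) (h : IsMinimizer a b ua ub x t y)
    (ha : y ≠ a) (hb : y ≠ b) : y = x := by
  -- Moving y a fraction s of the way towards x multiplies the quadratic cost by (1 - s)², without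
  -- changing the data when s is small.
  have hc : Tendsto (fun s : ℝ => y + s * (x - y)) (𝓝[>] 0) (𝓝 y) := by
    have : Continuous fun s : ℝ => y + s * (x - y) := by fun_prop
    simpa using (this.tendsto 0).mono_left nhdsWithin_le_nhds
  obtain ⟨s, hs, hs1⟩ := ((hc.eventually (stepData_eventually_eq_nhds (ua := ua) (ub := ub)
    hab ha hb)).and (Ioo_mem_nhdsGT one_pos)).exists
  have h1 := h (y + s * (x - y))
  rw [action, action, hs, add_le_add_iff_left, div_le_div_iff_of_pos_right (by positivity)] at h1
  by_contra hne
  have h2 : 0 < (x - y) ^ 2 := by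
    have := sub_ne_zero.2 (Ne.symm hne)
    positivity
  nlinarith [mul_pos (mul_pos hs1.1 (sub_pos.2 hs1.2)) h2, mul_pos hs1.1 h2]

/-- `x` separates the points whose minimizers lie to the left of `p` from those whose minimizers
lie to the right of `p`. -/
def IsFront (a b ua ub p t x : ℝ) : Prop :=
  ∃ y y', y ≤ p ∧ p ≤ y' ∧ IsMinimizer a b ua ub x t y ∧ IsMinimizer a b ua ub x t y'

/-- Monotonicity already gives p ≤ y. In case of equality p would minimize for both x and x'; since
the data are locally constant at p, this would force x = p = x'. -/
lemma IsFront.lt_of_gt (hab : a < b) (ht : 0 < t) (ha : p ≠ a) (hb : p ≠ b)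
    (h : IsFront a b ua ub p t x) (hx : x < x') (hy : IsMinimizer a b ua ub x' t y) : p < y := by
  obtain ⟨-, z, -, hz, -, hm⟩ := h
  refine lt_of_le_of_ne (hz.trans (hm.mono ht hx hy)) ?_
  rintro rfl
  obtain rfl : p = z := le_antisymm hz (hm.mono ht hx hy)
  exact hx.ne ((hm.eq_self hab ht ha hb).symm.trans (hy.eq_self hab ht ha hb))

lemma IsFront.gt_of_lt (hab : a < b) (ht : 0 < t) (ha : p ≠ a) (hb : p ≠ b)
    (h : IsFront a b ua ub p t x) (hx : x' < x) (hy : IsMinimizer a b ua ub x' t y) : y < p := by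
  obtain ⟨z, -, hz, -, hm, -⟩ := h
  refine lt_of_le_of_ne ((hy.mono ht hx hm).trans hz) ?_
  rintro rfl
  obtain rfl : z = y := le_antisymm hz (hy.mono ht hx hm)
  exact hx.ne ((hy.eq_self hab ht ha hb).symm.trans (hm.eq_self hab ht ha hb))

/-- Monotonicity squeezes every minimizer in between to p. With p = a or p = b this produces the
fans, where u = (x - p)/t. -/
lemma eq_of_isMinimizer_of_mem_Ioo {x₀ x₁ : ℝ} (ht : 0 < t) (h₀ : IsMinimizer a b ua ub x₀ t p)
    (h₁ : IsMinimizer a b ua ub x₁ t p) (hx : x ∈ Ioo x₀ x₁) (hy : IsMinimizer a b ua ub x t y) :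
    y = p :=
  le_antisymm (hy.mono ht hx.2 h₁) (h₀.mono ht hx.1 hy)

/-- Right of a point that is its own minimizer, the action of any other point further left is
larger than the data. -/
lemma IsMinimizer.lt_action_right (ht : 0 < t) (h : IsMinimizer a b ua ub x t x) (hx : x < x')
    (hy : y ≤ x) : stepData a b ua ub x < action a b ua ub x' t y := by
  have h1 := h y
  have h2 : (x - y) ^ 2 / (2 * t) < (x' - y) ^ 2 / (2 * t) := by
    rw [div_lt_div_iff_of_pos_right (by positivity)]
    nlinarith
  unfold action at *
  rw [sub_self, zero_pow two_ne_zero, zero_div, add_zero] at h1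
  linarith

lemma IsMinimizer.lt_action_left (ht : 0 < t) (h : IsMinimizer a b ua ub x t x) (hx : x' < x)
    (hy : x ≤ y) : stepData a b ua ub x < action a b ua ub x' t y := by
  have h1 := h y
  have h2 : (x - y) ^ 2 / (2 * t) < (x' - y) ^ 2 / (2 * t) := by
    rw [div_lt_div_iff_of_pos_right (by positivity)]
    nlinarith
  unfold action at *
  rw [sub_self, zero_pow two_ne_zero, zero_div, add_zero] at h1
  linarith

lemma action_self : action a b ua ub x t x = stepData a b ua ub x := by
  simp [action]

lemma lt_action_of_stepData_eq (ht : 0 < t) (hne : y ≠ x)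
    (h : stepData a b ua ub y = stepData a b ua ub x) :
    action a b ua ub x t x < action a b ua ub x t y := by
  rw [action_self, action, h]
  have := sub_ne_zero.2 hne.symm
  have : 0 < (x - y) ^ 2 / (2 * t) := by positivity
  linarith

/-- Competitors beyond x₁ cost more than the resting value, because x₁ prefers itself and is closer
to them. The other competitors lie in the same constancy interval and only add a positive distance
term. The two companions for the middle and right intervals rest on the same dichotomy. -/
lemma eq_self_of_lt (hab : a < b) (ht : 0 < t) {x₁ : ℝ} (hx₁ : x₁ ≤ a)
    (hs : stepData a b ua ub x₁ = 0) (h₁ : IsMinimizer a b ua ub x₁ t x₁) (hx : x < x₁)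
    (hy : IsMinimizer a b ua ub x t y) : y = x := by
  by_contra hne
  have hsx : stepData a b ua ub x = 0 := stepData_of_lt hab (hx.trans_le hx₁)
  rcases le_or_gt x₁ y with h | h
  · have := h₁.lt_action_left ht hx h
    rw [hs, ← hsx, ← action_self (t := t)] at this
    exact this.not_ge (hy x)
  · exact (lt_action_of_stepData_eq ht hne
      ((stepData_of_lt hab (h.trans_le hx₁)).trans hsx.symm)).not_ge (hy x)

lemma eq_self_of_mem_Ioo {x₀ x₁ : ℝ} (ht : 0 < t) (hx₀ : a ≤ x₀) (hx₁ : x₁ ≤ b)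
    (hs₀ : stepData a b ua ub x₀ = ua) (hs₁ : stepData a b ua ub x₁ = ua)
    (h₀ : IsMinimizer a b ua ub x₀ t x₀) (h₁ : IsMinimizer a b ua ub x₁ t x₁)
    (hx : x ∈ Ioo x₀ x₁) (hy : IsMinimizer a b ua ub x t y) : y = x := by
  by_contra hne
  have hsx : stepData a b ua ub x = ua :=
    stepData_of_mem_Ioo (hx₀.trans_lt hx.1) (hx.2.trans_le hx₁)
  rcases le_or_gt x₁ y with h | h
  · have := h₁.lt_action_left ht hx.2 h
    have e := hy x
    rw [action_self, hsx] at e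
    rw [hs₁] at this
    linarith
  rcases le_or_gt y x₀ with h' | h'
  · have := h₀.lt_action_right ht hx.1 h'
    have e := hy x
    rw [action_self, hsx] at e
    rw [hs₀] at this
    linarith
  · exact (lt_action_of_stepData_eq ht hne
      ((stepData_of_mem_Ioo (hx₀.trans_lt h') (h.trans_le hx₁)).trans hsx.symm)).not_ge (hy x)

lemma eq_self_of_gt (hab : a < b) (ht : 0 < t) {x₀ : ℝ} (hx₀ : b ≤ x₀)
    (hs : stepData a b ua ub x₀ = ua + ub) (h₀ : IsMinimizer a b ua ub x₀ t x₀) (hx : x₀ < x)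
    (hy : IsMinimizer a b ua ub x t y) : y = x := by
  by_contra hne
  have hsx : stepData a b ua ub x = ua + ub := stepData_of_gt hab (hx₀.trans_lt hx)
  rcases le_or_gt y x₀ with h | h
  · have := h₀.lt_action_right ht hx h
    rw [hs, ← hsx, ← action_self (t := t)] at this
    exact this.not_ge (hy x)
  · exact (lt_action_of_stepData_eq ht hne
      ((stepData_of_gt hab (hx₀.trans_lt h)).trans hsx.symm)).not_ge (hy x)

end Geometry

/-! ### The limits of approximate solutions -/

section Limits

variable {a b c d ua ub ρc ρd : ℝ}

lemma tendsto_explicitU (hab : a < b) {x t y₀ : ℝ} (ht : 0 < t)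
    (hmin : ∀ y, IsMinimizer a b ua ub x t y → y = y₀) :
    Tendsto (fun ε => explicitU a b ua ub ε x t) (𝓝[>] 0) (𝓝 ((x - y₀) / t)) := by
  refine (tendsto_gibbs_mean hab ht hmin).congr' ?_
  filter_upwards [self_mem_nhdsWithin] with ε hε using (explicitU_eq_gibbs hab ht hε).symm

lemma tendsto_explicitNumLeft_div (hac : a < c) (hcb : c < b) {x t x₀ : ℝ} (ht : 0 < t)
    (h : IsFront a b ua ub c t x₀) (hx : x ≠ x₀) :
    Tendsto (fun ε => explicitNumLeft b c ua ub ε x t / explicitDenom a b ua ub ε x t) (𝓝[>] 0)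
      (𝓝 ((Ioi x₀).indicator 1 x)) := by
  have hab := hac.trans hcb
  have key : Tendsto (fun ε => (∫ y in Ioi c, gibbs a b ua ub x t ε y) /
      ∫ y, gibbs a b ua ub x t ε y) (𝓝[>] 0) (𝓝 ((Ioi x₀).indicator 1 x)) := by
    rcases lt_or_gt_of_ne hx with hlt | hgt
    · simpa [hlt.not_gt] using tendsto_gibbs_Ioi_zero hab ht
        fun y hy => h.gt_of_lt hab ht hac.ne' hcb.ne hlt hy
    · simpa [hgt] using tendsto_gibbs_Ioi_one hab ht
        fun y hy => h.lt_of_gt hab ht hac.ne' hcb.ne hgt hy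
  refine key.congr' ?_
  filter_upwards [self_mem_nhdsWithin] with ε hε using (explicitNumLeft_div hac hcb ht hε).symm

lemma tendsto_explicitNumRight_div (hab : a < b) (hbd : b < d) {x t x₀ : ℝ} (ht : 0 < t)
    (h : IsFront a b ua ub d t x₀) (hx : x ≠ x₀) :
    Tendsto (fun ε => explicitNumRight d ua ub ε x t / explicitDenom a b ua ub ε x t) (𝓝[>] 0)
      (𝓝 ((Ioi x₀).indicator 1 x)) := by
  have key : Tendsto (fun ε => (∫ y in Ioi d, gibbs a b ua ub x t ε y) /
      ∫ y, gibbs a b ua ub x t ε y) (𝓝[>] 0) (𝓝 ((Ioi x₀).indicator 1 x)) := by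
    rcases lt_or_gt_of_ne hx with hlt | hgt
    · simpa [hlt.not_gt] using tendsto_gibbs_Ioi_zero hab ht
        fun y hy => h.gt_of_lt hab ht (hab.trans hbd).ne' hbd.ne' hlt hy
    · simpa [hgt] using tendsto_gibbs_Ioi_one hab ht
        fun y hy => h.lt_of_gt hab ht (hab.trans hbd).ne' hbd.ne' hgt hy
  refine key.congr' ?_
  filter_upwards [self_mem_nhdsWithin] with ε hε using (explicitNumRight_div hab hbd ht hε).symm

lemma tendsto_explicitR_eps (hac : a < c) (hcb : c < b) (hbd : b < d) {x t x₀ x₁ : ℝ}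
    (ht : 0 < t) (h₀ : IsFront a b ua ub c t x₀) (h₁ : IsFront a b ua ub d t x₁)
    (hx₀ : x ≠ x₀) (hx₁ : x ≠ x₁) :
    Tendsto (fun ε => explicitR a b c d ua ub ρc ρd ε x t) (𝓝[>] 0)
      (𝓝 (ρc * (Ioi x₀).indicator 1 x + ρd * (Ioi x₁).indicator 1 x)) := by
  refine (((tendsto_explicitNumLeft_div hac hcb ht h₀ hx₀).const_mul ρc).add
    ((tendsto_explicitNumRight_div (hac.trans hcb) hbd ht h₁ hx₁).const_mul ρd)).congr fun ε => ?_
  rw [explicitR_eq, explicitNum_eq]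
  ring

/-! ### Integrability of the density -/

lemma gaussHeat_nonneg (p ε x t : ℝ) : 0 ≤ gaussHeat p ε x t := by
  unfold gaussHeat
  positivity

lemma gaussHeat_le {ε : ℝ} (hε : 0 < ε) (p x : ℝ) {t : ℝ} (ht : 0 < t) :
    gaussHeat p ε x t ≤ (√(2 * ε))⁻¹ * (√t)⁻¹ := by
  rw [gaussHeat, show 2 * t * ε = (2 * ε) * t by ring, sqrt_mul (by positivity), ← mul_inv,
    div_eq_mul_inv]
  refine mul_le_of_le_one_left (by positivity) (exp_le_one_iff.2 ?_)
  exact div_nonpos_of_nonpos_of_nonneg (neg_nonpos.2 (sq_nonneg _)) (by positivity)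

/-- Write ρ^ε = (S_x - R V_x)/V with V bounded below and R bounded. The heat kernels in S_x and V_x
blow up no faster than t^(-1/2), which is integrable at t = 0, so test functions need not vanish
there. -/
lemma exists_abs_explicitρ_le (hac : a < c) (hcb : c < b) (hbd : b < d) {ε : ℝ} (hε : 0 < ε) :
    ∃ C, 0 ≤ C ∧ ∀ x t, 0 < t → |explicitρ a b c d ua ub ρc ρd ε x t| ≤ C * (√t)⁻¹ := by
  have hab := hac.trans hcb
  obtain ⟨m, _, hm, hN⟩ := explicitDenom_bounds (ua := ua) (ub := ub) hab hε
  have hmul : ∀ k p x t : ℝ, 0 < t →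
      |k * gaussHeat p ε x t| ≤ |k| * (√(2 * ε))⁻¹ * (√t)⁻¹ := fun k p x t ht => by
    rw [abs_mul, abs_of_nonneg (gaussHeat_nonneg p ε x t), mul_assoc]
    exact mul_le_mul_of_nonneg_left (gaussHeat_le hε p x ht) (abs_nonneg _)
  set A := |ρc * exp (-ua / ε)| * (√(2 * ε))⁻¹
    + |ρc * (exp (-(ua + ub) / ε) - exp (-ua / ε))| * (√(2 * ε))⁻¹
    + |ρd * exp (-(ua + ub) / ε)| * (√(2 * ε))⁻¹ with hA
  set B := |exp (-ua / ε) - 1| * (√(2 * ε))⁻¹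
    + |exp (-(ua + ub) / ε) - exp (-ua / ε)| * (√(2 * ε))⁻¹ with hB
  have hS : ∀ x t, 0 < t → |explicitNumDx b c d ua ub ρc ρd ε x t| ≤ A * (√t)⁻¹ :=
    fun x t ht => by
    rw [hA, add_mul, add_mul]
    exact (abs_add_three _ _ _).trans (add_le_add (add_le_add (hmul _ _ _ _ ht) (hmul _ _ _ _ ht))
      (hmul _ _ _ _ ht))
  have hV : ∀ x t, 0 < t → |explicitDenomDx a b ua ub ε x t| ≤ B * (√t)⁻¹ := fun x t ht => by
    rw [hB, add_mul]
    exact (abs_add_le _ _).trans (add_le_add (hmul _ _ _ _ ht) (hmul _ _ _ _ ht))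
  refine ⟨(A + (|ρc| + |ρd|) * B) / m, by positivity, fun x t ht => ?_⟩
  have hpos := explicitDenom_pos (ua := ua) (ub := ub) hab hε (x := x) ht
  have e : explicitρ a b c d ua ub ρc ρd ε x t = (explicitNumDx b c d ua ub ρc ρd ε x t
      - explicitR a b c d ua ub ρc ρd ε x t * explicitDenomDx a b ua ub ε x t)
      / explicitDenom a b ua ub ε x t := by
    rw [explicitρ_eq hab hε ht, explicitR_eq]
    field_simp
  rw [e, abs_div, abs_of_pos hpos, div_mul_eq_mul_div]
  refine div_le_div₀ (by positivity) ?_ hm (hN x t ht).1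
  refine (abs_sub _ _).trans ?_
  rw [abs_mul, add_mul, mul_assoc (|ρc| + |ρd|)]
  exact add_le_add (hS x t ht) (mul_le_mul (abs_explicitR_le hac hcb hbd hε ht) (hV x t ht)
    (abs_nonneg _) (by positivity))

lemma integrableOn_inv_sqrt (T : ℝ) : IntegrableOn (fun t : ℝ => (√t)⁻¹) (Ioc 0 T) := by
  rcases le_or_gt T 0 with h | h
  · simp [Ioc_eq_empty_of_le h]
  have h1 := (intervalIntegral.intervalIntegrable_rpow' (a := 0) (b := T) (r := -(1 / 2))
    (by norm_num)).1
  refine h1.congr_fun (fun t ht => ?_) measurableSet_Ioc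
  simp only
  rw [rpow_neg ht.1.le, ← sqrt_eq_rpow]

lemma integrableOn_explicitρ_mul (hac : a < c) (hcb : c < b) (hbd : b < d) {ε : ℝ} (hε : 0 < ε)
    {φ : ℝ × ℝ → ℝ} (hφ : Continuous φ) (hs : HasCompactSupport φ) :
    IntegrableOn (fun p : ℝ × ℝ => explicitρ a b c d ua ub ρc ρd ε p.1 p.2 * φ p) upperHalf := by
  obtain ⟨C, hC, hρ⟩ := exists_abs_explicitρ_le (ua := ua) (ub := ub) (ρc := ρc) (ρd := ρd)
    hac hcb hbd hε
  obtain ⟨L, hL⟩ := hs.isCompact.isBounded.subset_closedBall 0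
  obtain ⟨K, hK⟩ := hφ.bounded_above_of_compact_support hs
  -- The box [-L, L] × (0, L] contains the part of the support of φ with t > 0, and the majorant is
  -- a product, hence integrable factor by factor.
  have hdom : Integrable (fun p : ℝ × ℝ => (Icc (-L) L).indicator (fun _ => C * K) p.1 *
      (Ioc 0 L).indicator (fun t => (√t)⁻¹) p.2) :=
    ((integrableOn_const (by simp)).integrable_indicator measurableSet_Icc).mul_prod
      ((integrableOn_inv_sqrt L).integrable_indicator measurableSet_Ioc)
  refine Integrable.mono' hdom.integrableOn (ContinuousOn.aestronglyMeasurable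
    ((contDiffOn_explicitρ (hac.trans hcb) hε).continuousOn.mul hφ.continuousOn)
    isOpen_upperHalf.measurableSet)
    ((ae_restrict_iff' isOpen_upperHalf.measurableSet).2 (Eventually.of_forall fun p hp => ?_))
  have hp : 0 < p.2 := hp
  by_cases hpφ : φ p = 0
  · rw [hpφ, mul_zero, norm_zero]
    have hK0 : 0 ≤ K := (norm_nonneg _).trans (hK 0)
    refine mul_nonneg (indicator_nonneg (fun _ _ => by positivity) _)
      (indicator_nonneg (fun _ _ => by positivity) _)
  · have hpL := hL (subset_tsupport φ hpφ)
    rw [mem_closedBall_zero_iff, Prod.norm_def, max_le_iff, norm_eq_abs, norm_eq_abs] at hpL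
    have h₁ : p.1 ∈ Icc (-L) L := abs_le.1 hpL.1
    have h₂ : p.2 ∈ Ioc 0 L := ⟨hp, (abs_le.1 hpL.2).2⟩
    rw [indicator_of_mem h₁, indicator_of_mem h₂, norm_mul, norm_eq_abs]
    calc _ ≤ C * (√p.2)⁻¹ * K :=
          mul_le_mul (hρ p.1 p.2 hp) (hK p) (norm_nonneg _) (by positivity)
      _ = _ := by ring

/-- If `γ_c` and `γ_d` separate the minimizers left and right of `c` and `d`, then the densities of
approximate solutions concentrate on these curves. -/
theorem densityLimit_of_isFront (hac : a < c) (hcb : c < b) (hbd : b < d) {u ρ : ℝ → ℝ → ℝ → ℝ}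
    (h : ∀ ε : ℝ, 0 < ε → IsApproximateSolution a b c d ua ub ρc ρd ε (u ε) (ρ ε))
    {γc γd : ℝ → ℝ} (hγc : ∀ t, 0 < t → IsFront a b ua ub c t (γc t))
    (hγd : ∀ t, 0 < t → IsFront a b ua ub d t (γd t)) : DensityLimit ρ ρc ρd γc γd := by
  intro φ hφ hs
  have hab := hac.trans hcb
  have heq : ∀ ε, 0 < ε → EqOn (fun p : ℝ × ℝ => explicitρ a b c d ua ub ρc ρd ε p.1 p.2 * φ p)
      (fun p : ℝ × ℝ => ρ ε p.1 p.2 * φ p) upperHalf := fun ε hε p hp => by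
    simp only [((h ε hε).eq_explicit hac hcb hbd hε (x := p.1) hp).2]
  have hint : ∀ ε, 0 < ε → IntegrableOn
      (fun p : ℝ × ℝ => explicitρ a b c d ua ub ρc ρd ε p.1 p.2 * φ p) upperHalf :=
    fun ε hε => integrableOn_explicitρ_mul hac hcb hbd hε hφ.continuous hs
  refine ⟨fun ε hε => (hint ε hε).congr_fun (heq ε hε) isOpen_upperHalf.measurableSet, ?_⟩
  have hrestr : (volume : Measure (ℝ × ℝ)).restrict upperHalf =
      (volume : Measure ℝ).prod (volume.restrict (Ioi 0)) := by
    rw [upperHalf_eq_prod, Measure.volume_eq_prod, ← Measure.prod_restrict, Measure.restrict_univ]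
  have hint' : ∀ ε, 0 < ε → Integrable
      (fun p : ℝ × ℝ => explicitρ a b c d ua ub ρc ρd ε p.1 p.2 * φ p)
      ((volume : Measure ℝ).prod (volume.restrict (Ioi 0))) := fun ε hε => by
    rw [← hrestr]
    exact hint ε hε
  have hslice : ∀ t, ContDiff ℝ 1 fun x => φ (x, t) := fun t =>
    (hφ.of_le (by exact_mod_cast le_top)).comp (by fun_prop)
  have hsliceD : ∀ t x, deriv (fun x => φ (x, t)) x = fderiv ℝ φ (x, t) (1, 0) := fun t x =>
    (((hφ.differentiable (by simp)) (x, t)).hasFDerivAt.comp_hasDerivAt x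
      ((hasDerivAt_id x).prodMk (hasDerivAt_const x t))).deriv
  have hsliceS : ∀ t, HasCompactSupport fun x => φ (x, t) := fun t =>
    hs.comp_isClosedEmbedding (Topology.IsClosedEmbedding.of_continuous_injective_isClosedMap
      (by fun_prop) (fun _ _ h => congrArg Prod.fst h) (isClosedMap_prodMk_right t))
  -- This function dominates the inner integrals for every ε; its integrability follows from the
  -- compact support of ∂φ/∂x.
  have hbdd : Integrable (fun t => (|ρc| + |ρd|) * ∫ x, |deriv (fun x => φ (x, t)) x|)
      (volume.restrict (Ioi 0)) := by
    simp_rw [hsliceD]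
    have hc : Continuous fun p : ℝ × ℝ => fderiv ℝ φ p (1, 0) :=
      (hφ.continuous_fderiv (by simp)).clm_apply continuous_const
    have := (hc.integrable_of_hasCompactSupport (μ := volume)
      (hs.fderiv_apply (𝕜 := ℝ) (1, 0))).integrableOn (s := upperHalf)
    rw [IntegrableOn, hrestr] at this
    exact this.integral_norm_prod_right.const_mul _
  have hF : ∀ ε, 0 < ε → ∀ t, 0 < t → ∀ x, HasDerivAt
      (fun y => explicitR a b c d ua ub ρc ρd ε y t) (explicitρ a b c d ua ub ρc ρd ε x t) x :=
    fun ε hε t ht x => (hasDerivAt_explicitR hab hε ht).differentiableAt.hasDerivAt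
  have hF' : ∀ ε, 0 < ε → ∀ t, 0 < t →
      Continuous fun x => explicitρ a b c d ua ub ρc ρd ε x t :=
    fun ε hε t ht => (contDiffOn_explicitρ hab hε).continuousOn.slice_upperHalf ht
  have hlim : Tendsto
      (fun ε => ∫ t in Ioi 0, ∫ x, explicitρ a b c d ua ub ρc ρd ε x t * φ (x, t)) (𝓝[>] 0)
      (𝓝 (∫ t in Ioi (0 : ℝ), (ρc * φ (γc t, t) + ρd * φ (γd t, t)))) := by
    refine tendsto_integral_filter_of_dominated_convergence _ ?_ ?_ hbdd ?_
    · filter_upwards [self_mem_nhdsWithin] with ε hε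
      exact (hint' ε hε).integral_prod_right.aestronglyMeasurable
    · filter_upwards [self_mem_nhdsWithin] with ε hε
      refine (ae_restrict_iff' measurableSet_Ioi).2 (Eventually.of_forall fun t ht => ?_)
      exact abs_integral_deriv_mul_le (hF ε hε t ht) (hF' ε hε t ht)
        (fun x => abs_explicitR_le hac hcb hbd hε ht) (hslice t) (hsliceS t)
    · refine (ae_restrict_iff' measurableSet_Ioi).2 (Eventually.of_forall fun t ht => ?_)
      refine tendsto_integral_deriv_mul (F := fun ε x => explicitR a b c d ua ub ρc ρd ε x t)
        (F' := fun ε x => explicitρ a b c d ua ub ρc ρd ε x t) (K := |ρc| + |ρd|) ?_ ?_ ?_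
        (fun x h1 h2 => tendsto_explicitR_eps hac hcb hbd ht (hγc t ht) (hγd t ht) h1 h2)
        (hslice t) (hsliceS t)
      all_goals filter_upwards [self_mem_nhdsWithin] with ε hε
      · exact hF ε hε t ht
      · exact hF' ε hε t ht
      · exact fun x => abs_explicitR_le hac hcb hbd hε ht
  refine hlim.congr' ?_
  filter_upwards [self_mem_nhdsWithin] with ε hε
  rw [← setIntegral_congr_fun isOpen_upperHalf.measurableSet (heq ε hε), hrestr,
    integral_prod_symm _ (hint' ε hε)]

/-- The velocities of approximate solutions converge wherever the minimizer is unique. -/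
theorem velocityLimit_of_unique (hac : a < c) (hcb : c < b) (hbd : b < d) {u ρ : ℝ → ℝ → ℝ → ℝ}
    (h : ∀ ε : ℝ, 0 < ε → IsApproximateSolution a b c d ua ub ρc ρd ε (u ε) (ρ ε))
    {Z A B : ℝ → Set ℝ}
    (hZ : ∀ t, 0 < t → ∀ x ∈ Z t, ∀ y, IsMinimizer a b ua ub x t y → y = x)
    (hA : ∀ t, 0 < t → ∀ x ∈ A t, ∀ y, IsMinimizer a b ua ub x t y → y = a)
    (hB : ∀ t, 0 < t → ∀ x ∈ B t, ∀ y, IsMinimizer a b ua ub x t y → y = b) :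
    VelocityLimit u a b Z A B := by
  have key : ∀ x t y₀, 0 < t → (∀ y, IsMinimizer a b ua ub x t y → y = y₀) →
      Tendsto (fun ε => u ε x t) (𝓝[>] 0) (𝓝 ((x - y₀) / t)) := fun x t y₀ ht hy => by
    refine (tendsto_explicitU (hac.trans hcb) ht hy).congr' ?_
    filter_upwards [self_mem_nhdsWithin] with ε hε
      using ((h ε hε).eq_explicit hac hcb hbd hε ht).1.symm
  intro t ht
  refine ⟨fun x hx => ?_, fun x hx => key x t a ht (hA t ht x hx),
    fun x hx => key x t b ht (hB t ht x hx)⟩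
  simpa using key x t x ht (hZ t ht x hx)

end Limits

/-! ### Criteria for minimizers -/

section Criteria

variable {a b ua ub x t y v : ℝ}

/-- The number v plays the role of 2t times the minimal action. At a jump the data equal one of the
two adjacent values, so bounding the three constant values on closed intervals covers all
competitors, including a and b themselves. -/
lemma isMinimizer_of_forall_le (hab : a < b) (ht : 0 < t)
    (h0 : 2 * t * stepData a b ua ub y + (x - y) ^ 2 ≤ v) (hL : ∀ z ≤ a, v ≤ (x - z) ^ 2)
    (hM : ∀ z, a ≤ z → z ≤ b → v ≤ 2 * t * ua + (x - z) ^ 2)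
    (hR : ∀ z, b ≤ z → v ≤ 2 * t * (ua + ub) + (x - z) ^ 2) : IsMinimizer a b ua ub x t y := by
  have key : ∀ z, v ≤ 2 * t * stepData a b ua ub z + (x - z) ^ 2 := fun z => by
    rcases lt_trichotomy z a with h | rfl | h
    · rw [stepData_of_lt hab h]
      simpa using hL z h.le
    · rw [stepData, jump_of_lt hab, add_zero]
      rcases jump_eq_or ua z z with e | e <;> rw [e]
      · simpa using hL z le_rfl
      · exact hM z le_rfl hab.le
    · rcases lt_trichotomy z b with h' | rfl | h'
      · rw [stepData_of_mem_Ioo h h']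
        exact hM z h.le h'.le
      · rw [stepData, jump_of_gt hab]
        rcases jump_eq_or ub z z with e | e <;> rw [e]
        · simpa using hM z hab.le le_rfl
        · exact hR z le_rfl
      · rw [stepData_of_gt hab h']
        exact hR z h'.le
  intro z
  have hact : ∀ z, action a b ua ub x t z = (2 * t * stepData a b ua ub z + (x - z) ^ 2) / (2 * t) :=
    fun z => by
    unfold action
    field_simp
  rw [hact, hact, div_le_div_iff_of_pos_right (by positivity)]
  exact h0.trans (key z)

/-! ### Values at the jumps, and comparison with the nearest competitors -/

lemma stepData_left (hab : a < b) (hua : 0 ≤ ua) : stepData a b ua ub a = 0 := by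
  rw [stepData, jump_self_of_nonneg hua, jump_of_lt hab, add_zero]

lemma stepData_left' (hab : a < b) (hua : ua < 0) : stepData a b ua ub a = ua := by
  rw [stepData, jump_self_of_neg hua, jump_of_lt hab, add_zero]

lemma stepData_right (hab : a < b) (hub : 0 ≤ ub) : stepData a b ua ub b = ua := by
  rw [stepData, jump_self_of_nonneg hub, jump_of_gt hab, add_zero]

lemma stepData_right' (hab : a < b) (hub : ub < 0) : stepData a b ua ub b = ua + ub := by
  rw [stepData, jump_self_of_neg hub, jump_of_gt hab]

/-- On each constancy interval the cheapest competitor is the point of its closure nearest to x.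
Each criterion below therefore needs only one comparison per interval. -/
lemma isMinimizer_self_left (hab : a < b) (ht : 0 < t) (hx : x ≤ a)
    (hs : stepData a b ua ub x = 0) (h1 : 0 ≤ 2 * t * ua + (a - x) ^ 2)
    (h2 : 0 ≤ 2 * t * (ua + ub) + (b - x) ^ 2) : IsMinimizer a b ua ub x t x := by
  refine isMinimizer_of_forall_le hab ht (v := 0) (by rw [hs]; simp) (fun z _ => sq_nonneg _)
    (fun z h h' => ?_) (fun z h => ?_) <;> nlinarith

lemma isMinimizer_self_mid (hab : a < b) (ht : 0 < t) (hx : a ≤ x) (hx' : x ≤ b)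
    (hs : stepData a b ua ub x = ua) (h1 : 2 * t * ua ≤ (x - a) ^ 2)
    (h2 : 0 ≤ 2 * t * ub + (b - x) ^ 2) : IsMinimizer a b ua ub x t x := by
  refine isMinimizer_of_forall_le hab ht (v := 2 * t * ua) (by rw [hs]; simp) (fun z h => ?_)
    (fun z h h' => ?_) (fun z h => ?_) <;> nlinarith

lemma isMinimizer_self_right (hab : a < b) (ht : 0 < t) (hx : b ≤ x)
    (hs : stepData a b ua ub x = ua + ub) (h1 : 2 * t * (ua + ub) ≤ (x - a) ^ 2)
    (h2 : 2 * t * ub ≤ (x - b) ^ 2) : IsMinimizer a b ua ub x t x := by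
  refine isMinimizer_of_forall_le hab ht (v := 2 * t * (ua + ub)) (by rw [hs]; simp)
    (fun z h => ?_) (fun z h h' => ?_) (fun z h => ?_) <;> nlinarith

/-- The alternatives reflect where x lies: the nearest point of an interval is x itself if x belongs
to it, and an endpoint otherwise. -/
lemma isMinimizer_left_of_nonneg (hab : a < b) (ht : 0 < t) (hua : 0 ≤ ua) (hx : a ≤ x)
    (h1 : (x ≤ b ∧ (x - a) ^ 2 ≤ 2 * t * ua) ∨ (b ≤ x ∧ (x - a) ^ 2 ≤ 2 * t * ua + (x - b) ^ 2))
    (h2 : (x ≤ b ∧ (x - a) ^ 2 ≤ 2 * t * (ua + ub) + (b - x) ^ 2) ∨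
      (x - a) ^ 2 ≤ 2 * t * (ua + ub)) : IsMinimizer a b ua ub x t a := by
  refine isMinimizer_of_forall_le hab ht (v := (x - a) ^ 2)
    (by rw [stepData_left hab hua]; simp) (fun z h => ?_) (fun z h h' => ?_) (fun z h => ?_)
  · nlinarith
  · rcases h1 with ⟨h3, h4⟩ | ⟨h3, h4⟩ <;> nlinarith
  · rcases h2 with ⟨h3, h4⟩ | h3 <;> nlinarith

lemma isMinimizer_left_of_neg (hab : a < b) (ht : 0 < t) (hua : ua < 0) (hx : x ≤ a)
    (h1 : 2 * t * ua + (a - x) ^ 2 ≤ 0) (h2 : (a - x) ^ 2 ≤ 2 * t * ub + (b - x) ^ 2) :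
    IsMinimizer a b ua ub x t a := by
  refine isMinimizer_of_forall_le hab ht (v := 2 * t * ua + (a - x) ^ 2)
    (by rw [stepData_left' hab hua]; nlinarith) (fun z h => ?_) (fun z h h' => ?_)
    (fun z h => ?_) <;> nlinarith

lemma isMinimizer_right_of_nonneg (hab : a < b) (ht : 0 < t) (hub : 0 ≤ ub) (hx : b ≤ x)
    (h1 : 2 * t * ua + (x - b) ^ 2 ≤ (x - a) ^ 2) (h2 : (x - b) ^ 2 ≤ 2 * t * ub) :
    IsMinimizer a b ua ub x t b := by
  refine isMinimizer_of_forall_le hab ht (v := 2 * t * ua + (x - b) ^ 2)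
    (by rw [stepData_right hab hub]) (fun z h => ?_) (fun z h h' => ?_)
    (fun z h => ?_) <;> nlinarith

lemma isMinimizer_right_of_neg (hab : a < b) (ht : 0 < t) (hub : ub < 0) (hx : x ≤ b)
    (h1 : (a ≤ x ∧ 2 * t * ub + (b - x) ^ 2 ≤ 0) ∨
      (x ≤ a ∧ 2 * t * ub + (b - x) ^ 2 ≤ (a - x) ^ 2))
    (h2 : (a ≤ x ∧ 2 * t * (ua + ub) + (b - x) ^ 2 ≤ (x - a) ^ 2) ∨
      2 * t * (ua + ub) + (b - x) ^ 2 ≤ 0) : IsMinimizer a b ua ub x t b := by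
  refine isMinimizer_of_forall_le hab ht (v := 2 * t * (ua + ub) + (b - x) ^ 2)
    (by rw [stepData_right' hab hub]; nlinarith) (fun z h => ?_) (fun z h h' => ?_)
    (fun z h => ?_)
  · rcases h2 with ⟨h3, h4⟩ | h3 <;> nlinarith
  · rcases h1 with ⟨h3, h4⟩ | ⟨h3, h4⟩ <;> nlinarith
  · nlinarith

/-! ### Comparison of times -/

/-- A threshold on t becomes a comparison of the distance √(2wt) with D, so that all case
distinctions on time turn into inequalities between lengths. -/
lemma le_sq_div_iff {w D : ℝ} (hw : 0 < w) (hD : 0 ≤ D) :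
    t ≤ D ^ 2 / (2 * w) ↔ √(2 * w * t) ≤ D := by
  rw [le_div_iff₀ (by positivity), sqrt_le_left hD, mul_comm]

lemma le_sq_div_sq_iff {q D : ℝ} (hq : 0 < q) (hD : 0 ≤ D) :
    t ≤ D ^ 2 / (2 * q ^ 2) ↔ q * √(2 * t) ≤ D := by
  rw [le_sq_div_iff (by positivity) hD, show 2 * q ^ 2 * t = q ^ 2 * (2 * t) by ring,
    sqrt_mul (by positivity), sqrt_sq hq.le]

lemma sqrt_two_mul_mul {w : ℝ} (hw : 0 ≤ w) : √(2 * w * t) = √w * √(2 * t) := by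
  rw [← sqrt_mul hw]
  congr 1
  ring

lemma isFront_self {p : ℝ} (h : IsMinimizer a b ua ub p t p) : IsFront a b ua ub p t p :=
  ⟨p, p, le_rfl, le_rfl, h, h⟩

end Criteria

/-! ### The first case -/

section CaseOne

variable {a b c d ua ub t : ℝ}

/-- The two fans move apart and never interact. At each outer front the fan's centre and the front
point itself are tied minimizers; these ties and the self-minimizing a and b determine all regions.
-/
lemma case1_facts (hab : a < b) (hua : ua < 0) (hub : 0 < ub) (ht : 0 < t) :
    IsMinimizer a b ua ub a t a ∧ IsMinimizer a b ua ub b t b ∧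
    IsMinimizer a b ua ub (Case1.γa a ua t) t (Case1.γa a ua t) ∧
    IsMinimizer a b ua ub (Case1.γa a ua t) t a ∧
    IsMinimizer a b ua ub (b + √(2 * ub * t)) t (b + √(2 * ub * t)) ∧
    IsMinimizer a b ua ub (b + √(2 * ub * t)) t b := by
  have hA : 0 < -2 * ua * t := mul_pos (by linarith) ht
  have hB : 0 < 2 * ub * t := by positivity
  unfold Case1.γa
  have h1 := sqrt_pos.2 hA
  have h2 := sq_sqrt hA.le
  have h3 := sqrt_pos.2 hB
  have h4 := sq_sqrt hB.le
  generalize √(-2 * ua * t) = p at *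
  generalize √(2 * ub * t) = q at *
  refine ⟨isMinimizer_self_mid hab ht le_rfl hab.le (stepData_left' hab hua) ?_ ?_,
    isMinimizer_self_mid hab ht hab.le le_rfl (stepData_right hab hub.le) ?_ ?_,
    isMinimizer_self_left hab ht (by linarith) (stepData_of_lt hab (by linarith)) ?_ ?_,
    isMinimizer_left_of_neg hab ht hua (by linarith) ?_ ?_,
    isMinimizer_self_right hab ht (by linarith) (stepData_of_gt hab (by linarith)) ?_ ?_,
    isMinimizer_right_of_nonneg hab ht hub.le (by linarith) ?_ ?_⟩ <;> nlinarith

lemma case1_front_c (hac : a < c) (hcb : c < b) (hua : ua < 0) (hub : 0 < ub) (ht : 0 < t) :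
    IsFront a b ua ub c t (Case1.γc c t) := by
  have hA : 0 < -2 * ua * t := mul_pos (by linarith) ht
  have hB : 0 < 2 * ub * t := by positivity
  refine isFront_self (isMinimizer_self_mid (hac.trans hcb) ht hac.le hcb.le
    (stepData_of_mem_Ioo hac hcb) ?_ ?_) <;> nlinarith

lemma case1_front_d (hab : a < b) (hbd : b < d) (hua : ua < 0) (hub : 0 < ub) (ht : 0 < t) :
    IsFront a b ua ub d t (Case1.γd b d ub t) := by
  have hA : 0 < -2 * ua * t := mul_pos (by linarith) ht
  have hB : 0 < 2 * ub * t := by positivity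
  unfold Case1.γd
  simp only [le_sq_div_iff hub (sub_nonneg.2 hbd.le)]
  split_ifs with h
  · have h1 := sq_sqrt hB.le
    have h2 := sqrt_nonneg (2 * ub * t)
    refine isFront_self (isMinimizer_self_right hab ht hbd.le (stepData_of_gt hab hbd) ?_ ?_)
      <;> nlinarith
  · obtain ⟨-, -, -, -, h5, h6⟩ := case1_facts hab hua hub ht
    exact ⟨_, _, hbd.le, by linarith, h6, h5⟩

lemma case1_velocity_Z (hab : a < b) (hua : ua < 0) (hub : 0 < ub) (ht : 0 < t) {x y : ℝ}
    (hx : x ∈ Iio (Case1.γa a ua t) ∪ Ioo a b ∪ Ioi (Case1.γb b ub t))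
    (hy : IsMinimizer a b ua ub x t y) : y = x := by
  have hA : 0 < -2 * ua * t := mul_pos (by linarith) ht
  have hB : 0 < 2 * ub * t := by positivity
  have hp := sqrt_pos.2 hA
  have hq := sqrt_pos.2 hB
  obtain ⟨h1, h2, h3, h4, h5, h6⟩ := case1_facts hab hua hub ht
  have hlt : Case1.γa a ua t < a := by unfold Case1.γa; linarith
  rcases hx with (hx | hx) | hx
  · exact eq_self_of_lt hab ht hlt.le (stepData_of_lt hab hlt) h3 hx hy
  · exact eq_self_of_mem_Ioo ht le_rfl le_rfl (stepData_left' hab hua) (stepData_right hab hub.le)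
      h1 h2 hx hy
  · exact eq_self_of_gt hab ht (by linarith) (stepData_of_gt hab (by linarith)) h5 hx hy

lemma case1_velocity_A (hab : a < b) (hua : ua < 0) (hub : 0 < ub) (ht : 0 < t) {x y : ℝ}
    (hx : x ∈ Ioo (Case1.γa a ua t) a) (hy : IsMinimizer a b ua ub x t y) : y = a := by
  obtain ⟨h1, h2, h3, h4, h5, h6⟩ := case1_facts hab hua hub ht
  exact eq_of_isMinimizer_of_mem_Ioo ht h4 h1 hx hy

lemma case1_velocity_B (hab : a < b) (hua : ua < 0) (hub : 0 < ub) (ht : 0 < t) {x y : ℝ}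
    (hx : x ∈ Ioo b (Case1.γb b ub t)) (hy : IsMinimizer a b ua ub x t y) : y = b := by
  obtain ⟨h1, h2, h3, h4, h5, h6⟩ := case1_facts hab hua hub ht
  exact eq_of_isMinimizer_of_mem_Ioo ht h2 h6 hx hy

end CaseOne

/-! ### The second case -/

section CaseTwo

variable {a b c d ua ub t p q r m : ℝ}

/-- All three distances are multiples of √(2t). Multiplying by this factor rewrites the time t* as r
- q = b - a, when the front a + r catches b + q, and comparison with x* as comparison of (d - b)(r -
q) with (b - a)q. -/
lemma case2_roots (hab : a < b) (hua : 0 < ua) (hub : 0 < ub) (ht : 0 < t) :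
    ∃ p q r, 0 < p ∧ 0 < q ∧ 0 < r ∧ p ^ 2 = 2 * t * ua ∧ q ^ 2 = 2 * t * ub ∧
      r ^ 2 = 2 * t * (ua + ub) ∧ √(2 * ua * t) = p ∧ √(2 * ub * t) = q ∧
      √(2 * (ua + ub) * t) = r ∧ (∀ D, 0 ≤ D → (t ≤ D ^ 2 / (2 * ua) ↔ p ≤ D)) ∧
      (∀ D, 0 ≤ D → (t ≤ D ^ 2 / (2 * ub) ↔ q ≤ D)) ∧
      (∀ D, 0 ≤ D → (t ≤ D ^ 2 / (2 * (ua + ub)) ↔ r ≤ D)) ∧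
      (t ≤ Case2.tStar a b ua ub ↔ r - q ≤ b - a) ∧
      ((d < Case2.xStar a b ua ub ↔ (d - b) * (r - q) < (b - a) * q) ∧
        (d = Case2.xStar a b ua ub ↔ (d - b) * (r - q) = (b - a) * q)) := by
  have huab := add_pos hua hub
  have hτ : 0 < √(2 * t) := by positivity
  have hβκ : 0 < √(ua + ub) - √ub := sub_pos.2 (sqrt_lt_sqrt hub.le (by linarith))
  have hrq : √(2 * (ua + ub) * t) - √(2 * ub * t) = (√(ua + ub) - √ub) * √(2 * t) := by
    rw [sqrt_two_mul_mul huab.le, sqrt_two_mul_mul hub.le]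
    ring
  refine ⟨_, _, _, sqrt_pos.2 (by positivity), sqrt_pos.2 (by positivity),
    sqrt_pos.2 (by positivity), ?_, ?_, ?_, rfl, rfl, rfl, fun D hD => le_sq_div_iff hua hD,
    fun D hD => le_sq_div_iff hub hD, fun D hD => le_sq_div_iff huab hD, ?_, ?_, ?_⟩
  · rw [sq_sqrt (by positivity)]; ring
  · rw [sq_sqrt (by positivity)]; ring
  · rw [sq_sqrt (by positivity)]; ring
  · rw [Case2.tStar, le_sq_div_sq_iff hβκ (by linarith), hrq]
  · rw [hrq, sqrt_two_mul_mul hub.le, ← mul_assoc, ← mul_assoc, mul_lt_mul_iff_left₀ hτ,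
      ← lt_div_iff₀ hβκ, Case2.xStar, sub_lt_iff_lt_add']
  · rw [hrq, sqrt_two_mul_mul hub.le, ← mul_assoc, ← mul_assoc, mul_left_inj' hτ.ne',
      ← eq_div_iff hβκ.ne', Case2.xStar, sub_eq_iff_eq_add']

lemma case2_min_a (hab : a < b) (hua : 0 < ua) (hub : 0 < ub) (ht : 0 < t) :
    IsMinimizer a b ua ub a t a :=
  isMinimizer_self_left hab ht le_rfl (stepData_left hab hua.le) (by positivity)
    (by positivity)

lemma case2_min_b (hab : a < b) (hub : 0 < ub) (ht : 0 < t)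
    (hp : 0 < p) (hp2 : p ^ 2 = 2 * t * ua) (h : p ≤ b - a) : IsMinimizer a b ua ub b t b :=
  isMinimizer_self_mid hab ht hab.le le_rfl (stepData_right hab hub.le) (by nlinarith)
    (by nlinarith [mul_pos ht hub])

lemma case2_first (hab : a < b) (hua : 0 < ua) (hub : 0 < ub) (ht : 0 < t) (hp : 0 < p)
    (hp2 : p ^ 2 = 2 * t * ua) (h : p ≤ b - a) : stepData a b ua ub (a + p) = ua ∧
    IsMinimizer a b ua ub (a + p) t a ∧ IsMinimizer a b ua ub (a + p) t (a + p) := by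
  have hB := mul_pos ht hub
  -- In the borderline case the front has just reached b, where the data still equal `ua` because
  -- the jump there is upward.
  have hs : stepData a b ua ub (a + p) = ua := by
    rcases h.lt_or_eq with h | h
    · exact stepData_of_mem_Ioo (by linarith) (by linarith)
    · rw [show a + p = b by linarith, stepData_right hab hub.le]
  refine ⟨hs, isMinimizer_left_of_nonneg hab ht hua.le (by linarith) (Or.inl ⟨by linarith, ?_⟩)
    (Or.inl ⟨by linarith, ?_⟩), isMinimizer_self_mid hab ht (by linarith) (by linarith) hs ?_ ?_⟩
    <;> nlinarith

/-- At b + q the point itself and b both cost r² (in units of 1/(2t)), and the condition r - q ≤ b -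
a says precisely that a is not cheaper. -/
lemma case2_second (hab : a < b) (hub : 0 < ub) (ht : 0 < t) (hq : 0 < q) (hr : 0 < r)
    (hq2 : q ^ 2 = 2 * t * ub) (hr2 : r ^ 2 = 2 * t * (ua + ub)) (h : r - q ≤ b - a) :
    IsMinimizer a b ua ub (b + q) t b ∧ IsMinimizer a b ua ub (b + q) t (b + q) := by
  refine ⟨isMinimizer_right_of_nonneg hab ht hub.le (by linarith) ?_ ?_,
    isMinimizer_self_right hab ht (by linarith) (stepData_of_gt hab (by linarith)) ?_ ?_⟩
    <;> nlinarith

/-- Equal cost of a and b means (m - a)² = p² + (m - b)². The squares of m cancel, which is why this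
shock moves along a straight line. -/
lemma case2_shock (hab : a < b) (hua : 0 < ua) (hub : 0 < ub) (ht : 0 < t) (hp : 0 < p)
    (hq : 0 < q) (hr : 0 < r) (hp2 : p ^ 2 = 2 * t * ua)
    (hq2 : q ^ 2 = 2 * t * ub) (hr2 : r ^ 2 = 2 * t * (ua + ub)) (h : b - a ≤ p)
    (h' : r - q ≤ b - a) (hm : m = (a + b) / 2 + ua / (b - a) * t) :
    b ≤ m ∧ IsMinimizer a b ua ub m t a ∧ IsMinimizer a b ua ub m t b := by
  have hD : 0 < b - a := sub_pos.2 hab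
  have e : 2 * (b - a) * (m - b) = p ^ 2 - (b - a) ^ 2 := by
    rw [hm, hp2]
    field_simp
    ring
  have hbm : b ≤ m := by nlinarith
  -- From r² = p² + q² and r ≤ q + (b - a) one gets p² ≤ 2q(b - a) + (b - a)², which the identity
  -- `e` translates into the claim.
  have h3 : m - b ≤ q := by
    by_contra! h4
    nlinarith
  have h5 : (m - b) ^ 2 ≤ q ^ 2 := pow_le_pow_left₀ (by linarith) h3 2
  refine ⟨hbm, isMinimizer_left_of_nonneg hab ht hua.le (by linarith) (Or.inr ⟨hbm, ?_⟩)
    (Or.inr ?_), isMinimizer_right_of_nonneg hab ht hub.le hbm ?_ ?_⟩ <;> nlinarith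

lemma case2_last (hab : a < b) (hua : 0 < ua) (ht : 0 < t)
    (hq : 0 < q)
    (hq2 : q ^ 2 = 2 * t * ub) (hr2 : r ^ 2 = 2 * t * (ua + ub)) (h : b - a ≤ r - q) :
    b < a + r ∧ IsMinimizer a b ua ub (a + r) t a ∧ IsMinimizer a b ua ub (a + r) t (a + r) := by
  have hbr : b < a + r := by linarith
  have h1 : q ^ 2 ≤ (r - (b - a)) ^ 2 := pow_le_pow_left₀ hq.le (by linarith) 2
  refine ⟨hbr, isMinimizer_left_of_nonneg hab ht hua.le (by linarith) (Or.inr ⟨hbr.le, ?_⟩)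
    (Or.inr ?_), isMinimizer_self_right hab ht hbr.le (stepData_of_gt hab hbr) ?_ ?_⟩
    <;> nlinarith

lemma case2_front_c (hac : a < c) (hcb : c < b) (hua : 0 < ua) (hub : 0 < ub) (ht : 0 < t) :
    IsFront a b ua ub c t (Case2.γc a b c ua ub t) := by
  have hab := hac.trans hcb
  obtain ⟨p, q, r, hp, hq, hr, hp2, hq2, hr2, ep, eq, er, ip, iq, ir, is, -⟩ :=
    case2_roots (d := c) hab hua hub ht
  simp only [Case2.γc, ep, er, ip _ (sub_nonneg.2 hac.le), ip _ (sub_nonneg.2 hab.le), is]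
  split_ifs with h1 h2 h3
  · refine isFront_self (isMinimizer_self_mid hab ht hac.le hcb.le
      (stepData_of_mem_Ioo hac hcb) ?_ ?_) <;> nlinarith
  · obtain ⟨-, h4, h5⟩ := case2_first hab hua hub ht hp hp2 h2
    exact ⟨_, _, hac.le, by linarith, h4, h5⟩
  · obtain ⟨-, h4, h5⟩ := case2_shock hab hua hub ht hp hq hr hp2 hq2 hr2 (not_le.1 h2).le h3 rfl
    exact ⟨_, _, hac.le, hcb.le, h4, h5⟩
  · obtain ⟨h6, h4, h5⟩ := case2_last hab hua ht hq hq2 hr2 (not_le.1 h3).le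
    exact ⟨_, _, hac.le, by linarith, h4, h5⟩

/-- The position of d relative to x* decides whether the front b + q or the merged front a + r
reaches d first. -/
lemma case2_front_d (hab : a < b) (hbd : b < d) (hua : 0 < ua) (hub : 0 < ub) (ht : 0 < t) :
    IsFront a b ua ub d t (Case2.γd a b d ua ub t) := by
  have had := hab.trans hbd
  have hD := sub_pos.2 hab
  have hd := sub_pos.2 hbd
  obtain ⟨p, q, r, hp, hq, hr, hp2, hq2, hr2, ep, eq, er, ip, iq, ir, is, ix, ix'⟩ :=
    case2_roots (d := d) hab hua hub ht
  simp only [Case2.γd, eq, er, iq _ hd.le, ir _ (sub_nonneg.2 had.le), is, ix, ix']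
  have self : q ≤ d - b → r ≤ d - a → IsFront a b ua ub d t d := fun h1 h2 => by
    refine isFront_self (isMinimizer_self_right hab ht hbd.le (stepData_of_gt hab hbd) ?_ ?_)
      <;> nlinarith
  have last : b - a < r - q → d - a ≤ r → IsFront a b ua ub d t (a + r) := fun h1 h2 => by
    obtain ⟨h6, h4, h5⟩ := case2_last hab hua ht hq hq2 hr2 h1.le
    exact ⟨_, _, had.le, by linarith, h4, h5⟩
  -- The missing inequalities come from multiplying comparisons of r - q with b - a and of q with d
  -- - b, and contradicting the product form of the comparison of d with x*.
  split_ifs with h1 h2 h3 h2 h3 h2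
  · refine self h2 ?_
    by_contra! h
    nlinarith
  · obtain ⟨h4, h5⟩ := case2_second hab hub ht hq hr hq2 hr2 h3
    exact ⟨_, _, hbd.le, by linarith, h4, h5⟩
  · exact last (not_le.1 h3) (by linarith)
  · have : q ≤ d - b := by
      by_contra! h
      nlinarith
    exact self this (by linarith)
  · refine last (not_le.1 h3) ?_
    by_contra! h
    nlinarith
  · refine self ?_ h2
    by_contra! h
    have : r - q < b - a := by linarith
    have h4 : (b - a) * q ≤ (d - b) * (r - q) := by
      rcases lt_or_eq_of_le (not_lt.1 h1) with h5 | h5 <;> linarith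
    nlinarith
  · refine last ?_ (by linarith)
    by_contra! h
    have h4 : (b - a) * q ≤ (d - b) * (r - q) := not_lt.1 h1
    have h5 : (b - a) * q ≠ (d - b) * (r - q) := fun h => by simp_all
    have h6 := lt_of_le_of_ne h4 h5
    nlinarith

lemma case2_velocity_Z (hab : a < b) (hua : 0 < ua) (hub : 0 < ub) (ht : 0 < t) {x y : ℝ}
    (hx : x ∈ Iio a ∪ Ioo (Case2.γa a b ua ub t) (Case2.γb₁ a b ua ub t)
      ∪ Ioi (Case2.γb₂ a b ua ub t))
    (hy : IsMinimizer a b ua ub x t y) : y = x := by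
  obtain ⟨p, q, r, hp, hq, hr, hp2, hq2, hr2, ep, eq, er, ip, iq, ir, is, -⟩ :=
    case2_roots (d := b) hab hua hub ht
  simp only [Case2.γa, Case2.γb₁, Case2.γb₂, ep, eq, er, ip _ (sub_nonneg.2 hab.le), is] at hx
  rcases hx with (hx | hx) | hx
  · exact eq_self_of_lt hab ht le_rfl (stepData_left hab hua.le) (case2_min_a hab hua hub ht) hx hy
  · split_ifs at hx with h1 h2
    · obtain ⟨h3, -, h5⟩ := case2_first hab hua hub ht hp hp2 h1
      exact eq_self_of_mem_Ioo ht (by linarith) le_rfl h3 (stepData_right hab hub.le) h5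
        (case2_min_b hab hub ht hp hp2 h1) hx hy
    · exact absurd hx (by simp)
    · exact absurd hx (by simp)
  · split_ifs at hx with h1
    · exact eq_self_of_gt hab ht (by linarith) (stepData_of_gt hab (by linarith))
        (case2_second hab hub ht hq hr hq2 hr2 h1).2 hx hy
    · obtain ⟨h3, -, h5⟩ := case2_last hab hua ht hq hq2 hr2 (not_le.1 h1).le
      exact eq_self_of_gt hab ht h3.le (stepData_of_gt hab h3) h5 hx hy

lemma case2_velocity_A (hab : a < b) (hua : 0 < ua) (hub : 0 < ub) (ht : 0 < t) {x y : ℝ}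
    (hx : x ∈ Ioo a (Case2.γa a b ua ub t)) (hy : IsMinimizer a b ua ub x t y) : y = a := by
  obtain ⟨p, q, r, hp, hq, hr, hp2, hq2, hr2, ep, eq, er, ip, iq, ir, is, -⟩ :=
    case2_roots (d := b) hab hua hub ht
  refine eq_of_isMinimizer_of_mem_Ioo ht (case2_min_a hab hua hub ht) ?_ hx hy
  simp only [Case2.γa, ep, er, ip _ (sub_nonneg.2 hab.le), is]
  split_ifs with h1 h2
  · exact (case2_first hab hua hub ht hp hp2 h1).2.1
  · exact (case2_shock hab hua hub ht hp hq hr hp2 hq2 hr2 (not_le.1 h1).le h2 rfl).2.1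
  · exact (case2_last hab hua ht hq hq2 hr2 (not_le.1 h2).le).2.1

lemma case2_velocity_B (hab : a < b) (hua : 0 < ua) (hub : 0 < ub) (ht : 0 < t) {x y : ℝ}
    (hx : x ∈ Ioo (Case2.γb₁ a b ua ub t) (Case2.γb₂ a b ua ub t))
    (hy : IsMinimizer a b ua ub x t y) : y = b := by
  obtain ⟨p, q, r, hp, hq, hr, hp2, hq2, hr2, ep, eq, er, ip, iq, ir, is, -⟩ :=
    case2_roots (d := b) hab hua hub ht
  simp only [Case2.γb₁, Case2.γb₂, eq, er, ip _ (sub_nonneg.2 hab.le), is] at hx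
  by_cases h2 : r - q ≤ b - a
  · have h3 := (case2_second hab hub ht hq hr hq2 hr2 h2).1
    split_ifs at hx with h1
    · exact eq_of_isMinimizer_of_mem_Ioo ht (case2_min_b hab hub ht hp hp2 h1) h3 hx hy
    · exact eq_of_isMinimizer_of_mem_Ioo ht (case2_shock hab hua hub ht hp hq hr hp2 hq2 hr2
        (not_le.1 h1).le h2 rfl).2.2 h3 hx hy
  · have h1 : ¬ p ≤ b - a := fun h => h2 (by nlinarith)
    simp [h1, h2] at hx

end CaseTwo

/-! ### The last case -/

section CaseSix

variable {a b c d ua ub t p q r m : ℝ}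

/-- The reflection x ↦ -x, u ↦ -u exchanges (a, b, u_a, u_b) with (-b, -a, -u_b, -u_a), so the
fronts mirror those of the second case with p and q interchanged. The mass at d now lies on the side
where nothing moves. -/
lemma case6_roots (hab : a < b) (hua : ua < 0) (hub : ub < 0) (ht : 0 < t) :
    ∃ p q r, 0 < p ∧ 0 < q ∧ 0 < r ∧ p ^ 2 = -(2 * t * ua) ∧ q ^ 2 = -(2 * t * ub) ∧
      r ^ 2 = -(2 * t * (ua + ub)) ∧ √(-2 * ua * t) = p ∧ √(-2 * ub * t) = q ∧
      √(-2 * (ua + ub) * t) = r ∧ (∀ D, 0 ≤ D → (t ≤ D ^ 2 / (-2 * ub) ↔ q ≤ D)) ∧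
      (t ≤ Case6.tStar a b ua ub ↔ r - p ≤ b - a) := by
  have hneg : ∀ w : ℝ, -2 * w = 2 * -w := fun w => by ring
  simp only [hneg]
  have ha : 0 < -ua := by linarith
  have hb : 0 < -ub := by linarith
  have huab : 0 < -(ua + ub) := by linarith
  have hακ : 0 < √(-(ua + ub)) - √(-ua) := sub_pos.2 (sqrt_lt_sqrt ha.le (by linarith))
  have hrp : √(2 * -(ua + ub) * t) - √(2 * -ua * t) = (√(-(ua + ub)) - √(-ua)) * √(2 * t) := by
    rw [sqrt_two_mul_mul huab.le, sqrt_two_mul_mul ha.le]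
    ring
  refine ⟨_, _, _, sqrt_pos.2 (by positivity), sqrt_pos.2 (by positivity),
    sqrt_pos.2 (by positivity), ?_, ?_, ?_, rfl, rfl, rfl, fun D hD => le_sq_div_iff hb hD, ?_⟩
  · rw [sq_sqrt (by positivity)]; ring
  · rw [sq_sqrt (by positivity)]; ring
  · rw [sq_sqrt (by positivity)]; ring
  · rw [Case6.tStar, le_sq_div_sq_iff hακ (by linarith), hrp]

lemma case6_min_b (hab : a < b) (hua : ua < 0) (hub : ub < 0) (ht : 0 < t) :
    IsMinimizer a b ua ub b t b := by
  have hA := mul_pos_of_neg_of_neg hua (neg_neg_of_pos ht)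
  have hB := mul_pos_of_neg_of_neg hub (neg_neg_of_pos ht)
  refine isMinimizer_self_right hab ht le_rfl (stepData_right' hab hub) ?_ ?_ <;> nlinarith

lemma case6_min_a (hab : a < b) (hua : ua < 0) (ht : 0 < t) (hq : 0 < q)
    (hq2 : q ^ 2 = -(2 * t * ub)) (h : q ≤ b - a) : IsMinimizer a b ua ub a t a := by
  have hA := mul_pos_of_neg_of_neg hua (neg_neg_of_pos ht)
  refine isMinimizer_self_mid hab ht le_rfl hab.le (stepData_left' hab hua) ?_ ?_ <;> nlinarith

lemma case6_first (hab : a < b) (hua : ua < 0) (hub : ub < 0) (ht : 0 < t) (hq : 0 < q)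
    (hq2 : q ^ 2 = -(2 * t * ub)) (h : q ≤ b - a) : stepData a b ua ub (b - q) = ua ∧
    IsMinimizer a b ua ub (b - q) t b ∧ IsMinimizer a b ua ub (b - q) t (b - q) := by
  have hA := mul_pos_of_neg_of_neg hua (neg_neg_of_pos ht)
  have hs : stepData a b ua ub (b - q) = ua := by
    rcases h.lt_or_eq with h | h
    · exact stepData_of_mem_Ioo (by linarith) (by linarith)
    · rw [show b - q = a by linarith, stepData_left' hab hua]
  refine ⟨hs, isMinimizer_right_of_neg hab ht hub (by linarith) (Or.inl ⟨by linarith, ?_⟩)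
    (Or.inl ⟨by linarith, ?_⟩), isMinimizer_self_mid hab ht (by linarith) (by linarith) hs ?_ ?_⟩
    <;> nlinarith

lemma case6_second (hab : a < b) (hua : ua < 0) (ht : 0 < t) (hp : 0 < p) (hr : 0 < r)
    (hp2 : p ^ 2 = -(2 * t * ua)) (hr2 : r ^ 2 = -(2 * t * (ua + ub))) (h : r - p ≤ b - a) :
    IsMinimizer a b ua ub (a - p) t a ∧ IsMinimizer a b ua ub (a - p) t (a - p) := by
  refine ⟨isMinimizer_left_of_neg hab ht hua (by linarith) ?_ ?_,
    isMinimizer_self_left hab ht (by linarith) (stepData_of_lt hab (by linarith)) ?_ ?_⟩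
    <;> nlinarith

lemma case6_shock (hab : a < b) (hua : ua < 0) (hub : ub < 0) (ht : 0 < t) (hp : 0 < p)
    (hq : 0 < q) (hr : 0 < r) (hp2 : p ^ 2 = -(2 * t * ua)) (hq2 : q ^ 2 = -(2 * t * ub))
    (hr2 : r ^ 2 = -(2 * t * (ua + ub))) (h : b - a ≤ q)
    (h' : r - p ≤ b - a) (hm : m = (a + b) / 2 + ub / (b - a) * t) :
    m ≤ a ∧ IsMinimizer a b ua ub m t a ∧ IsMinimizer a b ua ub m t b := by
  have hD : 0 < b - a := sub_pos.2 hab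
  have e : 2 * (b - a) * (a - m) = q ^ 2 - (b - a) ^ 2 := by
    rw [hm, hq2]
    field_simp
    ring
  have hbm : m ≤ a := by nlinarith
  have h3 : a - m ≤ p := by
    by_contra! h4
    nlinarith
  have h5 : (a - m) ^ 2 ≤ p ^ 2 := pow_le_pow_left₀ (by linarith) h3 2
  refine ⟨hbm, isMinimizer_left_of_neg hab ht hua hbm ?_ ?_,
    isMinimizer_right_of_neg hab ht hub (by linarith) (Or.inr ⟨hbm, ?_⟩) (Or.inr ?_)⟩
    <;> nlinarith

lemma case6_last (hab : a < b) (hub : ub < 0) (ht : 0 < t) (hp : 0 < p)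
    (hp2 : p ^ 2 = -(2 * t * ua)) (hr2 : r ^ 2 = -(2 * t * (ua + ub))) (h : b - a ≤ r - p) :
    b - r < a ∧ IsMinimizer a b ua ub (b - r) t b ∧ IsMinimizer a b ua ub (b - r) t (b - r) := by
  have har : b - r < a := by linarith
  have h1 : p ^ 2 ≤ (r - (b - a)) ^ 2 := pow_le_pow_left₀ hp.le (by linarith) 2
  refine ⟨har, isMinimizer_right_of_neg hab ht hub (by linarith) (Or.inr ⟨har.le, ?_⟩)
    (Or.inr ?_), isMinimizer_self_left hab ht har.le (stepData_of_lt hab har) ?_ ?_⟩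
    <;> nlinarith

lemma case6_front_c (hac : a < c) (hcb : c < b) (hua : ua < 0) (hub : ub < 0) (ht : 0 < t) :
    IsFront a b ua ub c t (Case6.γc a b c ua ub t) := by
  have hab := hac.trans hcb
  obtain ⟨p, q, r, hp, hq, hr, hp2, hq2, hr2, ep, eq, er, iq, is⟩ := case6_roots hab hua hub ht
  simp only [Case6.γc, eq, er, iq _ (sub_nonneg.2 hcb.le), iq _ (sub_nonneg.2 hab.le), is]
  split_ifs with h1 h2 h3
  · refine isFront_self (isMinimizer_self_mid hab ht hac.le hcb.le
      (stepData_of_mem_Ioo hac hcb) ?_ ?_) <;> nlinarith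
  · obtain ⟨-, h4, h5⟩ := case6_first hab hua hub ht hq hq2 h2
    exact ⟨_, _, by linarith, hcb.le, h5, h4⟩
  · obtain ⟨-, h4, h5⟩ := case6_shock hab hua hub ht hp hq hr hp2 hq2 hr2 (not_le.1 h2).le h3 rfl
    exact ⟨_, _, hac.le, hcb.le, h4, h5⟩
  · obtain ⟨h6, h4, h5⟩ := case6_last hab hub ht hp hp2 hr2 (not_le.1 h3).le
    exact ⟨_, _, by linarith, hcb.le, h5, h4⟩

/-- If all the mass of `u` to the left of `d` is negative, then `d` does not move. -/
lemma isFront_const_right (hab : a < b) (hbd : b < d) (hub : ub ≤ 0) (huab : ua + ub ≤ 0)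
    (ht : 0 < t) : IsFront a b ua ub d t d := by
  have hA : 2 * t * (ua + ub) ≤ 0 := mul_nonpos_of_nonneg_of_nonpos (by positivity) huab
  have hB : 2 * t * ub ≤ 0 := mul_nonpos_of_nonneg_of_nonpos (by positivity) hub
  exact isFront_self (isMinimizer_self_right hab ht hbd.le (stepData_of_gt hab hbd)
    (hA.trans (sq_nonneg _)) (hB.trans (sq_nonneg _)))

lemma case6_velocity_Z (hab : a < b) (hua : ua < 0) (hub : ub < 0) (ht : 0 < t) {x y : ℝ}
    (hx : x ∈ Iio (Case6.γa₁ a b ua ub t)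
      ∪ Ioo (Case6.γa₂ a b ua ub t) (Case6.γb a b ua ub t) ∪ Ioi b)
    (hy : IsMinimizer a b ua ub x t y) : y = x := by
  obtain ⟨p, q, r, hp, hq, hr, hp2, hq2, hr2, ep, eq, er, iq, is⟩ := case6_roots hab hua hub ht
  simp only [Case6.γa₁, Case6.γa₂, Case6.γb, ep, eq, er, iq _ (sub_nonneg.2 hab.le), is] at hx
  rcases hx with (hx | hx) | hx
  · split_ifs at hx with h1
    · exact eq_self_of_lt hab ht (by linarith) (stepData_of_lt hab (by linarith))
        (case6_second hab hua ht hp hr hp2 hr2 h1).2 hx hy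
    · obtain ⟨h3, -, h5⟩ := case6_last hab hub ht hp hp2 hr2 (not_le.1 h1).le
      exact eq_self_of_lt hab ht h3.le (stepData_of_lt hab h3) h5 hx hy
  · split_ifs at hx with h1 h2
    · obtain ⟨h3, -, h5⟩ := case6_first hab hua hub ht hq hq2 h1
      exact eq_self_of_mem_Ioo ht le_rfl (by linarith) (stepData_left' hab hua) h3
        (case6_min_a hab hua ht hq hq2 h1) h5 hx hy
    · exact absurd hx (by simp)
    · exact absurd hx (by simp)
  · exact eq_self_of_gt hab ht le_rfl (stepData_right' hab hub) (case6_min_b hab hua hub ht) hx hy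

lemma case6_velocity_A (hab : a < b) (hua : ua < 0) (hub : ub < 0) (ht : 0 < t) {x y : ℝ}
    (hx : x ∈ Ioo (Case6.γa₁ a b ua ub t) (Case6.γa₂ a b ua ub t))
    (hy : IsMinimizer a b ua ub x t y) : y = a := by
  obtain ⟨p, q, r, hp, hq, hr, hp2, hq2, hr2, ep, eq, er, iq, is⟩ := case6_roots hab hua hub ht
  simp only [Case6.γa₁, Case6.γa₂, ep, er, iq _ (sub_nonneg.2 hab.le), is] at hx
  by_cases h2 : r - p ≤ b - a
  · have h3 := (case6_second hab hua ht hp hr hp2 hr2 h2).1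
    simp only [h2, if_true] at hx
    split_ifs at hx with h1
    · exact eq_of_isMinimizer_of_mem_Ioo ht h3 (case6_min_a hab hua ht hq hq2 h1) hx hy
    · exact eq_of_isMinimizer_of_mem_Ioo ht h3 (case6_shock hab hua hub ht hp hq hr hp2 hq2 hr2
        (not_le.1 h1).le h2 rfl).2.1 hx hy
  · have h1 : ¬ q ≤ b - a := fun h => h2 (by nlinarith)
    simp [h1, h2] at hx

lemma case6_velocity_B (hab : a < b) (hua : ua < 0) (hub : ub < 0) (ht : 0 < t) {x y : ℝ}
    (hx : x ∈ Ioo (Case6.γb a b ua ub t) b) (hy : IsMinimizer a b ua ub x t y) : y = b := by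
  obtain ⟨p, q, r, hp, hq, hr, hp2, hq2, hr2, ep, eq, er, iq, is⟩ := case6_roots hab hua hub ht
  refine eq_of_isMinimizer_of_mem_Ioo ht ?_ (case6_min_b hab hua hub ht) hx hy
  simp only [Case6.γb, eq, er, iq _ (sub_nonneg.2 hab.le), is]
  split_ifs with h1 h2
  · exact (case6_first hab hua hub ht hq hq2 h1).2.1
  · exact (case6_shock hab hua hub ht hp hq hr hp2 hq2 hr2 (not_le.1 h1).le h2 rfl).2.2
  · exact (case6_last hab hub ht hp hp2 hr2 (not_le.1 h2).le).2.1

end CaseSix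

/-! ### The third, fourth and fifth cases -/

section CaseMixed

variable {a b c d ua ub t p q r m : ℝ}

/-- The fronts a + p and b - q approach each other and meet when p + q = b - a. Both distances are
proportional to √(2t), so the meeting point divides [a, b] in the ratio p : q at all times; this
gives the product form of the comparison with x*. -/
lemma mixed_roots (hab : a < b) (hua : 0 < ua) (hub : ub < 0) (ht : 0 < t) :
    ∃ p q, 0 < p ∧ 0 < q ∧ p ^ 2 = 2 * t * ua ∧ q ^ 2 = -(2 * t * ub) ∧
      √(2 * ua * t) = p ∧ √(-2 * ub * t) = q ∧
      (∀ D, 0 ≤ D → (t ≤ D ^ 2 / (2 * ua) ↔ p ≤ D)) ∧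
      (∀ D, 0 ≤ D → (t ≤ D ^ 2 / (-2 * ub) ↔ q ≤ D)) ∧
      (t ≤ (b - a) ^ 2 / (2 * (√ua + √(-ub)) ^ 2) ↔ p + q ≤ b - a) ∧
      (c < a + (b - a) * √ua / (√ua + √(-ub)) ↔ (c - a) * (p + q) < (b - a) * p) ∧
      (c = a + (b - a) * √ua / (√ua + √(-ub)) ↔ (c - a) * (p + q) = (b - a) * p) := by
  have hb : 0 < -ub := by linarith
  have hτ : 0 < √(2 * t) := by positivity
  have hαβ : 0 < √ua + √(-ub) := by positivity
  rw [show -2 * ub = 2 * -ub by ring]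
  have hpq : √(2 * ua * t) + √(2 * -ub * t) = (√ua + √(-ub)) * √(2 * t) := by
    rw [sqrt_two_mul_mul hua.le, sqrt_two_mul_mul hb.le]
    ring
  refine ⟨_, _, sqrt_pos.2 (by positivity), sqrt_pos.2 (by positivity),
    ?_, ?_, rfl, rfl, fun D hD => le_sq_div_iff hua hD,
    fun D hD => le_sq_div_iff hb hD, ?_, ?_, ?_⟩
  · rw [sq_sqrt (by positivity)]; ring
  · rw [sq_sqrt (by positivity)]; ring
  · rw [le_sq_div_sq_iff hαβ (by linarith), hpq]
  · rw [hpq, sqrt_two_mul_mul hua.le, ← mul_assoc, ← mul_assoc, mul_lt_mul_iff_left₀ hτ,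
      ← lt_div_iff₀ hαβ, sub_lt_iff_lt_add']
  · rw [hpq, sqrt_two_mul_mul hua.le, ← mul_assoc, ← mul_assoc, mul_left_inj' hτ.ne',
      ← eq_div_iff hαβ.ne', sub_eq_iff_eq_add']

/-! ### Approaching fronts and their merger when u_a > 0 > u_b -/

lemma mixed_self (hac : a < c) (hcb : c < b) (ht : 0 < t) (hp : 0 < p) (hq : 0 < q)
    (hp2 : p ^ 2 = 2 * t * ua) (hq2 : q ^ 2 = -(2 * t * ub)) (h1 : p ≤ c - a) (h2 : q ≤ b - c) :
    IsFront a b ua ub c t c := by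
  refine isFront_self (isMinimizer_self_mid (hac.trans hcb) ht hac.le hcb.le
    (stepData_of_mem_Ioo hac hcb) ?_ ?_) <;> nlinarith

lemma mixed_first_left (hab : a < b) (hua : 0 < ua) (ht : 0 < t) (hp : 0 < p) (hq : 0 < q)
    (hp2 : p ^ 2 = 2 * t * ua) (hq2 : q ^ 2 = -(2 * t * ub)) (h : p + q ≤ b - a) :
    stepData a b ua ub (a + p) = ua ∧
      IsMinimizer a b ua ub (a + p) t a ∧ IsMinimizer a b ua ub (a + p) t (a + p) := by
  have hs : stepData a b ua ub (a + p) = ua := stepData_of_mem_Ioo (by linarith) (by linarith)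
  refine ⟨hs, isMinimizer_left_of_nonneg hab ht hua.le (by linarith) (Or.inl ⟨by linarith, ?_⟩)
    (Or.inl ⟨by linarith, ?_⟩), isMinimizer_self_mid hab ht (by linarith) (by linarith) hs ?_ ?_⟩
    <;> nlinarith

lemma mixed_first_right (hab : a < b) (hub : ub < 0) (ht : 0 < t) (hp : 0 < p) (hq : 0 < q)
    (hp2 : p ^ 2 = 2 * t * ua) (hq2 : q ^ 2 = -(2 * t * ub)) (h : p + q ≤ b - a) :
    stepData a b ua ub (b - q) = ua ∧
      IsMinimizer a b ua ub (b - q) t b ∧ IsMinimizer a b ua ub (b - q) t (b - q) := by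
  have hs : stepData a b ua ub (b - q) = ua := stepData_of_mem_Ioo (by linarith) (by linarith)
  refine ⟨hs, isMinimizer_right_of_neg hab ht hub (by linarith) (Or.inl ⟨by linarith, ?_⟩)
    (Or.inl ⟨by linarith, ?_⟩), isMinimizer_self_mid hab ht (by linarith) (by linarith) hs ?_ ?_⟩
    <;> nlinarith

/-- After the collision a and b have equal cost at m, an affine equation for m. The bounds on p² -
q² and q² - p² say that m has not left [a, b]. -/
lemma mixed_shock (hab : a < b) (hua : 0 < ua) (hub : ub < 0) (ht : 0 < t) (hq : 0 < q)
    (hp2 : p ^ 2 = 2 * t * ua) (hq2 : q ^ 2 = -(2 * t * ub)) (h : b - a ≤ p + q)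
    (h1 : p ^ 2 - q ^ 2 ≤ (b - a) ^ 2) (h2 : q ^ 2 - p ^ 2 ≤ (b - a) ^ 2)
    (hm : m = (a + b) / 2 + (ua + ub) / (b - a) * t) :
    IsMinimizer a b ua ub m t a ∧ IsMinimizer a b ua ub m t b := by
  have hD : 0 < b - a := sub_pos.2 hab
  have e : 2 * (b - a) * (m - a) = (b - a) ^ 2 + (p ^ 2 - q ^ 2) := by
    rw [hm, hp2, hq2]
    field_simp
    ring
  have ham : a ≤ m := by nlinarith
  have hmb : m ≤ b := by nlinarith
  have h3 : m - a ≤ p := by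
    by_contra! h4
    -- This inequality amounts to 2(b - a)(m - a) ≤ 2(b - a)p by the identity `e`, contradicting m -
    -- a > p. One side of the square bound is the collision condition, the other uses p² - q² ≤ (b -
    -- a)².
    have h5 : (b - a - p) ^ 2 ≤ q ^ 2 := by
      refine sq_le_sq' ?_ (by linarith)
      by_contra! h6
      nlinarith
    nlinarith
  have h5 : (m - a) ^ 2 ≤ p ^ 2 := pow_le_pow_left₀ (by linarith) h3 2
  refine ⟨isMinimizer_left_of_nonneg hab ht hua.le ham (Or.inl ⟨hmb, ?_⟩)
    (Or.inl ⟨hmb, ?_⟩), isMinimizer_right_of_neg hab ht hub hmb (Or.inl ⟨ham, ?_⟩)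
    (Or.inl ⟨ham, ?_⟩)⟩ <;> nlinarith

/-- The front at `c` before the two shocks emanating from `a` and `b` meet. -/
lemma mixed_front_of_lt (hac : a < c) (hcb : c < b) (hua : 0 < ua) (ht : 0 < t)
    (hp : 0 < p) (hq : 0 < q) (hp2 : p ^ 2 = 2 * t * ua) (hq2 : q ^ 2 = -(2 * t * ub))
    (hc : (c - a) * (p + q) < (b - a) * p) :
    (p ≤ c - a → IsFront a b ua ub c t c) ∧
      (¬ p ≤ c - a → p + q ≤ b - a → IsFront a b ua ub c t (a + p)) := by
  refine ⟨fun h => mixed_self hac hcb ht hp hq hp2 hq2 h ?_, fun h h' => ?_⟩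
  · by_contra! h1
    nlinarith
  · obtain ⟨-, h4, h5⟩ := mixed_first_left (hac.trans hcb) hua ht hp hq hp2 hq2 h'
    exact ⟨_, _, hac.le, by linarith, h4, h5⟩

lemma mixed_front_of_eq (hac : a < c) (hcb : c < b) (ht : 0 < t)
    (hp : 0 < p) (hq : 0 < q) (hp2 : p ^ 2 = 2 * t * ua) (hq2 : q ^ 2 = -(2 * t * ub))
    (hc : (c - a) * (p + q) = (b - a) * p) (h : p + q ≤ b - a) : IsFront a b ua ub c t c := by
  refine mixed_self hac hcb ht hp hq hp2 hq2 ?_ ?_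
  · by_contra! h1
    nlinarith
  · by_contra! h1
    nlinarith

lemma mixed_front_of_gt (hac : a < c) (hcb : c < b) (hub : ub < 0) (ht : 0 < t)
    (hp : 0 < p) (hq : 0 < q) (hp2 : p ^ 2 = 2 * t * ua) (hq2 : q ^ 2 = -(2 * t * ub))
    (hc : (b - a) * p < (c - a) * (p + q)) :
    (q ≤ b - c → IsFront a b ua ub c t c) ∧
      (¬ q ≤ b - c → p + q ≤ b - a → IsFront a b ua ub c t (b - q)) := by
  refine ⟨fun h => mixed_self hac hcb ht hp hq hp2 hq2 ?_ h, fun h h' => ?_⟩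
  · by_contra! h1
    nlinarith
  · obtain ⟨-, h4, h5⟩ := mixed_first_right (hac.trans hcb) hub ht hp hq hp2 hq2 h'
    exact ⟨_, _, by linarith, hcb.le, h5, h4⟩

lemma mixed_front_shock (hac : a < c) (hcb : c < b) (hua : 0 < ua) (hub : ub < 0) (ht : 0 < t)
    (hq : 0 < q) (hp2 : p ^ 2 = 2 * t * ua) (hq2 : q ^ 2 = -(2 * t * ub))
    (h : ¬ p + q ≤ b - a) (h1 : p ^ 2 - q ^ 2 ≤ (b - a) ^ 2) (h2 : q ^ 2 - p ^ 2 ≤ (b - a) ^ 2) :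
    IsFront a b ua ub c t ((a + b) / 2 + (ua + ub) / (b - a) * t) := by
  obtain ⟨h4, h5⟩ := mixed_shock (hac.trans hcb) hua hub ht hq hp2 hq2 (not_le.1 h).le h1 h2 rfl
  exact ⟨_, _, hac.le, hcb.le, h4, h5⟩

/-! The third case: `u_a + u_b > 0`. -/

/-- Since r² = p² - q², the condition r ≤ b - a says that the merged shock has not yet passed b; the
other bound needed by `mixed_shock` is then automatic. -/
lemma case3_root (hab : a < b) (huab : 0 < ua + ub) (ht : 0 < t)
    (hp2 : p ^ 2 = 2 * t * ua) (hq2 : q ^ 2 = -(2 * t * ub)) :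
    ∃ r, 0 < r ∧ r ^ 2 = 2 * t * (ua + ub) ∧ r ^ 2 = p ^ 2 - q ^ 2 ∧ √(2 * (ua + ub) * t) = r ∧
      (∀ D, 0 ≤ D → (t ≤ D ^ 2 / (2 * (ua + ub)) ↔ r ≤ D)) ∧
      (r ≤ b - a → p ^ 2 - q ^ 2 ≤ (b - a) ^ 2 ∧ q ^ 2 - p ^ 2 ≤ (b - a) ^ 2) := by
  have hr : 0 < √(2 * (ua + ub) * t) := sqrt_pos.2 (by positivity)
  have hr2 : √(2 * (ua + ub) * t) ^ 2 = 2 * t * (ua + ub) := by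
    rw [sq_sqrt (by positivity)]; ring
  refine ⟨_, hr, hr2, by linarith, rfl, fun D hD => le_sq_div_iff huab hD, fun h => ?_⟩
  constructor <;> nlinarith

lemma case3_last (hab : a < b) (hua : 0 < ua) (hub : ub < 0) (ht : 0 < t)
    (hr2 : r ^ 2 = 2 * t * (ua + ub)) (h : b - a < r) :
    b < a + r ∧ IsMinimizer a b ua ub (a + r) t a ∧ IsMinimizer a b ua ub (a + r) t (a + r) := by
  have hB := mul_pos_of_neg_of_neg hub (neg_neg_of_pos ht)
  have hbr : b < a + r := by linarith
  refine ⟨hbr, isMinimizer_left_of_nonneg hab ht hua.le (by linarith) (Or.inr ⟨hbr.le, ?_⟩)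
    (Or.inr ?_), isMinimizer_self_right hab ht hbr.le (stepData_of_gt hab hbr) ?_ ?_⟩
    <;> nlinarith

lemma case3_min_a (hab : a < b) (hua : 0 < ua) (huab : 0 ≤ ua + ub) (ht : 0 < t) :
    IsMinimizer a b ua ub a t a :=
  isMinimizer_self_left hab ht le_rfl (stepData_left hab hua.le) (by positivity)
    (by positivity)

lemma case3_min_b (hab : a < b) (hub : ub < 0) (ht : 0 < t) (hr : 0 < r)
    (hr2 : r ^ 2 = 2 * t * (ua + ub)) (h : r ≤ b - a) : IsMinimizer a b ua ub b t b := by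
  have hB := mul_pos_of_neg_of_neg hub (neg_neg_of_pos ht)
  refine isMinimizer_self_right hab ht le_rfl (stepData_right' hab hub) ?_ ?_ <;> nlinarith

lemma case3_front_c (hac : a < c) (hcb : c < b) (hua : 0 < ua) (hub : ub < 0)
    (huab : 0 < ua + ub) (ht : 0 < t) : IsFront a b ua ub c t (Case3.γc a b c ua ub t) := by
  have hab := hac.trans hcb
  obtain ⟨p, q, hp, hq, hp2, hq2, ep, eq, ip, iq, is, ix, ix'⟩ :=
    mixed_roots (c := c) hab hua hub ht
  obtain ⟨r, hr, hr2, -, er, ir, hrs⟩ := case3_root hab huab ht hp2 hq2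
  simp only [Case3.γc, Case3.xStar, Case3.tStar, ep, eq, er, ip _ (sub_nonneg.2 hac.le),
    iq _ (sub_nonneg.2 hcb.le), ir _ (sub_nonneg.2 hab.le), is, ix, ix']
  have shock : ¬ p + q ≤ b - a → r ≤ b - a →
      IsFront a b ua ub c t ((a + b) / 2 + (ua + ub) / (b - a) * t) := fun h h' =>
    mixed_front_shock hac hcb hua hub ht hq hp2 hq2 h (hrs h').1 (hrs h').2
  have last : ¬ r ≤ b - a → IsFront a b ua ub c t (a + r) := fun h => by
    obtain ⟨h6, h4, h5⟩ := case3_last hab hua hub ht hr2 (not_le.1 h)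
    exact ⟨_, _, hac.le, by linarith, h4, h5⟩
  split_ifs with h1 h2 h3 h4 h2 h3 h4 h3 h4 h5
  · exact (mixed_front_of_lt hac hcb hua ht hp hq hp2 hq2 h1).1 h2
  · exact (mixed_front_of_lt hac hcb hua ht hp hq hp2 hq2 h1).2 h2 h3
  · exact shock h3 h4
  · exact last h4
  · exact mixed_front_of_eq hac hcb ht hp hq hp2 hq2 h2 h3
  · exact shock h3 h4
  · exact last h4
  -- What remains is c > x*, so the front coming from b is the one that can reach c before the
  -- collision.
  all_goals have h6 := lt_of_le_of_ne (not_lt.1 h1) (Ne.symm h2)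
  · exact (mixed_front_of_gt hac hcb hub ht hp hq hp2 hq2 h6).1 (by assumption)
  · exact (mixed_front_of_gt hac hcb hub ht hp hq hp2 hq2 h6).2 (by assumption) (by assumption)
  · exact shock (by assumption) (by assumption)
  · exact last (by assumption)

lemma case3_front_d (hab : a < b) (hbd : b < d) (hua : 0 < ua) (hub : ub < 0)
    (huab : 0 < ua + ub) (ht : 0 < t) : IsFront a b ua ub d t (Case3.γd a d ua ub t) := by
  have had := hab.trans hbd
  have hB := mul_pos_of_neg_of_neg hub (neg_neg_of_pos ht)
  obtain ⟨p, q, hp, hq, hp2, hq2, -⟩ := mixed_roots (c := d) hab hua hub ht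
  obtain ⟨r, hr, hr2, -, er, ir, -⟩ := case3_root hab huab ht hp2 hq2
  simp only [Case3.γd, er, ir _ (sub_nonneg.2 had.le)]
  split_ifs with h
  · refine isFront_self (isMinimizer_self_right hab ht hbd.le (stepData_of_gt hab hbd) ?_ ?_)
      <;> nlinarith
  · obtain ⟨h6, h4, h5⟩ := case3_last hab hua hub ht hr2 (by linarith)
    exact ⟨_, _, had.le, by linarith, h4, h5⟩

lemma mixed_velocity_mid (hab : a < b) (hua : 0 < ua) (hub : ub < 0) (ht : 0 < t)
    (hp : 0 < p) (hq : 0 < q) (hp2 : p ^ 2 = 2 * t * ua) (hq2 : q ^ 2 = -(2 * t * ub))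
    (h : p + q ≤ b - a) {x y : ℝ} (hx : x ∈ Ioo (a + p) (b - q))
    (hy : IsMinimizer a b ua ub x t y) : y = x := by
  obtain ⟨h3, -, h5⟩ := mixed_first_left hab hua ht hp hq hp2 hq2 h
  obtain ⟨h4, -, h6⟩ := mixed_first_right hab hub ht hp hq hp2 hq2 h
  exact eq_self_of_mem_Ioo ht (by linarith) (by linarith) h3 h4 h5 h6 hx hy

lemma case3_velocity_Z (hab : a < b) (hua : 0 < ua) (hub : ub < 0) (huab : 0 < ua + ub)
    (ht : 0 < t) {x y : ℝ}
    (hx : x ∈ Iio a ∪ Ioo (Case3.γa a b ua ub t) (Case3.γb₁ a b ua ub t)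
      ∪ Ioi (Case3.γb₂ a b ua ub t))
    (hy : IsMinimizer a b ua ub x t y) : y = x := by
  obtain ⟨p, q, hp, hq, hp2, hq2, ep, eq, ip, iq, is, -⟩ := mixed_roots (c := b) hab hua hub ht
  obtain ⟨r, hr, hr2, -, er, ir, -⟩ := case3_root hab huab ht hp2 hq2
  simp only [Case3.γa, Case3.γb₁, Case3.γb₂, Case3.tStar, ep, eq, er,
    ir _ (sub_nonneg.2 hab.le), is] at hx
  rcases hx with (hx | hx) | hx
  · exact eq_self_of_lt hab ht le_rfl (stepData_left hab hua.le)
      (case3_min_a hab hua huab.le ht) hx hy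
  · split_ifs at hx with h1 h2
    · exact mixed_velocity_mid hab hua hub ht hp hq hp2 hq2 h1 hx hy
    · exact absurd hx (by simp)
    · exact absurd hx (by simp)
  · split_ifs at hx with h1
    · exact eq_self_of_gt hab ht le_rfl (stepData_right' hab hub)
        (case3_min_b hab hub ht hr hr2 h1) hx hy
    · obtain ⟨h3, -, h5⟩ := case3_last hab hua hub ht hr2 (not_le.1 h1)
      exact eq_self_of_gt hab ht h3.le (stepData_of_gt hab h3) h5 hx hy

lemma case3_velocity_A (hab : a < b) (hua : 0 < ua) (hub : ub < 0) (huab : 0 < ua + ub)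
    (ht : 0 < t) {x y : ℝ} (hx : x ∈ Ioo a (Case3.γa a b ua ub t))
    (hy : IsMinimizer a b ua ub x t y) : y = a := by
  obtain ⟨p, q, hp, hq, hp2, hq2, ep, eq, ip, iq, is, -⟩ := mixed_roots (c := b) hab hua hub ht
  obtain ⟨r, hr, hr2, -, er, ir, hrs⟩ := case3_root hab huab ht hp2 hq2
  refine eq_of_isMinimizer_of_mem_Ioo ht (case3_min_a hab hua huab.le ht) ?_ hx hy
  simp only [Case3.γa, Case3.tStar, ep, er, ir _ (sub_nonneg.2 hab.le), is]
  split_ifs with h1 h2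
  · exact (mixed_first_left hab hua ht hp hq hp2 hq2 h1).2.1
  · exact (mixed_shock hab hua hub ht hq hp2 hq2 (not_le.1 h1).le (hrs h2).1 (hrs h2).2 rfl).1
  · exact (case3_last hab hua hub ht hr2 (not_le.1 h2)).2.1

lemma case3_velocity_B (hab : a < b) (hua : 0 < ua) (hub : ub < 0) (huab : 0 < ua + ub)
    (ht : 0 < t) {x y : ℝ} (hx : x ∈ Ioo (Case3.γb₁ a b ua ub t) (Case3.γb₂ a b ua ub t))
    (hy : IsMinimizer a b ua ub x t y) : y = b := by
  obtain ⟨p, q, hp, hq, hp2, hq2, ep, eq, ip, iq, is, -⟩ := mixed_roots (c := b) hab hua hub ht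
  obtain ⟨r, hr, hr2, hrr, er, ir, hrs⟩ := case3_root hab huab ht hp2 hq2
  simp only [Case3.γb₁, Case3.γb₂, Case3.tStar, eq, er, ir _ (sub_nonneg.2 hab.le), is] at hx
  by_cases h2 : r ≤ b - a
  · have h3 := case3_min_b hab hub ht hr hr2 h2
    simp only [h2, if_true] at hx
    split_ifs at hx with h1
    · exact eq_of_isMinimizer_of_mem_Ioo ht
        (mixed_first_right hab hub ht hp hq hp2 hq2 h1).2.1 h3 hx hy
    · exact eq_of_isMinimizer_of_mem_Ioo ht (mixed_shock hab hua hub ht hq hp2 hq2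
        (not_le.1 h1).le (hrs h2).1 (hrs h2).2 rfl).2 h3 hx hy
  · have h1 : ¬ p + q ≤ b - a := fun h => h2 (by nlinarith)
    simp [h1, h2] at hx

/-! The fourth case: `u_a + u_b < 0`. -/

/-- This is the third case reflected: the stronger negative mass drives the merged shock to the
left, and r ≤ b - a says that it has not yet passed a. -/
lemma case4_root (hab : a < b) (huab : ua + ub < 0) (ht : 0 < t)
    (hp2 : p ^ 2 = 2 * t * ua) (hq2 : q ^ 2 = -(2 * t * ub)) :
    ∃ r, 0 < r ∧ r ^ 2 = -(2 * t * (ua + ub)) ∧ r ^ 2 = q ^ 2 - p ^ 2 ∧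
      √(-2 * (ua + ub) * t) = r ∧
      (∀ D, 0 ≤ D → (t ≤ D ^ 2 / (-2 * (ua + ub)) ↔ r ≤ D)) ∧
      (r ≤ b - a → p ^ 2 - q ^ 2 ≤ (b - a) ^ 2 ∧ q ^ 2 - p ^ 2 ≤ (b - a) ^ 2) := by
  have h : 0 < -(ua + ub) := by linarith
  rw [show -2 * (ua + ub) = 2 * -(ua + ub) by ring]
  have hr : 0 < √(2 * -(ua + ub) * t) := sqrt_pos.2 (by positivity)
  have hr2 : √(2 * -(ua + ub) * t) ^ 2 = -(2 * t * (ua + ub)) := by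
    rw [sq_sqrt (by positivity)]; ring
  refine ⟨_, hr, hr2, by linarith, rfl, fun D hD => le_sq_div_iff h hD, fun h => ?_⟩
  constructor <;> nlinarith

lemma case4_last (hab : a < b) (hua : 0 < ua) (hub : ub < 0) (ht : 0 < t)
    (hr2 : r ^ 2 = -(2 * t * (ua + ub))) (h : b - a < r) :
    b - r < a ∧ IsMinimizer a b ua ub (b - r) t b ∧ IsMinimizer a b ua ub (b - r) t (b - r) := by
  have hA := mul_pos ht hua
  have har : b - r < a := by linarith
  refine ⟨har, isMinimizer_right_of_neg hab ht hub (by linarith) (Or.inr ⟨har.le, ?_⟩)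
    (Or.inr ?_), isMinimizer_self_left hab ht har.le (stepData_of_lt hab har) ?_ ?_⟩
    <;> nlinarith

lemma case4_min_a (hab : a < b) (hua : 0 < ua) (ht : 0 < t) (hr : 0 < r)
    (hr2 : r ^ 2 = -(2 * t * (ua + ub))) (h : r ≤ b - a) : IsMinimizer a b ua ub a t a := by
  have hA := mul_pos ht hua
  refine isMinimizer_self_left hab ht le_rfl (stepData_left hab hua.le) ?_ ?_ <;> nlinarith

lemma case4_min_b (hab : a < b) (hub : ub < 0) (huab : ua + ub ≤ 0) (ht : 0 < t) :
    IsMinimizer a b ua ub b t b := by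
  have hB := mul_pos_of_neg_of_neg hub (neg_neg_of_pos ht)
  have hAB := mul_nonpos_of_nonneg_of_nonpos ht.le huab
  refine isMinimizer_self_right hab ht le_rfl (stepData_right' hab hub) ?_ ?_ <;> nlinarith

lemma case4_front_c (hac : a < c) (hcb : c < b) (hua : 0 < ua) (hub : ub < 0)
    (huab : ua + ub < 0) (ht : 0 < t) : IsFront a b ua ub c t (Case4.γc a b c ua ub t) := by
  have hab := hac.trans hcb
  obtain ⟨p, q, hp, hq, hp2, hq2, ep, eq, ip, iq, is, ix, ix'⟩ :=
    mixed_roots (c := c) hab hua hub ht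
  obtain ⟨r, hr, hr2, -, er, ir, hrs⟩ := case4_root hab huab ht hp2 hq2
  simp only [Case4.γc, Case4.xStar, Case4.tStar, ep, eq, er, ip _ (sub_nonneg.2 hac.le),
    iq _ (sub_nonneg.2 hcb.le), ir _ (sub_nonneg.2 hab.le), is, ix, ix']
  have shock : ¬ p + q ≤ b - a → r ≤ b - a →
      IsFront a b ua ub c t ((a + b) / 2 + (ua + ub) / (b - a) * t) := fun h h' =>
    mixed_front_shock hac hcb hua hub ht hq hp2 hq2 h (hrs h').1 (hrs h').2
  have last : ¬ r ≤ b - a → IsFront a b ua ub c t (b - r) := fun h => by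
    obtain ⟨h6, h4, h5⟩ := case4_last hab hua hub ht hr2 (not_le.1 h)
    exact ⟨_, _, by linarith, hcb.le, h5, h4⟩
  split_ifs with h1 h2 h3 h4 h2 h3 h4 h3 h4 h5
  · exact (mixed_front_of_lt hac hcb hua ht hp hq hp2 hq2 h1).1 h2
  · exact (mixed_front_of_lt hac hcb hua ht hp hq hp2 hq2 h1).2 h2 h3
  · exact shock h3 h4
  · exact last h4
  · exact mixed_front_of_eq hac hcb ht hp hq hp2 hq2 h2 h3
  · exact shock h3 h4
  · exact last h4
  all_goals have h6 := lt_of_le_of_ne (not_lt.1 h1) (Ne.symm h2)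
  · exact (mixed_front_of_gt hac hcb hub ht hp hq hp2 hq2 h6).1 (by assumption)
  · exact (mixed_front_of_gt hac hcb hub ht hp hq hp2 hq2 h6).2 (by assumption) (by assumption)
  · exact shock (by assumption) (by assumption)
  · exact last (by assumption)

lemma case4_velocity_Z (hab : a < b) (hua : 0 < ua) (hub : ub < 0) (huab : ua + ub < 0)
    (ht : 0 < t) {x y : ℝ}
    (hx : x ∈ Iio (Case4.γa₁ a b ua ub t)
      ∪ Ioo (Case4.γa₂ a b ua ub t) (Case4.γb a b ua ub t) ∪ Ioi b)
    (hy : IsMinimizer a b ua ub x t y) : y = x := by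
  obtain ⟨p, q, hp, hq, hp2, hq2, ep, eq, ip, iq, is, -⟩ := mixed_roots (c := b) hab hua hub ht
  obtain ⟨r, hr, hr2, -, er, ir, -⟩ := case4_root hab huab ht hp2 hq2
  simp only [Case4.γa₁, Case4.γa₂, Case4.γb, Case4.tStar, ep, eq, er,
    ir _ (sub_nonneg.2 hab.le), is] at hx
  rcases hx with (hx | hx) | hx
  · split_ifs at hx with h1
    · exact eq_self_of_lt hab ht le_rfl (stepData_left hab hua.le)
        (case4_min_a hab hua ht hr hr2 h1) hx hy
    · obtain ⟨h3, -, h5⟩ := case4_last hab hua hub ht hr2 (not_le.1 h1)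
      exact eq_self_of_lt hab ht h3.le (stepData_of_lt hab h3) h5 hx hy
  · split_ifs at hx with h1 h2
    · exact mixed_velocity_mid hab hua hub ht hp hq hp2 hq2 h1 hx hy
    · exact absurd hx (by simp)
    · exact absurd hx (by simp)
  · exact eq_self_of_gt hab ht le_rfl (stepData_right' hab hub)
      (case4_min_b hab hub huab.le ht) hx hy

lemma case4_velocity_A (hab : a < b) (hua : 0 < ua) (hub : ub < 0) (huab : ua + ub < 0)
    (ht : 0 < t) {x y : ℝ} (hx : x ∈ Ioo (Case4.γa₁ a b ua ub t) (Case4.γa₂ a b ua ub t))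
    (hy : IsMinimizer a b ua ub x t y) : y = a := by
  obtain ⟨p, q, hp, hq, hp2, hq2, ep, eq, ip, iq, is, -⟩ := mixed_roots (c := b) hab hua hub ht
  obtain ⟨r, hr, hr2, hrr, er, ir, hrs⟩ := case4_root hab huab ht hp2 hq2
  simp only [Case4.γa₁, Case4.γa₂, Case4.tStar, ep, er, ir _ (sub_nonneg.2 hab.le), is] at hx
  by_cases h2 : r ≤ b - a
  · have h3 := case4_min_a hab hua ht hr hr2 h2
    simp only [h2, if_true] at hx
    split_ifs at hx with h1
    · exact eq_of_isMinimizer_of_mem_Ioo ht h3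
        (mixed_first_left hab hua ht hp hq hp2 hq2 h1).2.1 hx hy
    · exact eq_of_isMinimizer_of_mem_Ioo ht h3 (mixed_shock hab hua hub ht hq hp2 hq2
        (not_le.1 h1).le (hrs h2).1 (hrs h2).2 rfl).1 hx hy
  · have h1 : ¬ p + q ≤ b - a := fun h => h2 (by nlinarith)
    simp [h1, h2] at hx

lemma case4_velocity_B (hab : a < b) (hua : 0 < ua) (hub : ub < 0) (huab : ua + ub < 0)
    (ht : 0 < t) {x y : ℝ} (hx : x ∈ Ioo (Case4.γb a b ua ub t) b)
    (hy : IsMinimizer a b ua ub x t y) : y = b := by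
  obtain ⟨p, q, hp, hq, hp2, hq2, ep, eq, ip, iq, is, -⟩ := mixed_roots (c := b) hab hua hub ht
  obtain ⟨r, hr, hr2, hrr, er, ir, hrs⟩ := case4_root hab huab ht hp2 hq2
  refine eq_of_isMinimizer_of_mem_Ioo ht ?_ (case4_min_b hab hub huab.le ht) hx hy
  simp only [Case4.γb, Case4.tStar, eq, er, ir _ (sub_nonneg.2 hab.le), is]
  split_ifs with h1 h2
  · exact (mixed_first_right hab hub ht hp hq hp2 hq2 h1).2.1
  · exact (mixed_shock hab hua hub ht hq hp2 hq2 (not_le.1 h1).le (hrs h2).1 (hrs h2).2 rfl).2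
  · exact (case4_last hab hua hub ht hr2 (not_le.1 h2)).2.1

/-! The fifth case: `u_a + u_b = 0`. -/

/-- Opposite masses give p = q, so the point of equal cost is the midpoint at all later times: the
merged shock stands still. -/
lemma case5_shock (hab : a < b) (hua : 0 < ua) (hub : ub < 0) (huab : ua + ub = 0) (ht : 0 < t)
    (hq : 0 < q) (hp2 : p ^ 2 = 2 * t * ua) (hq2 : q ^ 2 = -(2 * t * ub))
    (h : ¬ p + q ≤ b - a) :
    IsMinimizer a b ua ub ((a + b) / 2) t a ∧ IsMinimizer a b ua ub ((a + b) / 2) t b := by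
  have e : p ^ 2 - q ^ 2 = 0 := by
    rw [hp2, hq2, sub_neg_eq_add, ← mul_add, huab, mul_zero]
  have hD := sq_nonneg (b - a)
  exact mixed_shock hab hua hub ht hq hp2 hq2 (not_le.1 h).le (by linarith) (by linarith)
    (by rw [huab]; ring)

/-- With p = q the product comparison of c with x* is just comparison with (a + b)/2, so the lemmas
on approaching fronts apply directly. -/
lemma case5_front_c (hac : a < c) (hcb : c < b) (hua : 0 < ua) (hub : ub < 0)
    (huab : ua + ub = 0) (ht : 0 < t) : IsFront a b ua ub c t (Case5.γc a b c ua ub t) := by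
  have hab := hac.trans hcb
  obtain ⟨p, q, hp, hq, hp2, hq2, ep, eq, ip, iq, is, -⟩ :=
    mixed_roots (c := c) hab hua hub ht
  have hpq : p = q := by
    refine (pow_left_inj₀ hp.le hq.le two_ne_zero).1 ?_
    rw [hp2, hq2, show ub = -ua by linarith]
    ring
  simp only [Case5.γc, Case5.tStar, ep, eq, ip _ (sub_nonneg.2 hac.le),
    iq _ (sub_nonneg.2 hcb.le), is]
  have shock : ¬ p + q ≤ b - a → IsFront a b ua ub c t ((a + b) / 2) := fun h => by
    obtain ⟨h4, h5⟩ := case5_shock hab hua hub huab ht hq hp2 hq2 h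
    exact ⟨_, _, hac.le, hcb.le, h4, h5⟩
  split_ifs with h1 h2 h3 h2 h3 h4
  · exact (mixed_front_of_lt hac hcb hua ht hp hq hp2 hq2 (by nlinarith)).1 h2
  · exact (mixed_front_of_lt hac hcb hua ht hp hq hp2 hq2 (by nlinarith)).2 h2 h3
  · exact shock h3
  · by_cases h : p + q ≤ b - a
    · rw [← h2]
      exact mixed_front_of_eq hac hcb ht hp hq hp2 hq2 (by rw [h2, hpq]; ring) h
    · exact shock h
  all_goals have h5 := lt_of_le_of_ne (not_lt.1 h1) (Ne.symm h2)
  · exact (mixed_front_of_gt hac hcb hub ht hp hq hp2 hq2 (by nlinarith)).1 h3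
  · exact (mixed_front_of_gt hac hcb hub ht hp hq hp2 hq2 (by nlinarith)).2 h3 h4
  · exact shock h4

lemma case5_velocity_Z (hab : a < b) (hua : 0 < ua) (hub : ub < 0) (huab : ua + ub = 0)
    (ht : 0 < t) {x y : ℝ}
    (hx : x ∈ Iio a ∪ Ioo (Case5.γa a b ua ub t) (Case5.γb a b ua ub t) ∪ Ioi b)
    (hy : IsMinimizer a b ua ub x t y) : y = x := by
  obtain ⟨p, q, hp, hq, hp2, hq2, ep, eq, ip, iq, is, -⟩ := mixed_roots (c := b) hab hua hub ht
  simp only [Case5.γa, Case5.γb, Case5.tStar, ep, eq, is] at hx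
  rcases hx with (hx | hx) | hx
  · exact eq_self_of_lt hab ht le_rfl (stepData_left hab hua.le)
      (case3_min_a hab hua huab.ge ht) hx hy
  · split_ifs at hx with h1
    · exact mixed_velocity_mid hab hua hub ht hp hq hp2 hq2 h1 hx hy
    · exact absurd hx (by simp)
  · exact eq_self_of_gt hab ht le_rfl (stepData_right' hab hub)
      (case4_min_b hab hub huab.le ht) hx hy

lemma case5_velocity_A (hab : a < b) (hua : 0 < ua) (hub : ub < 0) (huab : ua + ub = 0)
    (ht : 0 < t) {x y : ℝ} (hx : x ∈ Ioo a (Case5.γa a b ua ub t))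
    (hy : IsMinimizer a b ua ub x t y) : y = a := by
  obtain ⟨p, q, hp, hq, hp2, hq2, ep, eq, ip, iq, is, -⟩ := mixed_roots (c := b) hab hua hub ht
  refine eq_of_isMinimizer_of_mem_Ioo ht (case3_min_a hab hua huab.ge ht) ?_ hx hy
  simp only [Case5.γa, Case5.tStar, ep, is]
  split_ifs with h1
  · exact (mixed_first_left hab hua ht hp hq hp2 hq2 h1).2.1
  · exact (case5_shock hab hua hub huab ht hq hp2 hq2 h1).1

lemma case5_velocity_B (hab : a < b) (hua : 0 < ua) (hub : ub < 0) (huab : ua + ub = 0)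
    (ht : 0 < t) {x y : ℝ} (hx : x ∈ Ioo (Case5.γb a b ua ub t) b)
    (hy : IsMinimizer a b ua ub x t y) : y = b := by
  obtain ⟨p, q, hp, hq, hp2, hq2, ep, eq, ip, iq, is, -⟩ := mixed_roots (c := b) hab hua hub ht
  refine eq_of_isMinimizer_of_mem_Ioo ht ?_ (case4_min_b hab hub huab.le ht) hx hy
  simp only [Case5.γb, Case5.tStar, eq, is]
  split_ifs with h1
  · exact (mixed_first_right hab hub ht hp hq hp2 hq2 h1).2.1
  · exact (case5_shock hab hua hub huab ht hq hp2 hq2 h1).2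

end CaseMixed

end

theorem mainTheorem1 (a b c d ua ub ρc ρd : ℝ) (hac : a < c) (hcb : c < b) (hbd : b < d) :
    -- the explicit formulas give approximate solutions
    (∀ ε : ℝ, 0 < ε → IsApproximateSolution a b c d ua ub ρc ρd ε
      (explicitU a b ua ub ε) (explicitρ a b c d ua ub ρc ρd ε)) ∧
    -- and all approximate solutions have the following limits
    (∀ u ρ : ℝ → ℝ → ℝ → ℝ,
      (∀ ε : ℝ, 0 < ε → IsApproximateSolution a b c d ua ub ρc ρd ε (u ε) (ρ ε)) →
      (ua < 0 → 0 < ub →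
        VelocityLimit u a b
          (fun t => Iio (Case1.γa a ua t) ∪ Ioo a b ∪ Ioi (Case1.γb b ub t))
          (fun t => Ioo (Case1.γa a ua t) a)
          (fun t => Ioo b (Case1.γb b ub t)) ∧
        DensityLimit ρ ρc ρd (Case1.γc c) (Case1.γd b d ub)) ∧
      (0 < ua → 0 < ub →
        VelocityLimit u a b
          (fun t => Iio a ∪ Ioo (Case2.γa a b ua ub t) (Case2.γb₁ a b ua ub t)
            ∪ Ioi (Case2.γb₂ a b ua ub t))
          (fun t => Ioo a (Case2.γa a b ua ub t))
          (fun t => Ioo (Case2.γb₁ a b ua ub t) (Case2.γb₂ a b ua ub t)) ∧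
        DensityLimit ρ ρc ρd (Case2.γc a b c ua ub) (Case2.γd a b d ua ub)) ∧
      (0 < ua → ub < 0 → 0 < ua + ub →
        VelocityLimit u a b
          (fun t => Iio a ∪ Ioo (Case3.γa a b ua ub t) (Case3.γb₁ a b ua ub t)
            ∪ Ioi (Case3.γb₂ a b ua ub t))
          (fun t => Ioo a (Case3.γa a b ua ub t))
          (fun t => Ioo (Case3.γb₁ a b ua ub t) (Case3.γb₂ a b ua ub t)) ∧
        DensityLimit ρ ρc ρd (Case3.γc a b c ua ub) (Case3.γd a d ua ub)) ∧
      (0 < ua → ub < 0 → ua + ub < 0 →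
        VelocityLimit u a b
          (fun t => Iio (Case4.γa₁ a b ua ub t)
            ∪ Ioo (Case4.γa₂ a b ua ub t) (Case4.γb a b ua ub t) ∪ Ioi b)
          (fun t => Ioo (Case4.γa₁ a b ua ub t) (Case4.γa₂ a b ua ub t))
          (fun t => Ioo (Case4.γb a b ua ub t) b) ∧
        DensityLimit ρ ρc ρd (Case4.γc a b c ua ub) (Case4.γd d)) ∧
      (0 < ua → ub < 0 → ua + ub = 0 →
        VelocityLimit u a b
          (fun t => Iio a ∪ Ioo (Case5.γa a b ua ub t) (Case5.γb a b ua ub t) ∪ Ioi b)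
          (fun t => Ioo a (Case5.γa a b ua ub t))
          (fun t => Ioo (Case5.γb a b ua ub t) b) ∧
        DensityLimit ρ ρc ρd (Case5.γc a b c ua ub) (Case5.γd d)) ∧
      (ua < 0 → ub < 0 →
        VelocityLimit u a b
          (fun t => Iio (Case6.γa₁ a b ua ub t)
            ∪ Ioo (Case6.γa₂ a b ua ub t) (Case6.γb a b ua ub t) ∪ Ioi b)
          (fun t => Ioo (Case6.γa₁ a b ua ub t) (Case6.γa₂ a b ua ub t))
          (fun t => Ioo (Case6.γb a b ua ub t) b) ∧
        DensityLimit ρ ρc ρd (Case6.γc a b c ua ub) (Case6.γd d))) := by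
  have hab := hac.trans hcb
  refine ⟨fun ε hε => isApproximateSolution_explicit hac hcb hbd hε,
    fun u ρ h => ⟨fun hua hub => ?_, fun hua hub => ?_, fun hua hub huab => ?_,
      fun hua hub huab => ?_, fun hua hub huab => ?_, fun hua hub => ?_⟩⟩
  · exact ⟨velocityLimit_of_unique hac hcb hbd h
        (fun t ht x hx y hy => case1_velocity_Z hab hua hub ht hx hy)
        (fun t ht x hx y hy => case1_velocity_A hab hua hub ht hx hy)
        (fun t ht x hx y hy => case1_velocity_B hab hua hub ht hx hy),
      densityLimit_of_isFront hac hcb hbd h (fun t ht => case1_front_c hac hcb hua hub ht)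
        (fun t ht => case1_front_d hab hbd hua hub ht)⟩
  · exact ⟨velocityLimit_of_unique hac hcb hbd h
        (fun t ht x hx y hy => case2_velocity_Z hab hua hub ht hx hy)
        (fun t ht x hx y hy => case2_velocity_A hab hua hub ht hx hy)
        (fun t ht x hx y hy => case2_velocity_B hab hua hub ht hx hy),
      densityLimit_of_isFront hac hcb hbd h (fun t ht => case2_front_c hac hcb hua hub ht)
        (fun t ht => case2_front_d hab hbd hua hub ht)⟩
  · exact ⟨velocityLimit_of_unique hac hcb hbd h
        (fun t ht x hx y hy => case3_velocity_Z hab hua hub huab ht hx hy)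
        (fun t ht x hx y hy => case3_velocity_A hab hua hub huab ht hx hy)
        (fun t ht x hx y hy => case3_velocity_B hab hua hub huab ht hx hy),
      densityLimit_of_isFront hac hcb hbd h (fun t ht => case3_front_c hac hcb hua hub huab ht)
        (fun t ht => case3_front_d hab hbd hua hub huab ht)⟩
  · exact ⟨velocityLimit_of_unique hac hcb hbd h
        (fun t ht x hx y hy => case4_velocity_Z hab hua hub huab ht hx hy)
        (fun t ht x hx y hy => case4_velocity_A hab hua hub huab ht hx hy)
        (fun t ht x hx y hy => case4_velocity_B hab hua hub huab ht hx hy),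
      densityLimit_of_isFront hac hcb hbd h (fun t ht => case4_front_c hac hcb hua hub huab ht)
        (fun t ht => isFront_const_right hab hbd hub.le huab.le ht)⟩
  · exact ⟨velocityLimit_of_unique hac hcb hbd h
        (fun t ht x hx y hy => case5_velocity_Z hab hua hub huab ht hx hy)
        (fun t ht x hx y hy => case5_velocity_A hab hua hub huab ht hx hy)
        (fun t ht x hx y hy => case5_velocity_B hab hua hub huab ht hx hy),
      densityLimit_of_isFront hac hcb hbd h (fun t ht => case5_front_c hac hcb hua hub huab ht)
        (fun t ht => isFront_const_right hab hbd hub.le huab.le ht)⟩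
  · exact ⟨velocityLimit_of_unique hac hcb hbd h
        (fun t ht x hx y hy => case6_velocity_Z hab hua hub ht hx hy)
        (fun t ht x hx y hy => case6_velocity_A hab hua hub ht hx hy)
        (fun t ht x hx y hy => case6_velocity_B hab hua hub ht hx hy),
      densityLimit_of_isFront hac hcb hbd h (fun t ht => case6_front_c hac hcb hua hub ht)
        (fun t ht => isFront_const_right hab hbd hub.le (add_neg hua hub).le ht)⟩
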